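/- Let $d\ge 0$ be an integer and let $f,g\in\mathcal D'(\mathbb R^d)$ be complex-valued distributions. Suppose that for every $x\in\operatorname{singsupp}(f)\cap\operatorname{singsupp}(g)$ there are test functions $\varphi_f,\varphi_g\in\mathcal D(\mathbb R^d)$ with $\varphi_f(x)\ne0$, $\varphi_g(x)\neq 0$, and numbers $\alpha>0$, $\beta<0$ (all allowed to depend on $x$) such that $\varphi_f f\in\mathcal C^\alpha_c(\mathbb R^d)$, $\varphi_g g\in\mathcal C^\beta_c(\mathbb R^d)$ and $$\alpha+\beta^*_{\varphi_g g}>0 .$$ Then $f$ and $g$ have a unique canonical product $f\cdot g=\Delta^*(f\otimes g)\in\mathcal D'(\mathbb R^d)$. Here the notions are the following. For $r\in\mathbb N$ let $\mathcal B^r$ be the set of test functions $\psi$ with support in the open unit ball and $\|\psi\|_{C^r}\le1$, and for an integer $m\ge0$ let $\mathcal B^r_m$ be the set of those $\psi\in\mathcal B^r$ with $\int y^k\psi(y)\,dy=0$ for all multi-indices $|k|\le m$. Put $\psi_x^\lambda(y)=\lambda^{-d}\psi((x-y)/\lambda)$ and $\psi_x=\psi_x^1$. - For $\alpha>0$, $\mathcal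 C^\alpha_c$ is the set of compactly supported distributions given by a function $F$ of class $C^m$, $m$ being the largest integer $<\alpha$, such that for every compact $K$ there is $C$ with $|F(y)-\sum_{|k|<\alpha}\partial^kF(x)(y-x)^k/k!|\le C|x-y|^\alpha$ for all $x,y\in K$. - For $\beta<0$, $\mathcal C^\beta_c$ is the set of compactly supported distributions $u$ such that for every compact $K$ there is $C$ with $|u(\psi_x^\lambda)|\le C\lambda^\beta$ for all $x\in K$, $\lambda\in(0,1]$, $\psi\in\mathcal B^r$, where $r$ is the smallest integer $>-\beta$. - For $\gamma\le 0$ and $p\in[2,\infty]$, a distribution $u$ is in $B^\gamma_{p,\infty,\mathrm{loc}}(\mathbb R^d)$ if for some integer $r>-\gamma$ (the choice does not matter) and every compact $K$: if $\gamma<0$, $\sup_{n\ge0}2^{n\gamma}\big\|\sup_{\psi\in\mathcal B^r}|u(\psi_x^{2^{-n}})|\big\|_{L^p(K)}<\infty$; if $\gamma=0$, $\big\|\sup_{\psi\in\mathcal B^r}|u(\psi_x)|\big\|_{L^p(K)}+\sup_{n\ge0}\big\|\sup_{\psi\in\mathcal B^r_0}|u(\psi_x^{2^{-n}})|\big\|_{L^p(K)}<\infty$.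 Further, $\beta^*_u=\sup\{\gamma\le0: u\in B^\gamma_{p,\infty,\mathrm{loc}}(\mathbb R^d)\text{ for some }p\in[2,\infty]\}$. - $f\otimes g\in\mathcal D'(\mathbb R^d\times\mathbb R^d)$ is the tensor product, and $h=\Delta^*u$, the pull-back of $u\in\mathcal D'(\mathbb R^d\times\mathbb R^d)$ along the diagonal map $\Delta(x)=(x,x)$, means the extension by continuity of $F\mapsto F\circ\Delta$: for every sequence of test functions $\Theta_n$ on $\mathbb R^d\times\mathbb R^d$ with $\int\Theta_n=1$, $\sup_n\|\Theta_n\|_{L^1}<\infty$ and supports shrinking to $\{0\}$, the functions $(u*\Theta_n)\circ\Delta$ converge to $h$ in $\mathcal D'(\mathbb R^d)$. -/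

import Mathlib

open MeasureTheory Filter TopologicalSpace Topology
open scoped ENNReal ContDiff Distributions

namespace MicrolocalYoung

noncomputable section

/-- Euclidean space `ℝ^d`. -/
abbrev Rd (d : ℕ) : Type := EuclideanSpace ℝ (Fin d)

/-- Real test functions on a whole normed space. -/
abbrev Test (E : Type) [NormedAddCommGroup E] [NormedSpace ℝ E] : Type :=
  𝓓((⊤ : Opens E), ℝ)

/-- Complex test functions on a whole normed space. -/
abbrev CTest (E : Type) [NormedAddCommGroup E] [NormedSpace ℝ E] : Type :=
  𝓓((⊤ : Opens E), ℂ)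

/-- Complex-valued distributions on a whole normed space (Mathlib tests them against real
test functions, which amounts to the same as testing `ℂ`-linearly against complex ones). -/
abbrev Distr (E : Type) [NormedAddCommGroup E] [NormedSpace ℝ E] : Type :=
  𝓓'((⊤ : Opens E), ℂ)

section TestFunctions

variable {E : Type} [NormedAddCommGroup E] [NormedSpace ℝ E]
variable {E' : Type} [NormedAddCommGroup E'] [NormedSpace ℝ E']

/-- The test function `q ↦ Θ (p - q)`. -/
def reflect (Θ : Test E) (p : E) : Test E where
  toFun q := Θ (p - q)
  contDiff' := Θ.contDiff.comp (contDiff_const.sub contDiff_id)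
  hasCompactSupport' := Θ.hasCompactSupport.comp_homeomorph (Homeomorph.subLeft p)
  tsupport_subset' := fun _ _ => trivial

/-- The rescaled test function `y ↦ lam ^ (-dim E) * ψ ((x - y) / lam)`. -/
def rescale (ψ : Test E) (x : E) (lam : ℝ) (hlam : 0 < lam) : Test E where
  toFun y := (lam ^ Module.finrank ℝ E)⁻¹ * ψ (lam⁻¹ • (x - y))
  contDiff' := contDiff_const.mul
    (ψ.contDiff.comp ((contDiff_const.sub contDiff_id).const_smul lam⁻¹))
  hasCompactSupport' := (ψ.hasCompactSupport.comp_homeomorph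
    ((Homeomorph.subLeft x).trans
      (Homeomorph.smulOfNeZero lam⁻¹ (inv_ne_zero hlam.ne')))).mul_left
  tsupport_subset' := fun _ _ => trivial

/-- The tensor product `(x, y) ↦ φ x * ψ y` of two test functions. -/
def tensorTest (φ : Test E) (ψ : Test E') : Test (E × E') where
  toFun p := φ p.1 * ψ p.2
  contDiff' := (φ.contDiff.comp contDiff_fst).mul (ψ.contDiff.comp contDiff_snd)
  hasCompactSupport' := by
    refine HasCompactSupport.intro
      (φ.hasCompactSupport.isCompact.prod ψ.hasCompactSupport.isCompact) ?_
    rintro ⟨x, y⟩ h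
    by_cases hx : x ∈ tsupport φ
    · have hy : y ∉ tsupport ψ := fun hy => h ⟨hx, hy⟩
      simp [image_eq_zero_of_notMem_tsupport hy]
    · simp [image_eq_zero_of_notMem_tsupport hx]
  tsupport_subset' := fun _ _ => trivial

/-- Multiplication `ψ ↦ ψ a` of test functions by a smooth function `a`. -/
def mulCLM (a : E → ℝ) (ha : ContDiff ℝ ∞ a) : Test E →L[ℝ] Test E :=
  TestFunction.limitCLM ℝ
    (fun ψ => (⟨fun x => ψ x * a x, ψ.contDiff.mul ha, ψ.hasCompactSupport.mul_right,
      fun _ _ => trivial⟩ : Test E))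
    (fun _ hK => TestFunction.ofSupportedInCLM ℝ hK ∘L
      ContDiffMapSupportedIn.bilinLeftCLM (ContinuousLinearMap.mul ℝ ℝ) ha)
    (fun _ _ _ => rfl)

theorem contDiff_re (φ : CTest E) : ContDiff ℝ ∞ fun x => (φ x).re :=
  Complex.reCLM.contDiff.comp φ.contDiff

theorem contDiff_im (φ : CTest E) : ContDiff ℝ ∞ fun x => (φ x).im :=
  Complex.imCLM.contDiff.comp φ.contDiff

/-- The product `φ f` of a distribution with a complex test function,
`(φ f)(ψ) = f(φ ψ) = f(ψ Re φ) + i f(ψ Im φ)`. -/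
def localize (φ : CTest E) (f : Distr E) : Distr E where
  toFun ψ := f (mulCLM _ (contDiff_re φ) ψ) + Complex.I * f (mulCLM _ (contDiff_im φ) ψ)
  map_add' ψ χ := by simp only [map_add]; ring
  map_smul' c ψ := by
    simp only [map_smul, RingHom.id_apply, Complex.real_smul]; ring
  cont := (f.continuous.comp (mulCLM _ (contDiff_re φ)).continuous).add
    (continuous_const.mul (f.continuous.comp (mulCLM _ (contDiff_im φ)).continuous))

end TestFunctions

section SingularSupport

variable {d : ℕ}

/-- The singular support: the complement of the largest open set on which `f` is given by
integration against a smooth function. -/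
def singSupp (f : Distr (Rd d)) : Set (Rd d) :=
  {x | ¬ ∃ U : Set (Rd d), IsOpen U ∧ x ∈ U ∧ ∃ F : Rd d → ℂ, ContDiffOn ℝ ∞ F U ∧
    ∀ ψ : Test (Rd d), tsupport ψ ⊆ U → f ψ = ∫ y, (ψ y : ℂ) * F y}

end SingularSupport

section FunctionSpaces

variable {d : ℕ}

/-- Test functions supported in the open unit ball, with `C^r` norm at most one. -/
def unitTests (d r : ℕ) : Set (Test (Rd d)) :=
  {ψ | tsupport ψ ⊆ Metric.ball 0 1 ∧
    ∀ k : ℕ, k ≤ r → ∀ x, ‖iteratedFDeriv ℝ k (ψ : Rd d → ℝ) x‖ ≤ 1}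

/-- The elements of `unitTests d r` whose moments of order at most `m` vanish. -/
def unitTestsMoments (d r m : ℕ) : Set (Test (Rd d)) :=
  {ψ | ψ ∈ unitTests d r ∧
    ∀ k : Fin d → ℕ, ∑ i, k i ≤ m → ∫ x : Rd d, (∏ i, x i ^ k i) * ψ x = 0}

/-- Locally Hölder distributions of exponent `α > 0`: `f` is (integration against) a function `F`
of class `C^m`, where `m = ⌈α⌉ - 1` is the largest integer `< α`, whose Taylor polynomial of
order `m` approximates it up to `O(|x - y|^α)` locally uniformly. -/
def MemHolderPosLoc (α : ℝ) (f : Distr (Rd d)) : Prop :=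
  ∃ F : Rd d → ℂ, ContDiff ℝ ((⌈α⌉₊ - 1 : ℕ) : WithTop ℕ∞) F ∧
    (∀ K : Set (Rd d), IsCompact K → ∃ C : ℝ, ∀ x ∈ K, ∀ y ∈ K,
      ‖F y - ∑ j ∈ Finset.range ⌈α⌉₊,
        ((j.factorial : ℝ)⁻¹) • iteratedFDeriv ℝ j F x (fun _ => y - x)‖ ≤ C * ‖x - y‖ ^ α) ∧
    ∀ ψ : Test (Rd d), f ψ = ∫ y, (ψ y : ℂ) * F y

/-- Locally Hölder distributions of exponent `β < 0`; `⌊-β⌋ + 1` is the smallest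
integer `> -β`. -/
def MemHolderNegLoc (β : ℝ) (g : Distr (Rd d)) : Prop :=
  ∀ K : Set (Rd d), IsCompact K → ∃ C : ℝ, ∀ x ∈ K, ∀ lam : ℝ, ∀ hlam : 0 < lam, lam ≤ 1 →
    ∀ ψ ∈ unitTests d (⌊-β⌋₊ + 1), ‖g (rescale ψ x lam hlam)‖ ≤ C * lam ^ β

/-- Compactly supported Hölder distributions of exponent `α > 0`. -/
def MemHolderPosCompact (α : ℝ) (f : Distr (Rd d)) : Prop :=
  MemHolderPosLoc α f ∧ IsCompact (Distribution.dsupport f)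

/-- Compactly supported Hölder distributions of exponent `β < 0`. -/
def MemHolderNegCompact (β : ℝ) (g : Distr (Rd d)) : Prop :=
  MemHolderNegLoc β g ∧ IsCompact (Distribution.dsupport g)

/-- `x ↦ sup_{ψ ∈ B} |f(ψ_x^{2^{-n}})|`. -/
def scaleSup (f : Distr (Rd d)) (B : Set (Test (Rd d))) (n : ℕ) (x : Rd d) : ℝ≥0∞ :=
  ⨆ ψ ∈ B, ‖f (rescale ψ x ((1 / 2 : ℝ) ^ n) (by positivity))‖ₑ

/-- The quantity `‖ ‖ sup_{ψ ∈ B} |f(ψ_x^{2^{-n}})| / 2^{-nα} ‖_{L^p(K)} ‖_{ℓ^q(ℕ)}`. -/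
def scaleNorm (α : ℝ) (p q : ℝ≥0∞) (f : Distr (Rd d)) (B : Set (Test (Rd d)))
    (K : Set (Rd d)) : ℝ≥0∞ :=
  eLpNorm (fun n : ℕ => eLpNorm
    (fun x => ENNReal.ofReal ((2 : ℝ) ^ ((n : ℝ) * α)) * scaleSup f B n x)
    p (volume.restrict K)) q Measure.count

/-- The local Besov space `B^α_{p,q,loc}(ℝ^d)`. The space does not depend on the choice of
the integer `r > -α`. -/
def MemBesovLoc (α : ℝ) (p q : ℝ≥0∞) (f : Distr (Rd d)) : Prop :=
  ∃ r : ℕ, -α < r ∧ ∀ K : Set (Rd d), IsCompact K →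
    (α < 0 → scaleNorm α p q f (unitTests d r) K < ⊤) ∧
    (0 ≤ α → eLpNorm (scaleSup f (unitTests d r) 0) p (volume.restrict K) +
      scaleNorm α p q f (unitTestsMoments d r ⌊α⌋₊) K < ⊤)

/-- The exponent `β*_g = sup {γ ≤ 0 : g ∈ B^γ_{p,∞,loc} for some p ∈ [2,∞]}`. -/
def betaStar (g : Distr (Rd d)) : ℝ :=
  sSup {γ : ℝ | γ ≤ 0 ∧ ∃ p : ℝ≥0∞, 2 ≤ p ∧ MemBesovLoc γ p ⊤ g}

end FunctionSpaces

section CanonicalProduct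

/-- `u = f ⊗ g`. -/
def IsTensorProduct {d : ℕ} (f g : Distr (Rd d)) (u : Distr (Rd d × Rd d)) : Prop :=
  ∀ φ ψ : Test (Rd d), u (tensorTest φ ψ) = f φ * g ψ

/-- Strict delta sequences: integral one, bounded in `L^1`, supports shrinking to the origin. -/
structure IsDeltaSeq {E : Type} [NormedAddCommGroup E] [NormedSpace ℝ E] [MeasureSpace E]
    (Θ : ℕ → Test E) : Prop where
  integral_eq_one : ∀ n, ∫ p, Θ n p = 1
  bounded : ∃ C : ℝ, ∀ n, ∫ p, ‖Θ n p‖ ≤ C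
  shrinking : ∀ ε : ℝ, 0 < ε → ∀ᶠ n in atTop, tsupport (Θ n) ⊆ Metric.ball 0 ε

/-- The regularization `u * Θ`, a smooth function: `(u * Θ)(p) = u(Θ(p - ·))`. -/
def regularize {E : Type} [NormedAddCommGroup E] [NormedSpace ℝ E]
    (u : Distr E) (Θ : Test E) (p : E) : ℂ :=
  u (reflect Θ p)

/-- `h = Δ^* u`, the pull-back of `u` along the diagonal map `Δ x = (x, x)`. It extends the
pull-back `F ↦ F ∘ Δ` of functions by continuity: for all regularizations `u * Θ_n` of `u`, the
functions `(u * Θ_n) ∘ Δ` converge to `h` in the sense of distributions. -/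
def IsDiagonalPullback {d : ℕ} (u : Distr (Rd d × Rd d)) (h : Distr (Rd d)) : Prop :=
  ∀ Θ : ℕ → Test (Rd d × Rd d), IsDeltaSeq Θ → ∀ ψ : Test (Rd d),
    Tendsto (fun n => ∫ x, (ψ x : ℂ) * regularize u (Θ n) (x, x)) atTop (𝓝 (h ψ))

/-- `h` is the canonical product of `f` and `g`, that is `h = Δ^* (f ⊗ g)`. -/
def IsCanonicalProduct {d : ℕ} (f g h : Distr (Rd d)) : Prop :=
  ∃ u : Distr (Rd d × Rd d), IsTensorProduct f g u ∧ IsDiagonalPullback u h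

end CanonicalProduct

end

end MicrolocalYoung

/-! The question is local. Near a point where one factor is smooth, the regularized products
converge because the other distribution is continuous, so the substance lies at common singular
points. Near such a point `f` is a function `F` with polynomial approximations of order `α`. Testing
the diagonal of `(f ⊗ g) * Θ` against `η` gives `g` applied to `z ↦ ∫ η(z+b) F(z+b-a) Θ(a,b) da db`
(`smear_eq`, `integral_mul_regularize_left`). Along a delta sequence these functions converge
uniformly to `η F`, and the `L¹` bound on `Θ` keeps their estimates of order `α` bounded. It
therefore suffices to extend `g`, after cutting off, to functions of regularity `α`, continuously
for uniform convergence with bounded estimates.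

For the extension let `A_l` be averaging at scale `l` with a kernel `ρ` that reproduces polynomials
(`exists_kernel`), let `k_l(x)` be `g` applied to `ρ` rescaled to size `l` around `x`, and put
`S_l(H) = ∫ (A_l H) k_l = g(A_l A_l H)`. Since averages commute, `S_l(H) - S_l'(H) = ∫ (A_l H - A_l'
H)(k_l + k_l')` (`scalePair_sub`). For consecutive dyadic scales the first factor is `O(2^(-nα))`
uniformly and lives on a fixed compact set. On that set the second is `O((n+1) 2^(-nγ))` in `L¹`,
for some `γ > -α` such that `g` has Besov regularity `γ`. As `α + γ > 0`, the differences are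
summable, at a rate that sees `H` only through its constant of order `α` (`exists_rate`). At a fixed
scale `S_l` is continuous in the supremum norm, and `S_l(φ) → g(φ)` for test functions, so the
limits may be exchanged (`tendsto_pair_of_avgRate`). The bound at scale one shows that the limit has
finite order in the test function, hence is a distribution.

Local products are glued along cutoffs `χ₁ + χ₂ - χ₁χ₂`. For uniqueness take `Θ = θ ⊗ θ`: the
regularization then depends only on the values of `u` on tensors of test functions, that is, on `f`
and `g`. -/

namespace MicrolocalYoung

noncomputable section

set_option linter.unusedSectionVars false

/-! ### Complex-linear pairing and finite order -/

section Pairing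

variable {E : Type} [NormedAddCommGroup E] [NormedSpace ℝ E]

/-- Smooth compactly supported complex functions, unbundled. -/
structure IsTest (φ : E → ℂ) : Prop where
  smooth : ContDiff ℝ ∞ φ
  compact : HasCompactSupport φ

namespace IsTest

variable {φ ψ : E → ℂ}

theorem continuous (h : IsTest φ) : Continuous φ := h.smooth.continuous

theorem add (h : IsTest φ) (h' : IsTest ψ) : IsTest fun x => φ x + ψ x :=
  ⟨h.smooth.add h'.smooth, h.compact.add h'.compact⟩

theorem sub (h : IsTest φ) (h' : IsTest ψ) : IsTest fun x => φ x - ψ x :=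
  ⟨h.smooth.sub h'.smooth, h.compact.sub h'.compact⟩

theorem mul_left (h : IsTest φ) (h' : ContDiff ℝ ∞ ψ) : IsTest fun x => ψ x * φ x :=
  ⟨h'.mul h.smooth, h.compact.mul_left⟩

theorem mul_right (h : IsTest φ) (h' : ContDiff ℝ ∞ ψ) : IsTest fun x => φ x * ψ x :=
  ⟨h.smooth.mul h', h.compact.mul_right⟩

theorem const_mul (h : IsTest φ) (c : ℂ) : IsTest fun x => c * φ x :=
  h.mul_left contDiff_const

theorem comp_add_right (h : IsTest φ) (c : E) : IsTest fun x => φ (x + c) :=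
  ⟨h.smooth.comp (contDiff_id.add contDiff_const),
    h.compact.comp_homeomorph (Homeomorph.addRight c)⟩

theorem ofReal (ψ : Test E) : IsTest fun x => (ψ x : ℂ) :=
  ⟨Complex.ofRealCLM.contDiff.comp ψ.contDiff, ψ.hasCompactSupport.comp_left (g := Complex.ofReal) rfl⟩

theorem of_ctest (ψ : CTest E) : IsTest ψ := ⟨ψ.contDiff, ψ.hasCompactSupport⟩

theorem zero : IsTest (fun _ : E => (0 : ℂ)) :=
  ⟨contDiff_const, HasCompactSupport.zero⟩

end IsTest

/-- Bundled real part. -/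
def reTest (φ : E → ℂ) (h : IsTest φ) : Test E :=
  ⟨fun x => (φ x).re, Complex.reCLM.contDiff.comp h.smooth,
    h.compact.comp_left (g := Complex.re) rfl, fun _ _ => trivial⟩

/-- Bundled imaginary part. -/
def imTest (φ : E → ℂ) (h : IsTest φ) : Test E :=
  ⟨fun x => (φ x).im, Complex.imCLM.contDiff.comp h.smooth,
    h.compact.comp_left (g := Complex.im) rfl, fun _ _ => trivial⟩

@[simp] theorem reTest_apply (φ : E → ℂ) (h : IsTest φ) (x : E) : reTest φ h x = (φ x).re := rfl

@[simp] theorem imTest_apply (φ : E → ℂ) (h : IsTest φ) (x : E) : imTest φ h x = (φ x).im := rfl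

open Classical in
/-- The complex linear extension of a distribution to complex test functions. -/
def pair (g : Distr E) (φ : E → ℂ) : ℂ :=
  if h : IsTest φ then g (reTest φ h) + Complex.I * g (imTest φ h) else 0

theorem pair_def (g : Distr E) {φ : E → ℂ} (h : IsTest φ) :
    pair g φ = g (reTest φ h) + Complex.I * g (imTest φ h) := by
  rw [pair, dif_pos h]

theorem pair_ofReal (g : Distr E) (ψ : Test E) : pair g (fun x => (ψ x : ℂ)) = g ψ := by
  rw [pair_def g (IsTest.ofReal ψ)]
  have h1 : reTest _ (IsTest.ofReal ψ) = ψ := by ext x; simp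
  have h2 : imTest _ (IsTest.ofReal ψ) = 0 := by ext x; simp
  rw [h1, h2]; simp

theorem pair_add (g : Distr E) {φ ψ : E → ℂ} (h : IsTest φ) (h' : IsTest ψ) :
    pair g (fun x => φ x + ψ x) = pair g φ + pair g ψ := by
  rw [pair_def g h, pair_def g h', pair_def g (h.add h')]
  have h1 : reTest _ (h.add h') = reTest φ h + reTest ψ h' := by ext x; simp
  have h2 : imTest _ (h.add h') = imTest φ h + imTest ψ h' := by ext x; simp
  rw [h1, h2, map_add, map_add]; ring

theorem pair_const_mul (g : Distr E) {φ : E → ℂ} (h : IsTest φ) (c : ℂ) :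
    pair g (fun x => c * φ x) = c * pair g φ := by
  rw [pair_def g h, pair_def g (h.const_mul c)]
  have h1 : reTest _ (h.const_mul c) = c.re • reTest φ h - c.im • imTest φ h := by ext x; simp
  have h2 : imTest _ (h.const_mul c) = c.re • imTest φ h + c.im • reTest φ h := by ext x; simp
  rw [h1, h2, map_add, map_sub, map_smul, map_smul, map_smul, map_smul]
  simp only [Complex.real_smul]
  conv_rhs => rw [← Complex.re_add_im c]
  linear_combination -(c.im * g (imTest φ h)) * Complex.I_mul_I

theorem pair_sub (g : Distr E) {φ ψ : E → ℂ} (h : IsTest φ) (h' : IsTest ψ) :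
    pair g (fun x => φ x - ψ x) = pair g φ - pair g ψ := by
  have := pair_add g h (h'.const_mul (-1))
  rw [pair_const_mul g h'] at this
  rw [sub_eq_add_neg, ← neg_one_mul (pair g ψ), ← this]
  congr 1; ext x; ring

theorem pair_zero (g : Distr E) : pair g (fun _ => 0) = 0 := by
  have := pair_const_mul g (IsTest.zero (E := E)) 0
  simpa using this

/-- On a compact set a distribution has finite order. -/
theorem exists_bound_real (g : Distr E) {K : Set E} (hK : IsCompact K) :
    ∃ N : ℕ, ∃ C : ℝ, 0 ≤ C ∧ ∀ φ : Test E, tsupport φ ⊆ K → ∀ S : ℝ,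
      (∀ k ≤ N, ∀ x, ‖iteratedFDeriv ℝ k φ x‖ ≤ S) → ‖g φ‖ ≤ C * S := by
  let K' : Compacts E := ⟨K, hK⟩
  have hK' : (K' : Set E) ⊆ (⊤ : Opens E) := fun _ _ => trivial
  have hcont : Continuous fun φ : 𝓓_{K'}(E, ℝ) => g (TestFunction.ofSupportedInCLM ℝ hK' φ) :=
    g.continuous.comp (TestFunction.ofSupportedInCLM ℝ hK').continuous
  let q : Seminorm ℝ 𝓓_{K'}(E, ℝ) := (normSeminorm ℝ ℂ).comp
    (g.toLinearMap ∘ₗ (TestFunction.ofSupportedInCLM ℝ hK').toLinearMap)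
  have hq : Continuous q := hcont.norm
  obtain ⟨s, C, -, h⟩ := Seminorm.bound_of_continuous
    (ContDiffMapSupportedIn.withSeminorms ℝ E ℝ ⊤ K') q hq
  -- Continuity bounds `q` by finitely many seminorms, indexed by the orders in `s`; the largest of
  -- them serves as the order `N`.
  refine ⟨s.sup id, C, C.2, fun φ hφ S hS => ?_⟩
  have hS0 : 0 ≤ S := (norm_nonneg _).trans (hS 0 (Nat.zero_le _) 0)
  let φ' : 𝓓_{K'}(E, ℝ) := .of_support_subset φ.contDiff ((subset_tsupport _).trans hφ)
  have h1 : ‖g φ‖ ≤ C * (s.sup (ContDiffMapSupportedIn.seminorm ℝ E ℝ ⊤ K')) φ' := h φ'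
  refine h1.trans (mul_le_mul_of_nonneg_left (Seminorm.finset_sup_apply_le hS0 fun i hi => ?_) C.2)
  exact (ContDiffMapSupportedIn.seminorm_top_le_iff ℝ hS0 i φ').2
    fun x _ => hS i (Finset.le_sup (f := id) hi) x

theorem exists_bound (g : Distr E) {K : Set E} (hK : IsCompact K) :
    ∃ N : ℕ, ∃ C : ℝ, 0 ≤ C ∧ ∀ φ : E → ℂ, IsTest φ → tsupport φ ⊆ K → ∀ S : ℝ,
      (∀ k ≤ N, ∀ x, ‖iteratedFDeriv ℝ k φ x‖ ≤ S) → ‖pair g φ‖ ≤ C * S := by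
  obtain ⟨N, C, hC, h⟩ := exists_bound_real g hK
  refine ⟨N, C + C, by positivity, fun φ hφ hsupp S hS => ?_⟩
  have key : ∀ (L : ℂ →L[ℝ] ℝ), ‖L‖ ≤ 1 → ∀ k ≤ N, ∀ x, ‖iteratedFDeriv ℝ k (L ∘ φ) x‖ ≤ S := by
    intro L hL k hk x
    rw [L.iteratedFDeriv_comp_left hφ.smooth.contDiffAt (i := k) (mod_cast le_top)]
    refine (L.norm_compContinuousMultilinearMap_le _).trans ?_
    exact (mul_le_of_le_one_left (norm_nonneg _) hL).trans (hS k hk x)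
  rw [pair_def g hφ]
  refine (norm_add_le _ _).trans ?_
  rw [add_mul, norm_mul, Complex.norm_I, one_mul]
  refine add_le_add (h _ ?_ S (key Complex.reCLM (by simp))) (h _ ?_ S (key Complex.imCLM (by simp)))
  · exact (tsupport_comp_subset (g := Complex.re) rfl φ).trans hsupp
  · exact (tsupport_comp_subset (g := Complex.im) rfl φ).trans hsupp

/-- A linear functional on test functions that is of finite order on compact sets is a
distribution. -/
def mkDistr (T : Test E → ℂ) (hadd : ∀ φ ψ, T (φ + ψ) = T φ + T ψ)
    (hsmul : ∀ (c : ℝ) φ, T (c • φ) = c • T φ)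
    (hbound : ∀ K : Set E, IsCompact K → ∃ N : ℕ, ∃ C : ℝ, 0 ≤ C ∧ ∀ φ : Test E, tsupport φ ⊆ K →
      ∀ S : ℝ, (∀ k ≤ N, ∀ x, ‖iteratedFDeriv ℝ k φ x‖ ≤ S) → ‖T φ‖ ≤ C * S) : Distr E :=
  TestFunction.mkCLM ℝ T hadd hsmul fun K hK => by
    refine (ContDiffMapSupportedIn.mkCLMtoNormedSpace (𝕜 := ℝ)
      (fun φ => T (TestFunction.ofSupportedIn hK φ))
      (fun φ ψ => hadd (TestFunction.ofSupportedIn hK φ) (TestFunction.ofSupportedIn hK ψ)) (fun c φ => hsmul c (TestFunction.ofSupportedIn hK φ)) ?_).continuous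
    obtain ⟨N, C, hC, h⟩ := hbound K K.isCompact
    refine ⟨Finset.range (N + 1), C, hC, fun φ => h _ φ.tsupport_subset _ fun k hk x => ?_⟩
    refine (ContDiffMapSupportedIn.norm_iteratedFDeriv_apply_le_seminorm_top ℝ (f := φ)).trans ?_
    exact Seminorm.le_finset_sup_apply (Finset.mem_range.2 (by omega))

@[simp] theorem mkDistr_apply (T : Test E → ℂ) (hadd hsmul hbound) (φ : Test E) :
    mkDistr T hadd hsmul hbound φ = T φ := rfl

end Pairing

/-! ### Distributions applied to functions with a parameter -/

section Slices

variable {P E : Type} [NormedAddCommGroup P] [NormedSpace ℝ P]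
  [NormedAddCommGroup E] [NormedSpace ℝ E]

theorem norm_iteratedFDeriv_slice_le {Φ : P × E → ℂ} (h : ContDiff ℝ ∞ Φ) (p : P) (z : E) (k : ℕ) :
    ‖iteratedFDeriv ℝ k (fun z => Φ (p, z)) z‖ ≤ ‖iteratedFDeriv ℝ k Φ (p, z)‖ := by
  have h1 : (fun z => Φ (p, z)) = (fun q => Φ ((p, 0) + q)) ∘ ContinuousLinearMap.inr ℝ P E := by
    ext z; simp
  have h2 : ContDiff ℝ ∞ fun q => Φ ((p, 0) + q) := h.comp (contDiff_const.add contDiff_id)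
  rw [h1, ContinuousLinearMap.iteratedFDeriv_comp_right _ h2 z (i := k) (mod_cast le_top),
    iteratedFDeriv_comp_add_left]
  refine (ContinuousMultilinearMap.norm_compContinuousLinearMap_le _ _).trans ?_
  simp only [ContinuousLinearMap.inr_apply, Prod.mk_add_mk, add_zero, zero_add]
  refine mul_le_of_le_one_right (norm_nonneg _) (Finset.prod_le_one (fun _ _ => norm_nonneg _)
    fun _ _ => ContinuousLinearMap.norm_inr_le_one ℝ P E)

theorem support_slice_subset (Φ : P × E → ℂ) (p : P) :
    Function.support (fun z => Φ (p, z)) ⊆ Prod.snd '' tsupport Φ :=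
  fun z hz => ⟨(p, z), subset_tsupport _ hz, rfl⟩

theorem tsupport_slice_subset {Φ : P × E → ℂ} (h : HasCompactSupport Φ) (p : P) :
    tsupport (fun z => Φ (p, z)) ⊆ Prod.snd '' tsupport Φ :=
  closure_minimal (support_slice_subset Φ p) (h.isCompact.image continuous_snd).isClosed

theorem IsTest.slice {Φ : P × E → ℂ} (h : IsTest Φ) (p : P) : IsTest fun z => Φ (p, z) :=
  ⟨h.smooth.comp (contDiff_const.prodMk contDiff_id),
    HasCompactSupport.of_support_subset_isCompact (h.compact.isCompact.image continuous_snd)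
      (support_slice_subset Φ p)⟩

theorem IsTest.fderiv_apply {φ : E → ℂ} (h : IsTest φ) (v : E) : IsTest fun x => fderiv ℝ φ x v :=
  ⟨(h.smooth.fderiv_right (m := ∞) (by simp)).clm_apply contDiff_const,
    h.compact.fderiv_apply (𝕜 := ℝ) v⟩

theorem norm_iteratedFDeriv_fderiv_apply_le {φ : E → ℂ} (h : ContDiff ℝ ∞ φ) (v x : E) (k : ℕ) :
    ‖iteratedFDeriv ℝ k (fun y => fderiv ℝ φ y v) x‖ ≤ ‖iteratedFDeriv ℝ (k + 1) φ x‖ * ‖v‖ := by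
  refine ContinuousMultilinearMap.opNorm_le_bound (by positivity) fun m => ?_
  rw [iteratedFDeriv_clm_apply_const_apply (n := ∞) (h.fderiv_right (m := ∞) (by simp))
    (mod_cast le_top), ← norm_iteratedFDeriv_fderiv]
  calc _ ≤ ‖iteratedFDeriv ℝ k (fderiv ℝ φ) x m‖ * ‖v‖ := ContinuousLinearMap.le_opNorm _ _
    _ ≤ (‖iteratedFDeriv ℝ k (fderiv ℝ φ) x‖ * ∏ i, ‖m i‖) * ‖v‖ := by
      gcongr; exact ContinuousMultilinearMap.le_opNorm _ _
    _ = _ := by ring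

theorem infty_add_nat_le (k : ℕ) : ((⊤ : ℕ∞) : WithTop ℕ∞) + k ≤ ((⊤ : ℕ∞) : WithTop ℕ∞) := by
  exact_mod_cast (le_top : (⊤ : ℕ∞) + (k : ℕ∞) ≤ ⊤)

/-- Directional derivatives commute with iterated derivatives. -/
theorem iteratedFDeriv_fderiv_apply {φ : E → ℂ} (h : ContDiff ℝ ∞ φ) (v : E) (k : ℕ) :
    iteratedFDeriv ℝ k (fun y => fderiv ℝ φ y v) = fun x => fderiv ℝ (iteratedFDeriv ℝ k φ) x v := by
  induction k with
  | zero =>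
    ext x m
    rw [iteratedFDeriv_zero_apply, iteratedFDeriv_zero_eq_comp, LinearIsometryEquiv.comp_fderiv]
    rfl
  | succ k ih =>
    ext x m
    have hk : ContDiff ℝ ∞ (iteratedFDeriv ℝ k φ) := h.iteratedFDeriv_right (m := ∞) (infty_add_nat_le _)
    have hk' : ContDiff ℝ ∞ (fderiv ℝ (iteratedFDeriv ℝ k φ)) := hk.fderiv_right (m := ∞) (by simp)
    have hk1 : ContDiff ℝ ∞ (iteratedFDeriv ℝ (k + 1) φ) := h.iteratedFDeriv_right (m := ∞) (infty_add_nat_le _)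
    have hd := hk'.differentiable (by simp) x
    -- The induction step has to exchange the direction `v` with the new slot `m 0`: this is the
    -- symmetry of the second derivative of the `k`-th derivative.
    have hsymm : IsSymmSndFDerivAt ℝ (iteratedFDeriv ℝ k φ) x :=
      hk.contDiffAt.isSymmSndFDerivAt (by
        rw [minSmoothness_of_isRCLikeNormedField]; exact WithTop.coe_le_coe.2 (le_top : (2 : ℕ∞) ≤ ⊤))
    rw [iteratedFDeriv_succ_apply_left, ih,
      ← fderiv_continuousMultilinear_apply_const_apply (hk1.differentiable (by simp) x)]
    simp_rw [iteratedFDeriv_succ_apply_left]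
    rw [fderiv_clm_apply hd (differentiableAt_const v),
      fderiv_continuousMultilinear_apply_const_apply (hd.clm_apply (differentiableAt_const _)),
      fderiv_clm_apply hd (differentiableAt_const (m 0))]
    simp only [fderiv_fun_const, ContinuousLinearMap.flip_apply, Pi.zero_apply, ContinuousLinearMap.comp_zero, zero_add]
    rw [hsymm.eq]

/-- The first order Taylor remainder of a smooth compactly supported function. -/
theorem exists_norm_sub_sub_fderiv_le {F : Type*} [NormedAddCommGroup F] [NormedSpace ℝ F]
    {A : E → F} (hA : ContDiff ℝ ∞ A) (hc : HasCompactSupport A) :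
    ∃ C : ℝ, 0 ≤ C ∧ ∀ x h, ‖A (x + h) - A x - fderiv ℝ A x h‖ ≤ C * ‖h‖ ^ 2 := by
  obtain ⟨C, hC⟩ := ContDiff.lipschitzWith_of_hasCompactSupport (𝕂 := ℝ) (n := ∞)
    (hc.fderiv (𝕜 := ℝ)) (hA.fderiv_right (m := ∞) (by simp)) (by simp)
  refine ⟨C, C.2, fun x h => ?_⟩
  have := (convex_closedBall x ‖h‖).norm_image_sub_le_of_norm_fderiv_le' (𝕜 := ℝ) (f := A)
    (φ := fderiv ℝ A x) (C := C * ‖h‖) (x := x) (y := x + h)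
    (fun z _ => (hA.differentiable (by simp)).differentiableAt) (fun z hz => ?_)
    (Metric.mem_closedBall_self (norm_nonneg _)) (by simp)
  · simpa [pow_two, mul_assoc] using this
  · refine (hC.norm_sub_le z x).trans ?_
    gcongr
    simpa [dist_eq_norm] using hz

variable [FiniteDimensional ℝ P]

/-- The finite-order bound of `g` is applied to the first-order Taylor remainder of `Φ` in the
parameter: its derivatives up to that order are all `O(‖v‖²)`, and its slices stay in a fixed
compact set. -/
theorem hasFDerivAt_pair_slice (g : Distr E) {Φ : P × E → ℂ} (h : IsTest Φ) (p : P) :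
    ∃ L : P →L[ℝ] ℂ, HasFDerivAt (fun p => pair g fun z => Φ (p, z)) L p ∧
      ∀ v, L v = pair g fun z => fderiv ℝ Φ (p, z) (v, 0) := by
  have hsl : ∀ v, IsTest fun z => fderiv ℝ Φ (p, z) (v, 0) := fun v =>
    (h.fderiv_apply (v, 0)).slice p
  let L₀ : P →ₗ[ℝ] ℂ :=
    { toFun := fun v => pair g fun z => fderiv ℝ Φ (p, z) (v, 0)
      map_add' := fun v w => by
        rw [← pair_add g (hsl v) (hsl w)]; congr 1; ext z
        rw [← map_add, Prod.mk_add_mk, add_zero]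
      map_smul' := fun c v => by
        rw [RingHom.id_apply, Complex.real_smul, ← pair_const_mul g (hsl v)]; congr 1; ext z
        rw [← Complex.real_smul, ← map_smul]; simp }
  refine ⟨L₀.toContinuousLinearMap, ?_, fun v => rfl⟩
  obtain ⟨N, C, hC, hb⟩ := exists_bound g (h.compact.isCompact.image continuous_snd)
  have hA : ∀ k, ContDiff ℝ ∞ (iteratedFDeriv ℝ k Φ) := fun k =>
    h.smooth.iteratedFDeriv_right (m := ∞) (infty_add_nat_le _)
  choose D hD0 hD using fun k => exists_norm_sub_sub_fderiv_le (hA k) (h.compact.iteratedFDeriv k)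
  set M := ∑ k ∈ Finset.range (N + 1), D k
  have hM : ∀ v : P, ‖(pair g fun z => Φ (p + v, z)) - (pair g fun z => Φ (p, z)) - L₀ v‖
      ≤ C * (M * ‖v‖ ^ 2) := by
    intro v
    let R : P × E → ℂ := fun q => Φ (q + (v, 0)) - Φ q - fderiv ℝ Φ q (v, 0)
    have hR : IsTest R := ((h.comp_add_right (v, 0)).sub h).sub (h.fderiv_apply (v, 0))
    have e : (pair g fun z => Φ (p + v, z)) - (pair g fun z => Φ (p, z)) - L₀ v
        = pair g fun z => R (p, z) := by
      change _ - _ - pair g _ = _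
      rw [← pair_sub g (h.slice _) (h.slice _), ← pair_sub g ((h.slice _).sub (h.slice _)) (hsl v)]
      congr 1; ext z; simp [R]
    rw [e]
    refine hb _ (hR.slice p) (closure_minimal ?_ (h.compact.isCompact.image continuous_snd).isClosed)
      _ fun k hk z => ?_
    · intro z hz
      by_contra hz'
      have : ∀ p', (p', z) ∉ tsupport Φ := fun p' hp' => hz' ⟨_, hp', rfl⟩
      apply hz
      have h0 : fderiv ℝ Φ (p, z) = 0 := by
        apply image_eq_zero_of_notMem_tsupport
        exact fun h' => this p (tsupport_fderiv_subset ℝ h')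
      simp [R, h0, image_eq_zero_of_notMem_tsupport (this p),
        image_eq_zero_of_notMem_tsupport (this (p + v))]
    · refine (norm_iteratedFDeriv_slice_le hR.smooth p z k).trans ?_
      -- Directional derivatives commute with iterated ones, so the `k`-th derivative of the
      -- remainder is the remainder of the `k`-th derivative, and the quadratic bound applies to
      -- each order.
      have e2 : iteratedFDeriv ℝ k R (p, z) = iteratedFDeriv ℝ k Φ ((p, z) + (v, 0))
          - iteratedFDeriv ℝ k Φ (p, z) - fderiv ℝ (iteratedFDeriv ℝ k Φ) (p, z) (v, 0) := by
        rw [← iteratedFDeriv_comp_add_right]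
        have s1 := (h.comp_add_right (v, 0)).smooth
        have s2 := (h.fderiv_apply (v, 0)).smooth
        have t1 := iteratedFDeriv_sub_apply (𝕜 := ℝ) (i := k) (x := (p, z))
          ((s1.sub h.smooth).contDiffAt.of_le (mod_cast le_top)) (s2.contDiffAt.of_le (mod_cast le_top))
        have t2 := iteratedFDeriv_sub_apply (𝕜 := ℝ) (i := k) (x := (p, z))
          (s1.contDiffAt.of_le (mod_cast le_top)) (h.smooth.contDiffAt.of_le (mod_cast le_top))
        exact t1.trans (congrArg₂ (· - ·) t2 (congrFun (iteratedFDeriv_fderiv_apply h.smooth _ _) _))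
      rw [e2]
      refine (hD k _ _).trans ?_
      have : ‖((v, 0) : P × E)‖ = ‖v‖ := by simp [Prod.norm_def]
      rw [this]
      gcongr
      exact Finset.single_le_sum (f := D) (fun i _ => hD0 i) (Finset.mem_range.2 (by omega))
  rw [hasFDerivAt_iff_isLittleO_nhds_zero]
  refine Asymptotics.IsBigO.trans_isLittleO (g := fun v : P => ‖v‖ ^ 2) ?_ ?_
  · refine Asymptotics.IsBigO.of_bound (C * M) (Eventually.of_forall fun v => ?_)
    rw [Real.norm_of_nonneg (by positivity : (0 : ℝ) ≤ ‖v‖ ^ 2), mul_assoc]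
    exact hM v
  · exact (Asymptotics.isLittleO_norm_pow_id (by norm_num))

theorem fderiv_pair_slice (g : Distr E) {Φ : P × E → ℂ} (h : IsTest Φ) (p v : P) :
    fderiv ℝ (fun p => pair g fun z => Φ (p, z)) p v
      = pair g fun z => fderiv ℝ Φ (p, z) (v, 0) := by
  obtain ⟨L, hL, hv⟩ := hasFDerivAt_pair_slice g h p
  rw [hL.fderiv, hv]

/-- A directional derivative in the parameter is again a pairing of the same form, with `Φ` replaced
by a derivative of `Φ`, so smoothness follows by induction. -/
theorem contDiff_pair_slice (g : Distr E) {Φ : P × E → ℂ} (h : IsTest Φ) :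
    ContDiff ℝ ∞ fun p => pair g fun z => Φ (p, z) := by
  rw [contDiff_infty]
  intro n
  induction n generalizing Φ with
  | zero =>
    refine contDiff_zero.2 (continuous_iff_continuousAt.2 fun p => ?_)
    obtain ⟨L, hL, -⟩ := hasFDerivAt_pair_slice g h p
    exact hL.continuousAt
  | succ n ih =>
    push_cast
    refine contDiff_succ_iff_fderiv_apply.2 ⟨fun p => ?_, by simp, fun v => ?_⟩
    · obtain ⟨L, hL, -⟩ := hasFDerivAt_pair_slice g h p
      exact hL.differentiableAt
    · simp_rw [fderiv_pair_slice g h]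
      exact ih (h.fderiv_apply (v, 0))

theorem support_pair_slice_subset (g : Distr E) (Φ : P × E → ℂ) :
    Function.support (fun p => pair g fun z => Φ (p, z)) ⊆ Prod.fst '' tsupport Φ := by
  intro p hp
  by_contra hp'
  apply hp
  have : (fun z => Φ (p, z)) = fun _ => 0 := by
    ext z
    exact image_eq_zero_of_notMem_tsupport fun h' => hp' ⟨_, h', rfl⟩
  simp only [this, pair_zero]

theorem IsTest.pair_slice (g : Distr E) {Φ : P × E → ℂ} (h : IsTest Φ) :
    IsTest fun p => pair g fun z => Φ (p, z) :=
  ⟨contDiff_pair_slice g h, HasCompactSupport.of_support_subset_isCompact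
    (h.compact.isCompact.image continuous_fst) (support_pair_slice_subset g Φ)⟩

/-- Derivatives in the parameter pass onto `Φ`, so the order `N` of `g` grows by exactly `k` while
`C` does not depend on `k`. This makes the iterated pairing `tensor` a functional of finite order.
-/
theorem norm_iteratedFDeriv_pair_slice_le (g : Distr E) {K : Set (P × E)} (hK : IsCompact K) :
    ∃ N : ℕ, ∃ C : ℝ, 0 ≤ C ∧ ∀ k : ℕ, ∀ Φ : P × E → ℂ, IsTest Φ → tsupport Φ ⊆ K → ∀ S : ℝ,
      (∀ j ≤ N + k, ∀ q, ‖iteratedFDeriv ℝ j Φ q‖ ≤ S) →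
      ∀ p, ‖iteratedFDeriv ℝ k (fun p => pair g fun z => Φ (p, z)) p‖ ≤ C * S := by
  obtain ⟨N, C, hC, hb⟩ := exists_bound g (hK.image continuous_snd)
  refine ⟨N, C, hC, fun k => ?_⟩
  induction k with
  | zero =>
    intro Φ h hs S hS p
    rw [norm_iteratedFDeriv_zero]
    exact hb _ (h.slice p) ((tsupport_slice_subset h.compact p).trans (Set.image_mono hs)) S
      fun k hk z => (norm_iteratedFDeriv_slice_le h.smooth p z k).trans (hS k (by omega) _)
  | succ k ih =>
    intro Φ h hs S hS p
    have hS0 : 0 ≤ S := (norm_nonneg _).trans (hS 0 (Nat.zero_le _) 0)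
    refine ContinuousMultilinearMap.opNorm_le_bound (by positivity) fun m => ?_
    rw [iteratedFDeriv_succ_apply_right,
      ← iteratedFDeriv_clm_apply_const_apply (n := ∞)
        ((contDiff_pair_slice g h).fderiv_right (m := ∞) (by simp)) (mod_cast le_top)]
    simp_rw [fderiv_pair_slice g h]
    refine (ContinuousMultilinearMap.le_opNorm _ _).trans ?_
    have := ih _ (h.fderiv_apply (m (Fin.last k), 0))
      ((tsupport_fderiv_apply_subset ℝ _).trans hs) (S * ‖m (Fin.last k)‖) (fun j hj q => by
        refine (norm_iteratedFDeriv_fderiv_apply_le h.smooth _ _ _).trans ?_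
        have : ‖((m (Fin.last k), 0) : P × E)‖ = ‖m (Fin.last k)‖ := by simp [Prod.norm_def]
        rw [this]
        gcongr
        exact hS _ (by omega) _) p
    rw [Fin.prod_univ_castSucc]
    calc _ ≤ C * (S * ‖m (Fin.last k)‖) * ∏ i, ‖Fin.init m i‖ := by gcongr
      _ = _ := by simp only [Fin.init]; ring

end Slices

/-! ### Fubini theorem for distributions and parameter integrals -/

section Integrals

variable {P E : Type} [NormedAddCommGroup P] [NormedSpace ℝ P] [MeasureSpace P] [BorelSpace P]
  [IsLocallyFiniteMeasure (volume : Measure P)]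
  [NormedAddCommGroup E] [NormedSpace ℝ E]

/-- The distribution given by a continuous function. -/
def ofFun (H : P → ℂ) : Distr P :=
  TestFunction.integralAgainstBilinCLM (ContinuousLinearMap.lsmul ℝ ℝ) volume H

theorem ofFun_apply {H : P → ℂ} (hH : Continuous H) (φ : Test P) :
    ofFun H φ = ∫ x, (φ x : ℂ) * H x := by
  refine (TestFunction.integralAgainstBilinCLM_eq_integral
    (hH.locallyIntegrable.locallyIntegrableOn _)).trans ?_
  simp

theorem integrable_mul_of_isTest {H φ : P → ℂ} (hH : Continuous H) (h : IsTest φ) :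
    Integrable fun x => H x * φ x :=
  (hH.mul h.continuous).integrable_of_hasCompactSupport h.compact.mul_left

theorem pair_eq_integral_of_forall {f : Distr P} {H : P → ℂ} (hH : Continuous H)
    {φ : P → ℂ} (h : IsTest φ)
    (hf : ∀ ψ : Test P, tsupport ψ ⊆ tsupport φ → f ψ = ∫ x, (ψ x : ℂ) * H x) :
    pair f φ = ∫ x, H x * φ x := by
  rw [pair_def _ h, hf _ (tsupport_comp_subset (g := Complex.re) rfl φ),
    hf _ (tsupport_comp_subset (g := Complex.im) rfl φ), ← integral_const_mul, ← integral_add]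
  · refine integral_congr_ae (Eventually.of_forall fun x => ?_)
    simp only [reTest_apply, imTest_apply]
    conv_rhs => rw [← Complex.re_add_im (φ x)]
    ring
  · simp_rw [mul_comm]
    exact integrable_mul_of_isTest hH (IsTest.ofReal (reTest φ h))
  · simp_rw [mul_comm _ (H _)]
    exact (integrable_mul_of_isTest hH (IsTest.ofReal (imTest φ h))).const_mul _

theorem pair_ofFun {H : P → ℂ} (hH : Continuous H) {φ : P → ℂ} (h : IsTest φ) :
    pair (ofFun H) φ = ∫ x, H x * φ x :=
  pair_eq_integral_of_forall hH h fun ψ _ => ofFun_apply hH ψ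

theorem IsTest.comp_swap {Φ : P × E → ℂ} (h : IsTest Φ) : IsTest fun q : E × P => Φ (q.2, q.1) :=
  ⟨h.smooth.comp (contDiff_snd.prodMk contDiff_fst),
    h.compact.comp_homeomorph (Homeomorph.prodComm E P)⟩

theorem IsTest.slice_left {Φ : P × E → ℂ} (h : IsTest Φ) (z : E) : IsTest fun p => Φ (p, z) :=
  h.comp_swap.slice z

theorem fderiv_comp_swap {Φ : P × E → ℂ} (h : IsTest Φ) (p : P) (z v : E) :
    fderiv ℝ (fun q : E × P => Φ (q.2, q.1)) (z, p) (v, 0) = fderiv ℝ Φ (p, z) (0, v) := by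
  have h1 := (h.smooth.differentiable (by simp) (p, z)).hasFDerivAt
  have h2 : HasFDerivAt (fun q : E × P => (q.2, q.1))
      ((ContinuousLinearMap.snd ℝ E P).prod (ContinuousLinearMap.fst ℝ E P)) (z, p) :=
    hasFDerivAt_snd.prodMk hasFDerivAt_fst
  refine (DFunLike.congr_fun (HasFDerivAt.comp (z, p) (g := Φ) h1 h2).fderiv (v, 0)).trans ?_
  simp

theorem fderiv_slice {Φ : P × E → ℂ} (h : IsTest Φ) (p : P) (z v : E) :
    fderiv ℝ (fun z => Φ (p, z)) z v = fderiv ℝ Φ (p, z) (0, v) := by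
  have h1 := (h.smooth.differentiable (by simp) (p, z)).hasFDerivAt
  have h2 : HasFDerivAt (fun z : E => (p, z)) (ContinuousLinearMap.inr ℝ P E) z :=
    hasFDerivAt_prodMk_right p z
  refine (DFunLike.congr_fun (HasFDerivAt.comp z (g := Φ) h1 h2).fderiv v).trans ?_
  simp

variable [FiniteDimensional ℝ E]

/-- Differentiation under the integral sign is the special case of `IsTest.pair_slice` in which the
distribution is integration against `H`. -/
theorem isTest_integral {H : P → ℂ} (hH : Continuous H) {Φ : P × E → ℂ} (h : IsTest Φ) :
    IsTest fun z => ∫ p, H p * Φ (p, z) := by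
  simp_rw [← pair_ofFun hH (h.slice_left _)]
  exact h.comp_swap.pair_slice (ofFun H)

/-- This identifies the jets of a parameter integral with Bochner integrals of jets, as the Fubini
theorem below requires. -/
theorem iteratedFDeriv_integral {H : P → ℂ} (hH : Continuous H) {Φ : P × E → ℂ} (h : IsTest Φ)
    (k : ℕ) (z : E) (m : Fin k → E) :
    iteratedFDeriv ℝ k (fun z => ∫ p, H p * Φ (p, z)) z m =
      ∫ p, H p * iteratedFDeriv ℝ k (fun z => Φ (p, z)) z m := by
  induction k generalizing Φ with
  | zero => simp
  | succ k ih =>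
    have e1 : ∀ z v, fderiv ℝ (fun z => ∫ p, H p * Φ (p, z)) z v
        = ∫ p, H p * fderiv ℝ Φ (p, z) (0, v) := by
      intro z v
      simp_rw [← pair_ofFun hH (h.slice_left _)]
      rw [fderiv_pair_slice (ofFun H) h.comp_swap]
      simp_rw [fderiv_comp_swap h]
      exact pair_ofFun hH ((h.fderiv_apply (0, v)).slice_left z)
    rw [iteratedFDeriv_succ_apply_right, ← iteratedFDeriv_clm_apply_const_apply (n := ∞)
        ((isTest_integral hH h).smooth.fderiv_right (m := ∞) (by simp)) (mod_cast le_top)]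
    simp_rw [e1]
    rw [ih (h.fderiv_apply (0, m (Fin.last k)))]
    congr 1; ext p; congr 1
    rw [iteratedFDeriv_succ_apply_right, ← iteratedFDeriv_clm_apply_const_apply (n := ∞)
        ((h.slice p).smooth.fderiv_right (m := ∞) (by simp)) (mod_cast le_top)]
    simp_rw [fderiv_slice h]

/-- The space of bounded continuous fields of `k`-linear forms. -/
def Jet (E : Type) [NormedAddCommGroup E] [NormedSpace ℝ E] (k : ℕ) : Type :=
  BoundedContinuousFunction E (ContinuousMultilinearMap ℝ (fun _ : Fin k => E) ℂ)

instance (k : ℕ) : NormedAddCommGroup (Jet E k) :=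
  inferInstanceAs (NormedAddCommGroup
    (BoundedContinuousFunction E (ContinuousMultilinearMap ℝ (fun _ : Fin k => E) ℂ)))

instance (k : ℕ) : NormedSpace ℂ (Jet E k) :=
  inferInstanceAs (NormedSpace ℂ
    (BoundedContinuousFunction E (ContinuousMultilinearMap ℝ (fun _ : Fin k => E) ℂ)))

instance (k : ℕ) : CompleteSpace (Jet E k) :=
  inferInstanceAs (CompleteSpace
    (BoundedContinuousFunction E (ContinuousMultilinearMap ℝ (fun _ : Fin k => E) ℂ)))

/-- Evaluation of a field of `k`-linear forms. -/
def Jet.eval (k : ℕ) (z : E) (m : Fin k → E) : Jet E k →L[ℝ] ℂ :=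
  ContinuousMultilinearMap.apply ℝ (fun _ : Fin k => E) ℂ m ∘L BoundedContinuousFunction.evalCLM ℝ z

theorem Jet.ext_eval {k : ℕ} {A B : Jet E k} (h : ∀ z m, Jet.eval k z m A = Jet.eval k z m B) :
    A = B :=
  BoundedContinuousFunction.ext fun z => ContinuousMultilinearMap.ext fun m => h z m

/-- The derivative of order `k` of a test function. -/
def IsTest.jet {φ : E → ℂ} (h : IsTest φ) (k : ℕ) : Jet E k :=
  BoundedContinuousFunction.ofNormedAddCommGroup (iteratedFDeriv ℝ k φ)
    (h.smooth.continuous_iteratedFDeriv (mod_cast le_top))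
    ((h.smooth.continuous_iteratedFDeriv (m := k)
      (mod_cast le_top)).bounded_above_of_compact_support (h.compact.iteratedFDeriv k)).choose
    ((h.smooth.continuous_iteratedFDeriv (m := k)
      (mod_cast le_top)).bounded_above_of_compact_support (h.compact.iteratedFDeriv k)).choose_spec

theorem IsTest.norm_le_norm_jet {φ : E → ℂ} (h : IsTest φ) (k : ℕ) (z : E) :
    ‖iteratedFDeriv ℝ k φ z‖ ≤ ‖h.jet k‖ :=
  BoundedContinuousFunction.norm_coe_le_norm
    (show BoundedContinuousFunction E (ContinuousMultilinearMap ℝ (fun _ : Fin k => E) ℂ)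
      from h.jet k) z

theorem IsTest.norm_jet_le {φ : E → ℂ} (h : IsTest φ) (k : ℕ) {S : ℝ} (hS : 0 ≤ S)
    (hb : ∀ z, ‖iteratedFDeriv ℝ k φ z‖ ≤ S) : ‖h.jet k‖ ≤ S :=
  (BoundedContinuousFunction.norm_le hS).2 hb

theorem IsTest.jet_add {φ ψ : E → ℂ} (h : IsTest φ) (h' : IsTest ψ) (k : ℕ) :
    (h.add h').jet k = h.jet k + h'.jet k :=
  BoundedContinuousFunction.ext fun _ =>
    iteratedFDeriv_add_apply (h.smooth.contDiffAt.of_le (mod_cast le_top))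
      (h'.smooth.contDiffAt.of_le (mod_cast le_top))

theorem IsTest.jet_sub {φ ψ : E → ℂ} (h : IsTest φ) (h' : IsTest ψ) (k : ℕ) :
    (h.sub h').jet k = h.jet k - h'.jet k :=
  BoundedContinuousFunction.ext fun _ =>
    iteratedFDeriv_sub_apply (h.smooth.contDiffAt.of_le (mod_cast le_top))
      (h'.smooth.contDiffAt.of_le (mod_cast le_top))

theorem IsTest.jet_const_mul {φ : E → ℂ} (h : IsTest φ) (c : ℂ) (k : ℕ) :
    (h.const_mul c).jet k = c • h.jet k :=
  BoundedContinuousFunction.ext fun _ =>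
    iteratedFDeriv_const_smul_apply (𝕜 := ℝ) (h.smooth.contDiffAt.of_le (mod_cast le_top)) (a := c)

theorem continuous_jet_slice {Φ : P × E → ℂ} (h : IsTest Φ) (k : ℕ) :
    Continuous fun p => (h.slice p).jet k := by
  have hA : ContDiff ℝ ∞ (iteratedFDeriv ℝ k Φ) :=
    h.smooth.iteratedFDeriv_right (m := ∞) (infty_add_nat_le _)
  obtain ⟨C, hC⟩ := ContDiff.lipschitzWith_of_hasCompactSupport (𝕂 := ℝ) (n := ∞)
    (h.compact.iteratedFDeriv k) hA (by simp)
  refine (LipschitzWith.of_dist_le_mul (K := C) fun p p' => ?_).continuous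
  rw [dist_eq_norm, ← IsTest.jet_sub]
  refine IsTest.norm_jet_le _ _ (by positivity) fun z => ?_
  let R : P × E → ℂ := fun q => Φ (q + (p - p', 0)) - Φ q
  have hR : IsTest R := (h.comp_add_right _).sub h
  have e : (fun z => Φ (p, z) - Φ (p', z)) = fun z => R (p', z) := by
    ext z; simp [R]
  have e2 : iteratedFDeriv ℝ k R (p', z) = iteratedFDeriv ℝ k Φ ((p', z) + (p - p', 0))
      - iteratedFDeriv ℝ k Φ (p', z) := by
    rw [← iteratedFDeriv_comp_add_right]
    exact iteratedFDeriv_sub_apply (𝕜 := ℝ) (i := k)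
      ((h.comp_add_right _).smooth.contDiffAt.of_le (mod_cast le_top))
      (h.smooth.contDiffAt.of_le (mod_cast le_top))
  rw [e]
  refine (norm_iteratedFDeriv_slice_le hR.smooth p' z k).trans ?_
  rw [e2]
  refine (hC.norm_sub_le _ _).trans ?_
  simp [Prod.norm_def, dist_eq_norm]

/-- The quotient map by `W` is continuous linear and kills the integrand, hence also the integral.
-/
theorem integral_mem_of_isClosed {X : Type*} [NormedAddCommGroup X] [NormedSpace ℂ X]
    [CompleteSpace X] (W : Submodule ℂ X) (hW : IsClosed (W : Set X)) {v : P → X}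
    (hv : Integrable v) (hmem : ∀ p, v p ∈ W) : ∫ p, v p ∈ W := by
  have : ∫ p, W.mkQL (v p) = W.mkQL (∫ p, v p) := W.mkQL.integral_comp_comm hv
  rw [← W.ker_mkQ, LinearMap.mem_ker]
  refine this.symm.trans ?_
  have h0 : ∀ p, W.mkQL (v p) = 0 := fun p => by simpa using hmem p
  simp [h0]

/-- A linear functional that is bounded with respect to a map `T` into a Banach space commutes
with integrals that are taken after `T`. -/
theorem integral_eq_of_norm_le {V Y : Type*} [AddCommGroup V] [Module ℂ V] [NormedAddCommGroup Y]
    [NormedSpace ℂ Y] [CompleteSpace Y] (T : V →ₗ[ℂ] Y) (l : V →ₗ[ℂ] ℂ) {C : ℝ}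
    (hC : ∀ φ, ‖l φ‖ ≤ C * ‖T φ‖) {v : P → V} (hT : Integrable fun p => T (v p))
    (hl : Integrable fun p => l (v p)) {φ : V} (hφ : T φ = ∫ p, T (v p)) :
    ∫ p, l (v p) = l φ := by
  -- The bound of `l` by `T` holds on the range of `(T, l)` and survives closure. The integral of
  -- `(T v, l v)` and the point `(T φ, l φ)` both lie in the closure and have the same first
  -- coordinate, so the bound applied to their difference equates the second ones. The functional
  -- need not be defined on `Y`.
  let W : Submodule ℂ (Y × ℂ) := LinearMap.range (T.prod l)
  have hWb : ∀ x ∈ W.topologicalClosure, ‖x.2‖ ≤ C * ‖x.1‖ := by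
    have hcl : IsClosed {x : Y × ℂ | ‖x.2‖ ≤ C * ‖x.1‖} :=
      isClosed_le continuous_snd.norm (continuous_const.mul continuous_fst.norm)
    refine fun x hx => closure_minimal ?_ hcl hx
    rintro x ⟨φ, rfl⟩
    exact hC φ
  have hi : Integrable fun p => (T (v p), l (v p)) := hT.prodMk hl
  have hmem : ∫ p, (T (v p), l (v p)) ∈ W.topologicalClosure :=
    integral_mem_of_isClosed _ W.isClosed_topologicalClosure hi fun p =>
      W.le_topologicalClosure ⟨v p, rfl⟩
  have hmem' : (T φ, l φ) ∈ W.topologicalClosure := W.le_topologicalClosure ⟨φ, rfl⟩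
  have := hWb _ (Submodule.sub_mem _ hmem hmem')
  rw [integral_pair hT hl, hφ] at this
  simpa [sub_eq_zero] using this

/-- The space of test functions supported in `K`. -/
def testsIn (K : Set E) : Submodule ℂ (E → ℂ) where
  carrier := {φ | IsTest φ ∧ tsupport φ ⊆ K}
  zero_mem' := ⟨.zero, by simp [tsupport]⟩
  add_mem' := fun {φ ψ} h h' =>
    ⟨h.1.add h'.1, (tsupport_add φ ψ).trans (Set.union_subset h.2 h'.2)⟩
  smul_mem' := fun c _ h => ⟨h.1.const_mul c, (tsupport_mul_subset_right).trans h.2⟩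

/-- Distributions commute with integrals depending on a parameter. -/
theorem integral_mul_pair_slice [FiniteDimensional ℝ P] (g : Distr E) {H : P → ℂ}
    (hH : Continuous H) {Φ : P × E → ℂ} (h : IsTest Φ) :
    ∫ p, H p * pair g (fun z => Φ (p, z)) = pair g fun z => ∫ p, H p * Φ (p, z) := by
  have hK := h.compact.isCompact.image (continuous_snd (X := P) (Y := E))
  set K := Prod.snd '' tsupport Φ with hKdef
  obtain ⟨N, C, hC, hb⟩ := exists_bound g hK
  -- Test functions in `K` do not form a Banach space, but `g` has some finite order `N` there.
  -- Recording the derivatives of order at most `N` maps them to a Banach space in which the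
  -- integral makes sense and whose norm controls `g`.
  let T : testsIn K →ₗ[ℂ] ∀ k : Fin (N + 1), Jet E k :=
    { toFun := fun φ k => φ.2.1.jet k
      map_add' := fun φ ψ => funext fun k => IsTest.jet_add φ.2.1 ψ.2.1 k
      map_smul' := fun c φ => funext fun k => IsTest.jet_const_mul φ.2.1 c k }
  let l : testsIn K →ₗ[ℂ] ℂ :=
    { toFun := fun φ => pair g φ
      map_add' := fun φ ψ => pair_add g φ.2.1 ψ.2.1
      map_smul' := fun c φ => pair_const_mul g φ.2.1 c }
  have hTl : ∀ φ, ‖l φ‖ ≤ C * ‖T φ‖ := fun φ => hb _ φ.2.1 φ.2.2 _ fun k hk z =>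
    (φ.2.1.norm_le_norm_jet k z).trans (norm_le_pi_norm (T φ) ⟨k, by omega⟩)
  let w : P → testsIn K := fun p => ⟨_, h.slice p, tsupport_slice_subset h.compact p⟩
  have hw0 : ∀ p ∉ Prod.fst '' tsupport Φ, w p = 0 := by
    intro p hp
    refine Subtype.ext (funext fun z => ?_)
    exact image_eq_zero_of_notMem_tsupport (f := Φ) (x := (p, z)) fun h' => hp ⟨_, h', rfl⟩
  have hK1 := h.compact.isCompact.image (continuous_fst (X := P) (Y := E))
  have hTi : Integrable fun p => T (H p • w p) := by
    refine Continuous.integrable_of_hasCompactSupport ?_ (HasCompactSupport.intro hK1 fun p hp => ?_)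
    · simp_rw [map_smul]
      exact hH.smul (continuous_pi fun k => continuous_jet_slice h k)
    · rw [hw0 p hp, smul_zero, map_zero]
  have hli : Integrable fun p => l (H p • w p) := by
    refine Continuous.integrable_of_hasCompactSupport ?_ (HasCompactSupport.intro hK1 fun p hp => ?_)
    · simp_rw [map_smul]
      exact hH.smul (h.pair_slice g).continuous
    · rw [hw0 p hp, smul_zero, map_zero]
  have hφ := isTest_integral hH h
  have hφK : tsupport (fun z => ∫ p, H p * Φ (p, z)) ⊆ K := by
    refine closure_minimal (fun z hz => ?_) hK.isClosed
    by_contra hz'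
    apply hz
    have : ∀ p, Φ (p, z) = 0 := fun p =>
      image_eq_zero_of_notMem_tsupport fun h' => hz' ⟨_, h', rfl⟩
    simp [this]
  have key := integral_eq_of_norm_le T l hTl hTi hli (φ := ⟨_, hφ, hφK⟩) ?_
  · simp_rw [map_smul] at key
    exact key
  · funext k
    have h1 := (ContinuousLinearMap.proj (R := ℂ) (φ := fun k : Fin (N + 1) =>
      Jet E k) k).integral_comp_comm hTi
    have hTk := (ContinuousLinearMap.proj (R := ℂ) (φ := fun k : Fin (N + 1) =>
      Jet E k) k).integrable_comp hTi
    refine Eq.trans ?_ h1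
    refine Jet.ext_eval fun z m => ?_
    rw [← (Jet.eval (k : ℕ) z m).integral_comp_comm hTk]
    refine (iteratedFDeriv_integral hH h k z m).trans (integral_congr_ae
      (Eventually.of_forall fun p => ?_))
    simp only [map_smul]
    rfl

end Integrals

/-! ### Tensor product of distributions -/

section Tensor

variable {P E : Type} [NormedAddCommGroup P] [NormedSpace ℝ P] [FiniteDimensional ℝ P]
  [NormedAddCommGroup E] [NormedSpace ℝ E]

/-- The tensor product of two distributions. -/
def tensor (f : Distr P) (g : Distr E) : Distr (P × E) :=
  mkDistr (fun Φ => pair f fun p => pair g fun z => (Φ (p, z) : ℂ))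
    (fun Φ Ψ => by
      have h1 := IsTest.ofReal Φ
      have h2 := IsTest.ofReal Ψ
      rw [← pair_add f (h1.pair_slice g) (h2.pair_slice g)]
      simp_rw [← pair_add g (h1.slice _) (h2.slice _)]
      simp)
    (fun c Φ => by
      have h1 := IsTest.ofReal Φ
      rw [Complex.real_smul, ← pair_const_mul f (h1.pair_slice g)]
      simp_rw [← pair_const_mul g (h1.slice _)]
      simp)
    (fun K hK => by
      obtain ⟨N, C, hC, hb⟩ := norm_iteratedFDeriv_pair_slice_le g hK
      obtain ⟨N', C', hC', hb'⟩ := exists_bound f (hK.image continuous_fst)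
      refine ⟨N + N', C' * C, by positivity, fun Φ hΦ S hS => ?_⟩
      have h1 := IsTest.ofReal Φ
      have hsupp : tsupport (fun q => (Φ q : ℂ)) ⊆ K :=
        (tsupport_comp_subset (g := Complex.ofReal) rfl Φ).trans hΦ
      rw [mul_assoc]
      refine hb' _ (h1.pair_slice g) (closure_minimal ((support_pair_slice_subset g _).trans
        (Set.image_mono hsupp)) (hK.image continuous_fst).isClosed) _ fun k hk p => ?_
      refine hb k _ h1 hsupp S (fun j hj q => ?_) p
      have e : (fun q => (Φ q : ℂ)) = Complex.ofRealLI ∘ Φ := rfl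
      rw [e, LinearIsometry.norm_iteratedFDeriv_comp_left _ Φ.contDiff.contDiffAt (mod_cast le_top)]
      exact hS j (by omega) q)

theorem tensor_apply (f : Distr P) (g : Distr E) (Φ : Test (P × E)) :
    tensor f g Φ = pair f fun p => pair g fun z => (Φ (p, z) : ℂ) := rfl

end Tensor

theorem isTensorProduct_tensor {d : ℕ} (f g : Distr (Rd d)) : IsTensorProduct f g (tensor f g) := by
  intro φ ψ
  rw [tensor_apply]
  have : ∀ p, (pair g fun z => ((tensorTest φ ψ (p, z) : ℝ) : ℂ)) = g ψ * φ p := by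
    intro p
    rw [← pair_ofReal g, mul_comm, ← pair_const_mul g (IsTest.ofReal ψ)]
    congr 1; ext z
    exact Complex.ofReal_mul _ _
  simp_rw [this]
  rw [pair_const_mul f (IsTest.ofReal φ), pair_ofReal, mul_comm]

/-! ### Pointwise polynomial approximation of order `α` -/

section RayPolynomials

variable {E : Type} [NormedAddCommGroup E] [NormedSpace ℝ E]

/-- Continuous functions whose restriction to every line through the origin is a polynomial of
degree at most `m`. -/
structure IsRayPoly (m : ℕ) (p : E → ℂ) : Prop where
  continuous : Continuous p
  exists_poly : ∀ w, ∃ P : Polynomial ℂ, P.natDegree ≤ m ∧ ∀ t : ℝ, p (t • w) = P.eval (t : ℂ)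

/-- Polynomial behaviour along rays suffices, because the reproducing kernel is built by
extrapolation along each ray. Products are then products of one-variable polynomials. -/
theorem IsRayPoly.mul {m n : ℕ} {p q : E → ℂ} (hp : IsRayPoly m p) (hq : IsRayPoly n q) :
    IsRayPoly (m + n) fun w => p w * q w := by
  refine ⟨hp.continuous.mul hq.continuous, fun w => ?_⟩
  obtain ⟨P, hP, hP'⟩ := hp.exists_poly w
  obtain ⟨Q, hQ, hQ'⟩ := hq.exists_poly w
  exact ⟨P * Q, Polynomial.natDegree_mul_le.trans (add_le_add hP hQ), fun t => by
    rw [hP', hQ', Polynomial.eval_mul]⟩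

theorem IsRayPoly.zero (m : ℕ) : IsRayPoly m fun _ : E => (0 : ℂ) :=
  ⟨continuous_const, fun _ => ⟨0, by simp, by simp⟩⟩

theorem IsRayPoly.comp_smul {m : ℕ} {p : E → ℂ} (hp : IsRayPoly m p) (c : ℝ) :
    IsRayPoly m fun w => p (c • w) := by
  refine ⟨hp.continuous.comp (continuous_const_smul c), fun w => ?_⟩
  obtain ⟨P, hP, hP'⟩ := hp.exists_poly (c • w)
  exact ⟨P, hP, fun t => by rw [smul_comm, hP']⟩

theorem isRayPoly_sum (m : ℕ) (c : ℕ → ℝ)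
    (D : ∀ j : ℕ, ContinuousMultilinearMap ℝ (fun _ : Fin j => E) ℂ) :
    IsRayPoly m fun w => ∑ j ∈ Finset.range (m + 1), c j • D j fun _ => w := by
  refine ⟨continuous_finsetSum _ fun j _ => ((D j).cont.comp
    (continuous_pi fun _ => continuous_id)).const_smul (c j), fun w => ?_⟩
  refine ⟨∑ j ∈ Finset.range (m + 1), Polynomial.C (c j • D j fun _ => w) * Polynomial.X ^ j,
    Polynomial.natDegree_sum_le_of_forall_le _ _ fun j hj => ?_, fun t => ?_⟩
  · exact (Polynomial.natDegree_C_mul_X_pow_le _ _).trans (by simpa [Nat.lt_succ_iff] using hj)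
  · rw [Polynomial.eval_finsetSum]
    refine Finset.sum_congr rfl fun j _ => ?_
    have := (D j).map_smul_univ (fun _ => t) fun _ => w
    rw [this]
    simp
    ring

/-- `H` is approximated at `x` by a ray polynomial of degree `m`, to order `α`. -/
def ApproxAt (α : ℝ) (m : ℕ) (A : ℝ) (H : E → ℂ) (x : E) : Prop :=
  ∃ p : E → ℂ, IsRayPoly m p ∧ (∀ w, ‖w‖ ≤ 1 → ‖p w‖ ≤ A) ∧
    ∀ w, ‖w‖ ≤ 1 → ‖H (x + w) - p w‖ ≤ A * ‖w‖ ^ α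

variable {α : ℝ} {m n : ℕ} {A B : ℝ} {H G : E → ℂ} {x : E}

theorem ApproxAt.nonneg (h : ApproxAt α m A H x) : 0 ≤ A := by
  obtain ⟨p, -, h1, -⟩ := h
  exact (norm_nonneg _).trans (h1 0 (by simp))

theorem ApproxAt.mono (h : ApproxAt α m A H x) (hAB : A ≤ B) : ApproxAt α m B H x := by
  obtain ⟨p, hp, h1, h2⟩ := h
  refine ⟨p, hp, fun w hw => (h1 w hw).trans hAB, fun w hw => (h2 w hw).trans ?_⟩
  gcongr

/-- Writing `H G - p q = H (G - q) + (H - p) q` and using `|H| ≤ 2A` on the unit ball gives `2AB +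
AB`, the constant `3AB`. The degrees add, and no truncation of `p q` at degree `α` is needed. -/
theorem ApproxAt.mul (hα : 0 < α) (h : ApproxAt α m A H x) (h' : ApproxAt α n B G x) :
    ApproxAt α (m + n) (3 * A * B) (fun y => H y * G y) x := by
  have hA := h.nonneg
  have hB := h'.nonneg
  obtain ⟨p, hp, h1, h2⟩ := h
  obtain ⟨q, hq, h3, h4⟩ := h'
  refine ⟨_, hp.mul hq, fun w hw => ?_, fun w hw => ?_⟩
  · rw [norm_mul]
    calc ‖p w‖ * ‖q w‖ ≤ A * B := by gcongr <;> [exact h1 w hw; exact h3 w hw]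
      _ ≤ 3 * A * B := by nlinarith [mul_nonneg hA hB]
  · have hw1 : ‖w‖ ^ α ≤ 1 := Real.rpow_le_one (norm_nonneg _) hw hα.le
    have hw0 : 0 ≤ ‖w‖ ^ α := by positivity
    have hH : ‖H (x + w)‖ ≤ 2 * A := by
      calc ‖H (x + w)‖ = ‖(H (x + w) - p w) + p w‖ := by rw [sub_add_cancel]
        _ ≤ A * ‖w‖ ^ α + A := (norm_add_le _ _).trans (add_le_add (h2 w hw) (h1 w hw))
        _ ≤ 2 * A := by nlinarith
    have e : H (x + w) * G (x + w) - p w * q w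
        = H (x + w) * (G (x + w) - q w) + (H (x + w) - p w) * q w := by ring
    rw [e]
    refine (norm_add_le _ _).trans ?_
    rw [norm_mul, norm_mul]
    calc _ ≤ 2 * A * (B * ‖w‖ ^ α) + A * ‖w‖ ^ α * B := by
          gcongr <;> [exact h4 w hw; exact h2 w hw; exact h3 w hw]
      _ = _ := by ring

theorem ApproxAt.comp_add_right {c : E} (h : ApproxAt α m A H (x + c)) :
    ApproxAt α m A (fun y => H (y + c)) x := by
  obtain ⟨p, hp, h1, h2⟩ := h
  exact ⟨p, hp, h1, fun w hw => by simpa [add_right_comm] using h2 w hw⟩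

theorem approxAt_zero (α : ℝ) (m : ℕ) (hA : 0 ≤ A) (h : ∀ w, ‖w‖ ≤ 1 → H (x + w) = 0) :
    ApproxAt α m A H x :=
  ⟨_, IsRayPoly.zero m, fun w _ => by simpa using hA, fun w hw => by
    rw [h w hw]; simpa using by positivity⟩

theorem iteratedDeriv_comp_line {φ : E → ℂ} (h : ContDiff ℝ ∞ φ) (x w : E) (k : ℕ) (t : ℝ) :
    iteratedDeriv k (fun t : ℝ => φ (x + t • w)) t
      = iteratedFDeriv ℝ k φ (x + t • w) fun _ => w := by
  have h1 : (fun t : ℝ => φ (x + t • w))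
      = (fun z => φ (x + z)) ∘ ContinuousLinearMap.toSpanSingleton ℝ w := by
    ext t; simp
  have h2 : ContDiff ℝ ∞ fun z => φ (x + z) := h.comp (contDiff_const.add contDiff_id)
  rw [iteratedDeriv_eq_iteratedFDeriv, h1,
    ContinuousLinearMap.iteratedFDeriv_comp_right _ h2 t (i := k) (mod_cast le_top),
    iteratedFDeriv_comp_add_left]
  simp

/-- The one-variable Taylor bound along `t ↦ x + t w` on `[0, 1]`, with the factor `1 / m!`
discarded. -/
theorem norm_sub_taylor_le {φ : E → ℂ} (h : ContDiff ℝ ∞ φ) {S : ℝ} (m : ℕ)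
    (hS : ∀ x, ‖iteratedFDeriv ℝ (m + 1) φ x‖ ≤ S) (x w : E) :
    ‖φ (x + w) - ∑ j ∈ Finset.range (m + 1), ((j.factorial : ℝ)⁻¹) •
      iteratedFDeriv ℝ j φ x fun _ => w‖ ≤ S * ‖w‖ ^ (m + 1) := by
  have hS0 : 0 ≤ S := (norm_nonneg _).trans (hS x)
  set u : ℝ → ℂ := fun t => φ (x + t • w)
  have hu : ContDiff ℝ ∞ u := h.comp (contDiff_const.add (contDiff_id.smul contDiff_const))
  have hW : ∀ k, ∀ t ∈ Set.Icc (0 : ℝ) 1, iteratedDerivWithin k u (Set.Icc 0 1) t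
      = iteratedFDeriv ℝ k φ (x + t • w) fun _ => w := by
    intro k t ht
    rw [iteratedDerivWithin_eq_iteratedDeriv (uniqueDiffOn_Icc one_pos)
      (hu.contDiffAt.of_le (mod_cast le_top)) ht, iteratedDeriv_comp_line h]
  have := taylor_mean_remainder_bound (f := u) (a := 0) (b := 1) (x := 1) (n := m)
    (C := S * ‖w‖ ^ (m + 1)) zero_le_one (hu.contDiffOn.of_le (mod_cast le_top)) (by simp)
    fun t ht => by
      rw [hW _ t ht]
      refine (ContinuousMultilinearMap.le_opNorm _ _).trans ?_
      simp only [Finset.prod_const, Finset.card_univ, Fintype.card_fin]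
      gcongr
      exact hS _
  rw [taylor_within_apply] at this
  simp only [sub_zero, one_pow, mul_one] at this
  have e : u 1 = φ (x + w) := by simp [u]
  rw [e] at this
  refine (le_of_eq ?_).trans (this.trans (div_le_self (by positivity)
    (mod_cast Nat.one_le_iff_ne_zero.2 (Nat.factorial_ne_zero m))))
  congr 2
  refine Finset.sum_congr rfl fun j _ => ?_
  rw [hW j 0 (by simp)]
  simp

theorem approxAt_of_contDiff {φ : E → ℂ} (h : ContDiff ℝ ∞ φ) {S : ℝ} {m : ℕ} {α : ℝ}
    (hα : α ≤ m + 1) (hS : ∀ k ≤ m + 1, ∀ x, ‖iteratedFDeriv ℝ k φ x‖ ≤ S) (x : E) :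
    ApproxAt α m ((m + 1) * S) φ x := by
  have hS0 : 0 ≤ S := (norm_nonneg _).trans (hS 0 (Nat.zero_le _) x)
  refine ⟨_, isRayPoly_sum m (fun j => (j.factorial : ℝ)⁻¹) fun j => iteratedFDeriv ℝ j φ x,
    fun w hw => ?_, fun w hw => ?_⟩
  · refine (norm_sum_le _ _).trans ?_
    have : ∀ j ∈ Finset.range (m + 1),
        ‖((j.factorial : ℝ)⁻¹) • iteratedFDeriv ℝ j φ x fun _ => w‖ ≤ S := by
      intro j hj
      rw [norm_smul, norm_inv, Real.norm_natCast]
      refine (mul_le_of_le_one_left (norm_nonneg _) (inv_le_one_of_one_le₀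
        (mod_cast Nat.one_le_iff_ne_zero.2 (Nat.factorial_ne_zero j)))).trans ?_
      refine (ContinuousMultilinearMap.le_opNorm _ _).trans ?_
      refine (mul_le_of_le_one_right (norm_nonneg _) (Finset.prod_le_one
        (fun _ _ => norm_nonneg _) fun _ _ => hw)).trans (hS j ?_ x)
      have := Finset.mem_range.1 hj; omega
    refine (Finset.sum_le_sum this).trans ?_
    simp
  · refine (norm_sub_taylor_le h m (hS _ le_rfl) x w).trans ?_
    have h1 : ‖w‖ ^ (m + 1) ≤ ‖w‖ ^ α := by
      rcases (norm_nonneg w).eq_or_lt with h0 | h0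
      · rw [← h0, zero_pow (by omega)]; positivity
      · rw [← Real.rpow_natCast]
        exact Real.rpow_le_rpow_of_exponent_ge h0 hw (by push_cast; exact hα)
    have h2 : (0 : ℝ) ≤ ‖w‖ ^ α := by positivity
    calc S * ‖w‖ ^ (m + 1) ≤ S * ‖w‖ ^ α := by gcongr
      _ ≤ (m + 1) * S * ‖w‖ ^ α := by
        have : (0 : ℝ) ≤ m * S * ‖w‖ ^ α := by positivity
        nlinarith

theorem IsTest.exists_bound_iteratedFDeriv {φ : E → ℂ} (h : IsTest φ) (N : ℕ) :
    ∃ S : ℝ, ∀ k ≤ N, ∀ x, ‖iteratedFDeriv ℝ k φ x‖ ≤ S := by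
  choose D hD using fun k : ℕ => (h.smooth.continuous_iteratedFDeriv (m := k)
      (mod_cast le_top)).bounded_above_of_compact_support (h.compact.iteratedFDeriv k)
  refine ⟨∑ k ∈ Finset.range (N + 1), D k, fun k hk x => (hD k x).trans ?_⟩
  exact Finset.single_le_sum (f := D) (fun i _ => (norm_nonneg _).trans (hD i 0))
    (Finset.mem_range.2 (by omega))

theorem IsTest.exists_approxAt {φ : E → ℂ} (h : IsTest φ) {m : ℕ} {α : ℝ} (hα : α ≤ m + 1) :
    ∃ A, ∀ x, ApproxAt α m A φ x := by
  obtain ⟨S, hS⟩ := h.exists_bound_iteratedFDeriv (m + 1)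
  exact ⟨_, fun x => approxAt_of_contDiff h.smooth hα hS x⟩

/-- The product of a test function with a function that is locally uniformly approximated. -/
theorem IsTest.exists_approxAt_mul {κ F : E → ℂ} (h : IsTest κ) {m : ℕ} (hα : 0 < α)
    (hαm : α ≤ m + 1) [FiniteDimensional ℝ E]
    (hF : ∀ K : Set E, IsCompact K → ∃ A, ∀ x ∈ K, ApproxAt α n A F x) :
    ∃ A, ∀ x, ApproxAt α (m + n) A (fun y => κ y * F y) x := by
  have : ProperSpace E := FiniteDimensional.proper ℝ E
  obtain ⟨A, hA⟩ := h.exists_approxAt hαm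
  obtain ⟨B, hB⟩ := hF _ (h.compact.isCompact.cthickening (r := 1))
  refine ⟨|3 * A * B|, fun x => ?_⟩
  -- Farther than distance one from the support of `κ` the product vanishes on the whole unit ball
  -- around `x`, so local constants for `F` become a global one.
  by_cases hx : x ∈ Metric.cthickening 1 (tsupport κ)
  · exact ((hA x).mul hα (hB x hx)).mono (le_abs_self _)
  · refine approxAt_zero _ _ (abs_nonneg _) fun w hw => ?_
    suffices h' : x + w ∉ tsupport κ by rw [image_eq_zero_of_notMem_tsupport h', zero_mul]
    intro h'
    refine hx (Metric.mem_cthickening_of_dist_le x (x + w) _ _ h' ?_)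
    simpa [dist_eq_norm] using hw

end RayPolynomials

/-! ### Kernels that reproduce polynomials -/

section Kernel

/-- Lagrange interpolation at the nodes `2⁻ⁱ`, `i ≤ M`, evaluated at `0`. The weights are the values
of the basis polynomials at `0`; they are real and serve complex polynomials because the identity is
checked on monomials. -/
theorem exists_extrapolation (M : ℕ) : ∃ c : ℕ → ℝ, ∀ P : Polynomial ℂ, P.natDegree ≤ M →
    ∑ i ∈ Finset.range (M + 1), (c i : ℂ) * P.eval (((1 / 2 : ℝ) ^ i : ℝ) : ℂ) = P.eval 0 := by
  let v : ℕ → ℝ := fun i => (1 / 2 : ℝ) ^ i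
  have hv : Function.Injective v := pow_right_injective₀ (by norm_num) (by norm_num)
  let s := Finset.range (M + 1)
  refine ⟨fun i => (Lagrange.basis s v i).eval 0, fun P hP => ?_⟩
  have key : ∀ j ≤ M, ∑ i ∈ s, (Lagrange.basis s v i).eval 0 * v i ^ j = 0 ^ j := by
    intro j hj
    have h1 := Lagrange.eq_interpolate (s := s) (v := v) (f := (Polynomial.X ^ j : Polynomial ℝ))
      hv.injOn (by
        rw [Polynomial.degree_X_pow]; simp only [s, Finset.card_range]; exact_mod_cast by omega)
    have h2 := congrArg (Polynomial.eval 0) h1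
    rw [Lagrange.interpolate_apply, Polynomial.eval_finsetSum] at h2
    simp only [Polynomial.eval_pow, Polynomial.eval_X, Polynomial.eval_mul, Polynomial.eval_C] at h2
    rw [h2]
    exact Finset.sum_congr rfl fun i _ => mul_comm _ _
  simp_rw [Polynomial.eval_eq_sum_range' (Nat.lt_succ_of_le hP), Finset.mul_sum]
  rw [Finset.sum_comm]
  refine Finset.sum_congr rfl fun j hj => ?_
  have hj' := key j (by simpa [Nat.lt_succ_iff] using hj)
  have hj'' : ∑ i ∈ s, (((Lagrange.basis s v i).eval 0 : ℝ) : ℂ) * ((v i : ℝ) : ℂ) ^ j = 0 ^ j := by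
    exact_mod_cast congrArg (Complex.ofReal) hj'
  rw [← hj'', Finset.mul_sum]
  exact Finset.sum_congr rfl fun i _ => by ring

variable {E : Type} [NormedAddCommGroup E] [NormedSpace ℝ E] [FiniteDimensional ℝ E]
  [MeasureSpace E] [BorelSpace E] [(volume : Measure E).IsAddHaarMeasure]

/-- A nonnegative test function of integral one supported in a small ball. -/
theorem exists_bump {ε : ℝ} (hε : 0 < ε) : ∃ ρ : Test E, tsupport ρ ⊆ Metric.ball 0 ε ∧
    ∫ x, ρ x = 1 ∧ ∀ x, 0 ≤ ρ x := by
  let b : ContDiffBump (0 : E) := ⟨ε / 4, ε / 2, by positivity, by linarith⟩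
  refine ⟨⟨b.normed volume, b.contDiff_normed, b.hasCompactSupport_normed, fun _ _ => trivial⟩,
    ?_, b.integral_normed, fun x => b.nonneg_normed x⟩
  change tsupport (b.normed volume) ⊆ _
  rw [b.tsupport_normed_eq]
  exact Metric.closedBall_subset_ball (by change ε / 2 < ε; linarith)

/-- A compactly supported kernel that reproduces the value at the origin of polynomials. -/
theorem exists_kernel (E : Type) [NormedAddCommGroup E] [NormedSpace ℝ E] [FiniteDimensional ℝ E]
    [MeasureSpace E] [BorelSpace E] [(volume : Measure E).IsAddHaarMeasure] (M : ℕ) :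
    ∃ ρ : Test E, tsupport ρ ⊆ Metric.ball 0 1 ∧
      ∀ p : E → ℂ, IsRayPoly M p → ∫ w, p w * ρ w = p 0 := by
  obtain ⟨c, hc⟩ := exists_extrapolation M
  obtain ⟨b, hb, hb1, -⟩ := exists_bump (E := E) one_pos
  let l : ℕ → ℝ := fun i => (1 / 2 : ℝ) ^ i
  have hl : ∀ i, 0 < l i := fun i => by positivity
  have hl1 : ∀ i, l i ≤ 1 := fun i => pow_le_one₀ (by norm_num) (by norm_num)
  let s := Finset.range (M + 1)
  have hsub : ∀ i, tsupport (fun w => b ((l i)⁻¹ • w)) ⊆ Metric.ball 0 1 := by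
    intro i
    have := tsupport_comp_eq_preimage b (Homeomorph.smulOfNeZero (l i)⁻¹ (inv_ne_zero (hl i).ne') (α := E))
    intro w hw
    have hw' : w ∈ (fun w => (l i)⁻¹ • w) ⁻¹' tsupport b :=
      this.subset hw
    have h2 : ‖(l i)⁻¹ • w‖ < 1 := by simpa using hb hw'
    rw [norm_smul, norm_inv, Real.norm_of_nonneg (hl i).le, inv_mul_lt_iff₀ (hl i), mul_one] at h2
    simpa using h2.trans_le (hl1 i)
  -- A combination of dilates of one bump, weighted by the extrapolation coefficients. Integration
  -- against the `i`-th dilate evaluates `p` at `2⁻ⁱ w`, averaged against the bump.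
  let ρ : E → ℝ := fun w => ∑ i ∈ s, (c i * ((l i) ^ Module.finrank ℝ E)⁻¹) * b ((l i)⁻¹ • w)
  have hρsmooth : ContDiff ℝ ∞ ρ := ContDiff.sum fun i _ =>
    contDiff_const.mul (b.contDiff.comp (contDiff_const_smul _))
  have hρs : tsupport ρ ⊆ ⋃ i ∈ s, tsupport fun w => b ((l i)⁻¹ • w) := by
    refine closure_minimal (fun w hw => ?_)
      (Set.Finite.isClosed_biUnion s.finite_toSet fun i _ => isClosed_tsupport _)
    by_contra h'
    apply hw
    refine Finset.sum_eq_zero fun i hi => ?_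
    have : b ((l i)⁻¹ • w) = 0 := by
      refine image_eq_zero_of_notMem_tsupport (f := fun w => b ((l i)⁻¹ • w)) fun h'' => h' ?_
      exact Set.mem_biUnion hi h''
    rw [this, mul_zero]
  have hρc : HasCompactSupport ρ := by
    have : ProperSpace E := FiniteDimensional.proper ℝ E
    refine HasCompactSupport.of_support_subset_isCompact (isCompact_closedBall (0 : E) 1)
      ((subset_tsupport _).trans (hρs.trans ?_))
    exact Set.iUnion₂_subset fun i _ => (hsub i).trans Metric.ball_subset_closedBall
  refine ⟨⟨ρ, hρsmooth, hρc, fun _ _ => trivial⟩, hρs.trans (Set.iUnion₂_subset fun i _ => hsub i),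
    fun p hp => ?_⟩
  change ∫ w, p w * ((ρ w : ℝ) : ℂ) = p 0
  have hbi : ∀ i, Integrable fun w => p (l i • w) * (b w : ℂ) := fun i =>
    integrable_mul_of_isTest (hp.comp_smul (l i)).continuous (IsTest.ofReal b)
  have hchange : ∀ i, ∫ w, p w * (((l i) ^ Module.finrank ℝ E)⁻¹ * b ((l i)⁻¹ • w) : ℝ)
      = ∫ w, p (l i • w) * (b w : ℂ) := by
    intro i
    have h1 := Measure.integral_comp_smul (volume : Measure E)
      (fun w => p w * (b ((l i)⁻¹ • w) : ℂ)) (l i)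
    simp only [inv_smul_smul₀ (hl i).ne'] at h1
    rw [h1, abs_of_pos (by have := hl i; positivity), ← integral_smul]
    congr 1; ext w
    rw [Complex.real_smul]; push_cast; ring
  have hint : ∀ i, Integrable fun w => p w * (((l i) ^ Module.finrank ℝ E)⁻¹ * b ((l i)⁻¹ • w) : ℝ) := by
    intro i
    refine Continuous.integrable_of_hasCompactSupport ?_ ?_
    · exact hp.continuous.mul (Complex.continuous_ofReal.comp (continuous_const.mul
        (b.continuous.comp (continuous_const_smul _))))
    · have h1 : HasCompactSupport fun w => b ((l i)⁻¹ • w) :=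
        b.hasCompactSupport.comp_homeomorph
          (Homeomorph.smulOfNeZero (l i)⁻¹ (inv_ne_zero (hl i).ne') (α := E))
      have h2 : HasCompactSupport fun w => ((l i) ^ Module.finrank ℝ E)⁻¹ * b ((l i)⁻¹ • w) :=
        h1.mul_left
      exact (h2.comp_left (g := Complex.ofReal) rfl).mul_left
  calc ∫ w, p w * ((ρ w : ℝ) : ℂ)
      = ∫ w, ∑ i ∈ s, (c i : ℂ) * (p w * (((l i) ^ Module.finrank ℝ E)⁻¹ * b ((l i)⁻¹ • w) : ℝ)) := by
        congr 1; ext w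
        simp only [ρ, Complex.ofReal_sum, Finset.mul_sum]
        refine Finset.sum_congr rfl fun i _ => ?_
        push_cast; ring
    _ = ∑ i ∈ s, (c i : ℂ) * ∫ w, p (l i • w) * (b w : ℂ) := by
        rw [integral_finsetSum _ fun i _ => (hint i).const_mul _]
        simp_rw [integral_const_mul, hchange]
    _ = ∫ w, ∑ i ∈ s, (c i : ℂ) * (p (l i • w) * (b w : ℂ)) := by
        rw [integral_finsetSum _ fun i _ => (hbi i).const_mul _]
        simp_rw [integral_const_mul]
    -- Extrapolation is applied pointwise in `w`, to the polynomial `p` restricted to the ray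
    -- through `w`.
    _ = ∫ w, p 0 * (b w : ℂ) := by
        congr 1; ext w
        obtain ⟨P, hP, hP'⟩ := hp.exists_poly w
        have h0 : p 0 = P.eval 0 := by simpa using hP' 0
        rw [h0, ← hc P hP, Finset.sum_mul]
        refine Finset.sum_congr rfl fun i _ => ?_
        rw [hP']; ring
    _ = p 0 := by
        rw [integral_const_mul, integral_complex_ofReal, hb1]; simp

/-- Averages of `H` at scale `l` around a point. -/
def avg (ρ : Test E) (l : ℝ) (H : E → ℂ) (x : E) : ℂ := ∫ w, H (x + l • w) * ρ w

/-- The kernel returns `p 0 = H x` exactly for the approximating `p`, so only the remainder `H - p`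
is averaged, at distance at most `l` from `x`. The equality `p 0 = H x` is the approximation at `w =
0`, where `α > 0` matters. -/
theorem norm_avg_sub_le {ρ : Test E} {M : ℕ} (hs : tsupport ρ ⊆ Metric.ball 0 1)
    (hρ : ∀ p : E → ℂ, IsRayPoly M p → ∫ w, p w * ρ w = p 0) {α A : ℝ} (hα : 0 < α) {H : E → ℂ}
    (hH : Continuous H) {x : E} (h : ApproxAt α M A H x) {l : ℝ} (hl : 0 < l) (hl1 : l ≤ 1) :
    ‖avg ρ l H x - H x‖ ≤ A * (∫ w, ‖ρ w‖) * l ^ α := by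
  have hA := h.nonneg
  obtain ⟨p, hp, -, h2⟩ := h
  have h0 : H x = p 0 := by
    have := h2 0 (by simp)
    rw [norm_zero, Real.zero_rpow hα.ne', mul_zero, norm_le_zero_iff, sub_eq_zero, add_zero] at this
    exact this
  have hp' := hp.comp_smul l
  have h1 : p 0 = ∫ w, p (l • w) * ρ w := by rw [hρ _ hp', smul_zero]
  have hHc : Continuous fun w => H (x + l • w) :=
    hH.comp (continuous_const.add (continuous_const_smul l))
  rw [h0, h1, avg, ← integral_sub (integrable_mul_of_isTest hHc (IsTest.ofReal ρ))
    (integrable_mul_of_isTest hp'.continuous (IsTest.ofReal ρ))]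
  have hi : Integrable fun w => ‖ρ w‖ :=
    (ρ.continuous.integrable_of_hasCompactSupport ρ.hasCompactSupport).norm
  have e : A * (∫ w, ‖ρ w‖) * l ^ α = ∫ w, A * l ^ α * ‖ρ w‖ := by
    rw [integral_const_mul]; ring
  rw [e]
  refine norm_integral_le_of_norm_le (hi.const_mul _) (Eventually.of_forall fun w => ?_)
  rw [← sub_mul, norm_mul, Complex.norm_real]
  by_cases hw : w ∈ tsupport ρ
  · have hw1 : ‖w‖ < 1 := by simpa using hs hw
    have hlw : ‖l • w‖ ≤ l := by
      rw [norm_smul, Real.norm_of_nonneg hl.le]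
      exact mul_le_of_le_one_right hl.le hw1.le
    gcongr
    refine (h2 _ (hlw.trans hl1)).trans ?_
    gcongr
  · rw [image_eq_zero_of_notMem_tsupport hw]; simp

end Kernel

/-! ### Smooth cutoffs -/

section Cutoff

open scoped Manifold in
/-- Smooth cutoff functions. -/
theorem exists_cutoff {E : Type} [NormedAddCommGroup E] [NormedSpace ℝ E] [FiniteDimensional ℝ E]
    {K U : Set E} (hK : IsCompact K) (hU : IsOpen U) (hKU : K ⊆ U) :
    ∃ ζ : Test E, tsupport ζ ⊆ U ∧ ∀ᶠ x in 𝓝ˢ K, ζ x = 1 := by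
  have : ProperSpace E := FiniteDimensional.proper ℝ E
  obtain ⟨L, hL, hKL, hLU⟩ := exists_compact_between hK hU hKU
  obtain ⟨ζ, h1, h0, -⟩ := exists_contMDiffMap_one_nhds_of_subset_interior (n := (⊤ : ℕ∞)) 𝓘(ℝ, E)
    hK.isClosed hKL
  have hs : Function.support ζ ⊆ L := fun x hx => by
    by_contra hx'
    exact hx (h0 x hx')
  exact ⟨⟨ζ, ζ.contMDiff.contDiff, HasCompactSupport.of_support_subset_isCompact hL hs,
    fun _ _ => trivial⟩, (closure_minimal hs hL.isClosed).trans hLU, h1⟩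

end Cutoff

/-! ### Approximate pairings at dyadic scales -/

section Averages

variable {E : Type} [NormedAddCommGroup E] [NormedSpace ℝ E] [FiniteDimensional ℝ E]
  [ProperSpace E] [SecondCountableTopology E]
  [MeasureSpace E] [BorelSpace E] [(volume : Measure E).IsAddHaarMeasure]

/-- The value of `g` on the kernel `ρ` rescaled to size `l` around `x`. -/
def kern (g : Distr E) (ρ : Test E) (l : ℝ) (x : E) : ℂ :=
  pair g fun y => (((l ^ Module.finrank ℝ E)⁻¹ * ρ (l⁻¹ • (x - y)) : ℝ) : ℂ)

theorem kern_eq (g : Distr E) (ρ : Test E) {l : ℝ} (hl : 0 < l) (x : E) :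
    kern g ρ l x = g (rescale ρ x l hl) :=
  pair_ofReal g (rescale ρ x l hl)

theorem isTest_kernel (ζ : Test E) (ρ : Test E) {l : ℝ} (hl : 0 < l) :
    IsTest fun q : E × E =>
      (ζ q.1 : ℂ) * (((l ^ Module.finrank ℝ E)⁻¹ * ρ (l⁻¹ • (q.1 - q.2)) : ℝ) : ℂ) := by
  refine ⟨?_, ?_⟩
  · refine ((IsTest.ofReal ζ).smooth.comp contDiff_fst).mul (Complex.ofRealCLM.contDiff.comp ?_)
    exact contDiff_const.mul (ρ.contDiff.comp ((contDiff_fst.sub contDiff_snd).const_smul _))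
  · refine HasCompactSupport.intro ((ζ.hasCompactSupport.isCompact.prod
      ρ.hasCompactSupport.isCompact).image (f := fun q : E × E => (q.1, q.1 - l • q.2))
        (by fun_prop)) ?_
    rintro ⟨x, y⟩ hxy
    by_contra hne
    apply hxy
    have h1 : ζ x ≠ 0 := fun h => hne (by simp [h])
    have h2 : ρ (l⁻¹ • (x - y)) ≠ 0 := fun h => hne (by simp [h])
    exact ⟨(x, l⁻¹ • (x - y)), ⟨subset_tsupport _ h1, subset_tsupport _ h2⟩, by
      simp [smul_inv_smul₀ hl.ne']⟩

theorem continuous_kern (g : Distr E) (ρ : Test E) {l : ℝ} (hl : 0 < l) :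
    Continuous (kern g ρ l) := by
  refine continuous_iff_continuousAt.2 fun x => ?_
  obtain ⟨ζ, -, hζ⟩ := exists_cutoff (isCompact_singleton (x := x)) isOpen_univ (Set.subset_univ _)
  have h1 := ((isTest_kernel ζ ρ hl).pair_slice g).continuous.continuousAt (x := x)
  refine h1.congr ?_
  rw [nhdsSet_singleton] at hζ
  filter_upwards [hζ] with y hy
  simp [kern, hy]

theorem avg_eq_integral (ρ : Test E) {l : ℝ} (hl : 0 < l) (H : E → ℂ) (z : E) :
    avg ρ l H z
      = ∫ x, H x * (((l ^ Module.finrank ℝ E)⁻¹ * ρ (l⁻¹ • (x - z)) : ℝ) : ℂ) := by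
  rw [← integral_add_left_eq_self (μ := volume) _ z]
  have h1 := Measure.integral_comp_smul (volume : Measure E)
      (fun w => H (z + w) * (ρ (l⁻¹ • w) : ℂ)) l
  simp only [inv_smul_smul₀ hl.ne'] at h1
  rw [avg, h1, abs_of_pos (by positivity), ← integral_smul]
  congr 1; ext w
  rw [Complex.real_smul]; push_cast
  simp only [add_sub_cancel_left]
  ring

/-- Averaging `H` is adjoint to smoothing `g`, by the Fubini theorem for distributions. The cutoff
`ζ`, equal to one on the support of `H`, makes the kernel compactly supported in both variables
without changing the integrals. -/
theorem exists_isTest_avg (ρ : Test E) {l : ℝ} (hl : 0 < l) {H : E → ℂ} (hH : Continuous H)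
    (hc : HasCompactSupport H) (g : Distr E) :
    IsTest (avg ρ l H) ∧ ∫ x, H x * kern g ρ l x = pair g (avg ρ l H) := by
  obtain ⟨ζ, -, hζ⟩ := exists_cutoff hc.isCompact isOpen_univ (Set.subset_univ _)
  have hζ' : ∀ x, H x * (ζ x : ℂ) = H x := by
    intro x
    by_cases hx : x ∈ tsupport H
    · rw [hζ.self_of_nhdsSet x hx]; simp
    · rw [image_eq_zero_of_notMem_tsupport hx, zero_mul]
  have ht := isTest_kernel ζ ρ hl
  have e : avg ρ l H = fun z => ∫ x, H x * ((ζ x : ℂ) *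
      (((l ^ Module.finrank ℝ E)⁻¹ * ρ (l⁻¹ • (x - z)) : ℝ) : ℂ)) := by
    ext z
    simp_rw [← mul_assoc, hζ']
    exact avg_eq_integral ρ hl H z
  refine ⟨?_, ?_⟩
  · rw [e]
    exact isTest_integral hH ht
  · rw [e, ← integral_mul_pair_slice g hH ht]
    congr 1; ext x
    have h1 : IsTest fun y => (((l ^ Module.finrank ℝ E)⁻¹ * ρ (l⁻¹ • (x - y)) : ℝ) : ℂ) :=
      IsTest.ofReal (rescale ρ x l hl)
    dsimp only
    rw [pair_const_mul g h1, ← mul_assoc, hζ']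
    rfl

theorem isTest_avg (ρ : Test E) {l : ℝ} (hl : 0 < l) {H : E → ℂ} (hH : Continuous H)
    (hc : HasCompactSupport H) : IsTest (avg ρ l H) :=
  (exists_isTest_avg ρ hl hH hc (ofFun H)).1

theorem support_avg_subset {ρ : Test E} (hs : tsupport ρ ⊆ Metric.ball 0 1) {l : ℝ} (hl : 0 < l)
    (hl1 : l ≤ 1) {H : E → ℂ} {K : Set E} (hK : tsupport H ⊆ K) :
    Function.support (avg ρ l H) ⊆ Metric.cthickening 1 K := by
  intro x hx
  by_contra hx'
  apply hx
  refine integral_eq_zero_of_ae (Eventually.of_forall fun w => ?_)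
  by_cases hw : w ∈ tsupport ρ
  · have h1 : x + l • w ∉ tsupport H := by
      intro h
      refine hx' (Metric.mem_cthickening_of_dist_le x (x + l • w) _ _ (hK h) ?_)
      have hw1 : ‖w‖ < 1 := by simpa using hs hw
      rw [dist_self_add_right, norm_smul, Real.norm_of_nonneg hl.le]
      nlinarith [norm_nonneg w]
    simp [image_eq_zero_of_notMem_tsupport h1]
  · simp [image_eq_zero_of_notMem_tsupport hw]

theorem avg_comm (ρ : Test E) (l l' : ℝ) {H : E → ℂ} (hH : Continuous H) :
    avg ρ l (avg ρ l' H) = avg ρ l' (avg ρ l H) := by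
  ext x
  simp only [avg, ← integral_mul_const]
  rw [integral_integral_swap]
  · congr 1; ext w; congr 1; ext w'
    rw [add_right_comm]; ring
  · refine Continuous.integrable_of_hasCompactSupport ?_ ?_
    · have := ρ.continuous
      simp only [Function.uncurry_def]
      fun_prop
    · refine HasCompactSupport.intro
        (ρ.hasCompactSupport.isCompact.prod ρ.hasCompactSupport.isCompact) ?_
      rintro ⟨w, w'⟩ h
      simp only [Set.mem_prod, not_and_or] at h
      rcases h with h | h <;> simp [image_eq_zero_of_notMem_tsupport h]

/-- The approximate pairing of `g` with `H` at scale `l`. -/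
def scalePair (g : Distr E) (ρ : Test E) (l : ℝ) (H : E → ℂ) : ℂ :=
  ∫ x, avg ρ l H x * kern g ρ l x

theorem scalePair_eq (g : Distr E) (ρ : Test E) {l : ℝ} (hl : 0 < l) {H : E → ℂ}
    (hH : Continuous H) (hc : HasCompactSupport H) :
    scalePair g ρ l H = pair g (avg ρ l (avg ρ l H)) := by
  have h := isTest_avg ρ hl hH hc
  exact (exists_isTest_avg ρ hl h.continuous h.compact g).2

theorem integrable_mul_kern (g : Distr E) (ρ : Test E) {l : ℝ} (hl : 0 < l) {φ : E → ℂ}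
    (h : IsTest φ) : Integrable fun x => φ x * kern g ρ l x := by
  simpa only [mul_comm] using integrable_mul_of_isTest (continuous_kern g ρ hl) h

/-- The difference factors like `a² - b²`: each of the two cross terms is `g` applied to `H`
averaged once at each scale, and the averages commute. -/
theorem scalePair_sub (g : Distr E) (ρ : Test E) {l l' : ℝ} (hl : 0 < l) (hl' : 0 < l')
    {H : E → ℂ} (hH : Continuous H) (hc : HasCompactSupport H) :
    scalePair g ρ l H - scalePair g ρ l' H =
      ∫ x, (avg ρ l H x - avg ρ l' H x) * (kern g ρ l x + kern g ρ l' x) := by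
  have h := isTest_avg ρ hl hH hc
  have h' := isTest_avg ρ hl' hH hc
  have cross : ∫ x, avg ρ l H x * kern g ρ l' x = ∫ x, avg ρ l' H x * kern g ρ l x := by
    rw [(exists_isTest_avg ρ hl' h.continuous h.compact g).2,
      (exists_isTest_avg ρ hl h'.continuous h'.compact g).2, avg_comm ρ l l' hH]
  have i1 := integrable_mul_kern g ρ hl h
  have i2 := integrable_mul_kern g ρ hl' h
  have i3 := integrable_mul_kern g ρ hl h'
  have i4 := integrable_mul_kern g ρ hl' h'
  have e : ∀ x, (avg ρ l H x - avg ρ l' H x) * (kern g ρ l x + kern g ρ l' x)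
      = (avg ρ l H x * kern g ρ l x + avg ρ l H x * kern g ρ l' x)
        - (avg ρ l' H x * kern g ρ l x + avg ρ l' H x * kern g ρ l' x) := fun x => by ring
  simp_rw [e]
  have i12 : Integrable fun x => avg ρ l H x * kern g ρ l x + avg ρ l H x * kern g ρ l' x :=
    i1.add i2
  have i34 : Integrable fun x => avg ρ l' H x * kern g ρ l x + avg ρ l' H x * kern g ρ l' x :=
    i3.add i4
  rw [integral_sub i12 i34, integral_add i1 i2, integral_add i3 i4, cross,
    scalePair, scalePair]
  ring

theorem norm_integral_mul_le {a b : E → ℂ} {K : Set E} (hK : IsCompact K)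
    (hs : Function.support a ⊆ K) {B : ℝ} (hB : ∀ x, ‖a x‖ ≤ B) (hb : Continuous b) :
    ‖∫ x, a x * b x‖ ≤ B * ∫ x in K, ‖b x‖ := by
  have e : ∫ x, a x * b x = ∫ x in K, a x * b x := by
    rw [setIntegral_eq_integral_of_forall_compl_eq_zero]
    intro x hx
    have : a x = 0 := by
      by_contra h
      exact hx (hs h)
    rw [this, zero_mul]
  rw [e, ← integral_const_mul]
  refine norm_integral_le_of_norm_le ?_ (Eventually.of_forall fun x => ?_)
  · exact ((hb.norm).continuousOn.integrableOn_compact hK).const_mul B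
  · rw [norm_mul]
    exact mul_le_mul_of_nonneg_right (hB x) (norm_nonneg _)

/-- The regularity of `g`, measured by a kernel: the averages at scale `2⁻ⁿ` grow, in `L¹` on
compact sets, summably slower than `2 ^ (n α)`. -/
def SummableKern (α : ℝ) (g : Distr E) (ρ : Test E) : Prop :=
  ∀ K : Set E, IsCompact K →
    Summable fun n : ℕ => ((1 / 2 : ℝ) ^ n) ^ α * ∫ x in K, ‖kern g ρ ((1 / 2 : ℝ) ^ n) x‖

/-- The averages of `H` at scale `2⁻ⁿ` converge uniformly at rate `2 ^ (-n α)`. -/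
def AvgRate (α : ℝ) (ρ : Test E) (B : ℝ) (H : E → ℂ) : Prop :=
  ∀ n : ℕ, ∀ x, ‖avg ρ ((1 / 2 : ℝ) ^ n) H x - H x‖ ≤ B * ((1 / 2 : ℝ) ^ n) ^ α

theorem half_pow_pos (n : ℕ) : (0 : ℝ) < (1 / 2 : ℝ) ^ n := by positivity

theorem half_pow_le_one (n : ℕ) : (1 / 2 : ℝ) ^ n ≤ 1 := pow_le_one₀ (by norm_num) (by norm_num)

/-- Rate of convergence of the approximate pairings. -/
theorem exists_rate {α : ℝ} {g : Distr E} {ρ : Test E} (hs : tsupport ρ ⊆ Metric.ball 0 1)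
    (hα : 0 < α)
    (hg : SummableKern α g ρ) {K : Set E} (hK : IsCompact K) :
    ∃ τ : ℕ → ℝ, Tendsto τ atTop (𝓝 0) ∧ ∀ (H : E → ℂ) (B : ℝ), Continuous H → tsupport H ⊆ K →
      AvgRate α ρ B H → ∃ L : ℂ,
        Tendsto (fun n : ℕ => scalePair g ρ ((1 / 2 : ℝ) ^ n) H) atTop (𝓝 L) ∧
        ∀ n : ℕ, ‖scalePair g ρ ((1 / 2 : ℝ) ^ n) H - L‖ ≤ B * τ n := by
  -- Averaging at scale at most one enlarges supports by at most one, so all integrals take place on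
  -- this compact set.
  have hK1 := hK.cthickening (r := 1)
  set K1 := Metric.cthickening 1 K
  set I : ℕ → ℝ := fun n => ∫ x in K1, ‖kern g ρ ((1 / 2 : ℝ) ^ n) x‖
  have hI : ∀ n, 0 ≤ I n := fun n => integral_nonneg fun _ => norm_nonneg _
  set a : ℕ → ℝ := fun n => ((1 / 2 : ℝ) ^ n) ^ α * I n
  have ha : Summable a := hg K1 hK1
  -- With `r = 2^(-nα)` the averages at scales `n` and `n+1` differ by at most `2Br`. In front of
  -- the second kernel integral, `r` is `2^α` times the weight that belongs to scale `n+1`.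
  set σ : ℕ → ℝ := fun n => 2 * (a n + 2 ^ α * a (n + 1))
  have hσ : Summable σ := (ha.add (((summable_nat_add_iff 1).2 ha).mul_left _)).mul_left _
  refine ⟨fun n => ∑' m, σ (n + m), ?_, fun H B hH hHK hB => ?_⟩
  · refine (tendsto_sum_nat_add σ).congr fun n => tsum_congr fun m => ?_
    rw [add_comm]
  have hc : HasCompactSupport H :=
    HasCompactSupport.of_support_subset_isCompact hK ((subset_tsupport _).trans hHK)
  have hB0 : 0 ≤ B := by simpa using (norm_nonneg _).trans (hB 0 0)
  have hdist : ∀ n, dist (scalePair g ρ ((1 / 2 : ℝ) ^ n) H)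
      (scalePair g ρ ((1 / 2 : ℝ) ^ n.succ) H) ≤ B * σ n := by
    intro n
    have hp := half_pow_pos
    rw [dist_eq_norm, scalePair_sub g ρ (hp n) (hp (n + 1)) hH hc]
    set r : ℝ := ((1 / 2 : ℝ) ^ n) ^ α with hr
    have hr0 : 0 ≤ r := by positivity
    have hr1 : ((1 / 2 : ℝ) ^ (n + 1)) ^ α ≤ r := by
      rw [hr]; gcongr ?_ ^ α
      exact pow_le_pow_of_le_one (by norm_num) (by norm_num) (Nat.le_succ n)
    have hr2 : r = 2 ^ α * ((1 / 2 : ℝ) ^ (n + 1)) ^ α := by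
      rw [← Real.mul_rpow (by norm_num) (by positivity), hr]; congr 1; rw [pow_succ]; ring
    have h1 := norm_integral_mul_le (a := fun x => avg ρ ((1 / 2 : ℝ) ^ n) H x
        - avg ρ ((1 / 2 : ℝ) ^ (n + 1)) H x)
      (b := fun x => kern g ρ ((1 / 2 : ℝ) ^ n) x + kern g ρ ((1 / 2 : ℝ) ^ (n + 1)) x)
      (B := 2 * B * r) hK1 (fun x hx => ?_) (fun x => ?_)
      ((continuous_kern g ρ (hp n)).add (continuous_kern g ρ (hp (n + 1))))
    · refine h1.trans ?_
      have h2 : ∫ x in K1, ‖kern g ρ ((1 / 2 : ℝ) ^ n) x + kern g ρ ((1 / 2 : ℝ) ^ (n + 1)) x‖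
          ≤ I n + I (n + 1) := by
        have j1 := ((continuous_kern g ρ (hp n)).norm.continuousOn (s := K1)).integrableOn_compact
          (μ := volume) hK1
        have j2 := ((continuous_kern g ρ (hp (n + 1))).norm.continuousOn (s := K1)).integrableOn_compact
          (μ := volume) hK1
        rw [← integral_add j1 j2]
        refine integral_mono_of_nonneg (Eventually.of_forall fun _ => norm_nonneg _) (j1.add j2)
          (Eventually.of_forall fun x => norm_add_le _ _)
      calc _ ≤ 2 * B * r * (I n + I (n + 1)) := by gcongr
        _ = B * σ n := by
          simp only [σ, a, ← hr]
          rw [mul_add, ← mul_assoc (2 ^ α), ← hr2]; ring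
    · by_contra hx'
      apply hx
      have e1 : avg ρ ((1 / 2 : ℝ) ^ n) H x = 0 := by
        by_contra h
        exact hx' (support_avg_subset hs (hp n) (half_pow_le_one n) hHK h)
      have e2 : avg ρ ((1 / 2 : ℝ) ^ (n + 1)) H x = 0 := by
        by_contra h
        exact hx' (support_avg_subset hs (hp (n + 1)) (half_pow_le_one _) hHK h)
      change avg ρ _ H x - avg ρ _ H x = 0
      rw [e1, e2, sub_zero]
    · calc _ = ‖(avg ρ ((1 / 2 : ℝ) ^ n) H x - H x) - (avg ρ ((1 / 2 : ℝ) ^ (n + 1)) H x - H x)‖ := by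
            congr 1; ring
        _ ≤ B * r + B * r := (norm_sub_le _ _).trans (add_le_add (hB n x)
            ((hB (n + 1) x).trans (by gcongr)))
        _ = 2 * B * r := by ring
  obtain ⟨L, hL⟩ := cauchySeq_tendsto_of_complete
    (cauchySeq_of_dist_le_of_summable _ hdist (hσ.mul_left B))
  refine ⟨L, hL, fun n => ?_⟩
  have := dist_le_tsum_of_dist_le_of_tendsto _ hdist (hσ.mul_left B) hL n
  rwa [tsum_mul_left, dist_eq_norm] at this

theorem continuous_pair_translate (g : Distr E) {φ : E → ℂ} (h : IsTest φ) :
    Continuous fun c => pair g fun z => φ (z + c) := by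
  refine continuous_iff_continuousAt.2 fun x => ?_
  obtain ⟨ζ, -, hζ⟩ := exists_cutoff (isCompact_singleton (x := x)) isOpen_univ (Set.subset_univ _)
  have ht : IsTest fun q : E × E => (ζ q.1 : ℂ) * φ (q.2 + q.1) := by
    refine ⟨((IsTest.ofReal ζ).smooth.comp contDiff_fst).mul
      (h.smooth.comp (contDiff_snd.add contDiff_fst)), ?_⟩
    refine HasCompactSupport.intro ((ζ.hasCompactSupport.isCompact.prod
      h.compact.isCompact).image (f := fun q : E × E => (q.1, q.2 - q.1)) (by fun_prop)) ?_
    rintro ⟨c, y⟩ hxy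
    by_contra hne
    apply hxy
    have h1 : ζ c ≠ 0 := fun h => hne (by simp [h])
    have h2 : φ (y + c) ≠ 0 := fun h => hne (by simp [h])
    exact ⟨(c, y + c), ⟨subset_tsupport _ h1, subset_tsupport _ h2⟩, by simp⟩
  refine (ht.pair_slice g).continuous.continuousAt.congr ?_
  rw [nhdsSet_singleton] at hζ
  filter_upwards [hζ] with y hy
  simp [hy]

theorem pair_avg (g : Distr E) (ρ : Test E) (l : ℝ) {φ : E → ℂ} (h : IsTest φ) :
    pair g (avg ρ l φ) = ∫ w, (pair g fun z => φ (z + l • w)) * ρ w := by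
  have ht : IsTest fun q : E × E => (ρ q.1 : ℂ) * φ (q.2 + l • q.1) := by
    refine ⟨((IsTest.ofReal ρ).smooth.comp contDiff_fst).mul
      (h.smooth.comp (contDiff_snd.add (contDiff_fst.const_smul l))), ?_⟩
    refine HasCompactSupport.intro ((ρ.hasCompactSupport.isCompact.prod
      h.compact.isCompact).image (f := fun q : E × E => (q.1, q.2 - l • q.1)) (by fun_prop)) ?_
    rintro ⟨c, y⟩ hxy
    by_contra hne
    apply hxy
    have h1 : ρ c ≠ 0 := fun h => hne (by simp [h])
    have h2 : φ (y + l • c) ≠ 0 := fun h => hne (by simp [h])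
    exact ⟨(c, y + l • c), ⟨subset_tsupport _ h1, subset_tsupport _ h2⟩, by simp⟩
  have := integral_mul_pair_slice g (H := fun _ => 1) continuous_const ht
  simp only [one_mul] at this
  have e : avg ρ l φ = fun z => ∫ w, (ρ w : ℂ) * φ (z + l • w) := by
    ext z; simp only [avg, mul_comm]
  rw [e, ← this]
  congr 1; ext w
  rw [pair_const_mul g (h.comp_add_right _), mul_comm]

theorem norm_integral_mul_sub_le {ρ : Test E} (h1 : ∫ w, ρ w = 1) {f : E → ℂ} (hf : Continuous f)
    {c : ℂ} {ε : ℝ} (hε : ∀ w ∈ tsupport ρ, ‖f w - c‖ ≤ ε) :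
    ‖(∫ w, f w * ρ w) - c‖ ≤ ε * ∫ w, ‖ρ w‖ := by
  have hi : Integrable ρ := ρ.continuous.integrable_of_hasCompactSupport ρ.hasCompactSupport
  have hi2 : Integrable fun w => c * (ρ w : ℂ) := hi.ofReal.const_mul c
  have e : c = ∫ w, c * (ρ w : ℂ) := by
    rw [integral_const_mul, integral_complex_ofReal, h1]; simp
  conv_lhs => rw [e]
  rw [← integral_sub (integrable_mul_of_isTest hf (IsTest.ofReal ρ)) hi2,
    ← integral_const_mul]
  refine norm_integral_le_of_norm_le (hi.norm.const_mul _) (Eventually.of_forall fun w => ?_)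
  rw [← sub_mul, norm_mul, Complex.norm_real]
  by_cases hw : w ∈ tsupport ρ
  · gcongr; exact hε w hw
  · simp [image_eq_zero_of_notMem_tsupport hw]

/-- The approximate pairings with a test function converge to the true value. -/
theorem tendsto_scalePair (g : Distr E) {ρ : Test E} (hs : tsupport ρ ⊆ Metric.ball 0 1)
    (h1 : ∫ w, ρ w = 1) {φ : E → ℂ} (h : IsTest φ) :
    Tendsto (fun n : ℕ => scalePair g ρ ((1 / 2 : ℝ) ^ n) φ) atTop (𝓝 (pair g φ)) := by
  set G : E → ℂ := fun c => pair g fun z => φ (z + c)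
  have hG : Continuous G := continuous_pair_translate g h
  have hG0 : G 0 = pair g φ := by simp [G]
  set R := ∫ w, ‖ρ w‖
  have hR : 0 ≤ R := integral_nonneg fun _ => norm_nonneg _
  rw [Metric.tendsto_atTop]
  intro ε hε
  -- The pairing with `avg (avg φ)` is a double `ρ`-average of `g` on translates of `φ`. Since `ρ`
  -- may change sign, each averaging costs a factor `R`.
  obtain ⟨δ, hδ, hGδ⟩ := Metric.continuousAt_iff.1 (hG.continuousAt (x := 0))
    (ε / (R * R + 1)) (by positivity)
  obtain ⟨N, hN⟩ := exists_pow_lt_of_lt_one (half_pos hδ) (by norm_num : (1 / 2 : ℝ) < 1)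
  refine ⟨N, fun n hn => ?_⟩
  have hl := half_pow_pos n
  set l : ℝ := (1 / 2 : ℝ) ^ n
  have hlδ : l < δ / 2 := (pow_le_pow_of_le_one (by norm_num) (by norm_num) hn).trans_lt hN
  have hφ' := isTest_avg ρ hl h.continuous h.compact
  rw [scalePair_eq g ρ hl h.continuous h.compact, pair_avg g ρ l hφ', dist_eq_norm]
  have hnorm : ∀ w ∈ tsupport ρ, ‖l • w‖ ≤ l := by
    intro w hw
    have hw1 : ‖w‖ < 1 := by simpa using hs hw
    rw [norm_smul, Real.norm_of_nonneg hl.le]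
    exact mul_le_of_le_one_right hl.le hw1.le
  have inner : ∀ w ∈ tsupport ρ,
      ‖(pair g fun z => avg ρ l φ (z + l • w)) - pair g φ‖ ≤ ε / (R * R + 1) * R := by
    intro w hw
    have e : (fun z => avg ρ l φ (z + l • w)) = avg ρ l fun z => φ (z + l • w) := by
      ext z; simp only [avg, add_right_comm]
    rw [e, pair_avg g ρ l (h.comp_add_right _)]
    refine norm_integral_mul_sub_le h1 ?_ fun w' hw' => ?_
    · exact continuous_pair_translate g (h.comp_add_right _) |>.comp (continuous_const_smul l)
    · have hlt : dist (l • w' + l • w) 0 < δ := by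
        rw [dist_zero_right]
        exact (norm_add_le _ _).trans_lt (by linarith [hnorm w hw, hnorm w' hw'])
      have := (hGδ hlt).le
      rw [hG0, dist_eq_norm] at this
      simpa only [G, add_assoc] using this
  have := norm_integral_mul_sub_le h1 ((continuous_pair_translate g hφ').comp
    (continuous_const_smul l)) inner
  refine lt_of_le_of_lt this ?_
  rw [mul_assoc, div_mul_eq_mul_div, div_lt_iff₀ (by positivity)]
  nlinarith

theorem norm_avg_le {ρ : Test E} {l B : ℝ} {H : E → ℂ} (hB : ∀ x, ‖H x‖ ≤ B) (x : E) :
    ‖avg ρ l H x‖ ≤ B * ∫ w, ‖ρ w‖ := by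
  have hi : Integrable ρ := ρ.continuous.integrable_of_hasCompactSupport ρ.hasCompactSupport
  rw [← integral_const_mul]
  refine norm_integral_le_of_norm_le (hi.norm.const_mul _) (Eventually.of_forall fun w => ?_)
  rw [norm_mul, Complex.norm_real]
  gcongr
  exact hB _

theorem norm_scalePair_le (g : Distr E) {ρ : Test E} (hs : tsupport ρ ⊆ Metric.ball 0 1)
    {K : Set E} (hK : IsCompact K) {l B : ℝ} (hl : 0 < l) (hl1 : l ≤ 1) {H : E → ℂ}
    (hHK : tsupport H ⊆ K) (hB : ∀ x, ‖H x‖ ≤ B) :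
    ‖scalePair g ρ l H‖ ≤ B * (∫ w, ‖ρ w‖) * ∫ x in Metric.cthickening 1 K, ‖kern g ρ l x‖ :=
  norm_integral_mul_le (hK.cthickening (r := 1)) (support_avg_subset hs hl hl1 hHK)
    (norm_avg_le hB) (continuous_kern g ρ hl)

theorem avg_add (ρ : Test E) (l : ℝ) {H H' : E → ℂ} (hH : Continuous H) (hH' : Continuous H')
    (x : E) : avg ρ l (fun y => H y + H' y) x = avg ρ l H x + avg ρ l H' x := by
  have h1 : Continuous fun w => H (x + l • w) := hH.comp (by fun_prop)
  have h2 : Continuous fun w => H' (x + l • w) := hH'.comp (by fun_prop)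
  simp only [avg, add_mul]
  exact integral_add (integrable_mul_of_isTest h1 (IsTest.ofReal ρ))
    (integrable_mul_of_isTest h2 (IsTest.ofReal ρ))

theorem scalePair_add (g : Distr E) (ρ : Test E) {l : ℝ} (hl : 0 < l) {H H' : E → ℂ}
    (hH : Continuous H) (hc : HasCompactSupport H) (hH' : Continuous H')
    (hc' : HasCompactSupport H') :
    scalePair g ρ l (fun y => H y + H' y) = scalePair g ρ l H + scalePair g ρ l H' := by
  simp only [scalePair, avg_add ρ l hH hH', add_mul]
  exact integral_add (integrable_mul_kern g ρ hl (isTest_avg ρ hl hH hc))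
    (integrable_mul_kern g ρ hl (isTest_avg ρ hl hH' hc'))

theorem scalePair_const_mul (g : Distr E) (ρ : Test E) (l : ℝ) (c : ℂ) (H : E → ℂ) :
    scalePair g ρ l (fun y => c * H y) = c * scalePair g ρ l H := by
  simp only [scalePair, avg, mul_assoc, integral_const_mul]

end Averages

/-! ### Convergence of pairings with smeared products -/

section Core

variable {E : Type} [NormedAddCommGroup E] [NormedSpace ℝ E] [FiniteDimensional ℝ E]
  [ProperSpace E] [SecondCountableTopology E]
  [MeasureSpace E] [BorelSpace E] [(volume : Measure E).IsAddHaarMeasure]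

theorem ApproxAt.norm_le {α : ℝ} (hα : 0 < α) {m : ℕ} {A : ℝ} {H : E → ℂ} {x : E}
    (h : ApproxAt α m A H x) : ‖H x‖ ≤ A := by
  obtain ⟨p, -, h1, h2⟩ := h
  have e := h2 0 (by simp)
  rw [norm_zero, Real.zero_rpow hα.ne', mul_zero, norm_le_zero_iff, sub_eq_zero, add_zero] at e
  rw [e]; exact h1 0 (by simp)

theorem isRayPoly_one (m : ℕ) : IsRayPoly m fun _ : E => (1 : ℂ) :=
  ⟨continuous_const, fun _ => ⟨1, by simp, by simp⟩⟩

theorem integral_kernel_eq_one {ρ : Test E} {M : ℕ}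
    (hρ : ∀ p : E → ℂ, IsRayPoly M p → ∫ w, p w * ρ w = p 0) : ∫ w, ρ w = 1 := by
  have := hρ _ (isRayPoly_one M)
  simp only [one_mul] at this
  rw [integral_complex_ofReal] at this
  exact_mod_cast this

instance isAddHaarMeasure_volume_prod : (volume : Measure (E × E)).IsAddHaarMeasure :=
  inferInstanceAs ((volume : Measure E).prod volume).IsAddHaarMeasure

/-- The smeared product of `η` and `F`. -/
def smear (η F : E → ℂ) (Θ : Test (E × E)) (z : E) : ℂ :=
  ∫ q : E × E, F q.2 * (η q.1 * (Θ (q.1 - q.2, q.1 - z) : ℂ))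

theorem isTest_smear_kernel {η : E → ℂ} (hη : IsTest η) (Θ : Test (E × E)) :
    IsTest fun r : (E × E) × E => η r.1.1 * (Θ (r.1.1 - r.1.2, r.1.1 - r.2) : ℂ) := by
  have hΘ := IsTest.ofReal Θ
  refine ⟨(hη.smooth.comp (by fun_prop)).mul (hΘ.smooth.comp (by fun_prop)), ?_⟩
  refine HasCompactSupport.intro ((hη.compact.isCompact.prod
    Θ.hasCompactSupport.isCompact).image
      (f := fun q : E × (E × E) => ((q.1, q.1 - q.2.1), q.1 - q.2.2)) (by fun_prop)) ?_
  rintro ⟨⟨x, y⟩, z⟩ hxy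
  by_contra hne
  apply hxy
  have h1 : η x ≠ 0 := fun h => hne (by simp [h])
  have h2 : Θ (x - y, x - z) ≠ 0 := fun h => hne (by simp [h])
  exact ⟨(x, (x - y, x - z)), ⟨subset_tsupport _ h1, subset_tsupport _ h2⟩, by simp⟩

theorem isTest_smear {η F : E → ℂ} (hη : IsTest η) (hF : Continuous F) (Θ : Test (E × E)) :
    IsTest (smear η F Θ) :=
  isTest_integral (P := E × E) (H := fun q => F q.2) (hF.comp continuous_snd)
    (isTest_smear_kernel hη Θ)

/-- The substitution `a = x - y`, `b = x - z` exhibits the smeared product as a `Θ`-average of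
translated products, whose estimates of order `α` do not depend on the translation. -/
theorem smear_eq {η F : E → ℂ} (hη : IsTest η) (hF : Continuous F) (Θ : Test (E × E)) (z : E) :
    smear η F Θ z = ∫ q : E × E, η (z + q.2) * F (z + q.2 - q.1) * (Θ q : ℂ) := by
  have i1 : Integrable (fun q : E × E => F q.2 * (η q.1 * (Θ (q.1 - q.2, q.1 - z) : ℂ))) :=
    integrable_mul_of_isTest (H := fun q : E × E => F q.2) (hF.comp continuous_snd)
      ((isTest_smear_kernel hη Θ).slice_left z)
  have hc : Continuous fun q : E × E => η (z + q.2) * F (z + q.2 - q.1) := by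
    have := hη.continuous
    fun_prop
  have i2 : Integrable (fun q : E × E => η (z + q.2) * F (z + q.2 - q.1) * (Θ q : ℂ)) :=
    integrable_mul_of_isTest hc (IsTest.ofReal Θ)
  rw [smear]
  refine (integral_prod _ i1).trans (Eq.trans ?_ (integral_prod_symm _ i2).symm)
  rw [← integral_add_left_eq_self (μ := volume) _ z]
  congr 1; ext b
  rw [← integral_sub_left_eq_self (μ := volume) _ (z + b)]
  congr 1; ext a
  simp only [sub_sub_cancel, add_sub_cancel_left]
  ring

theorem tsupport_smear_subset {η F : E → ℂ} (hη : IsTest η) (hF : Continuous F)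
    {Θ : Test (E × E)} {ε : ℝ} (hΘ : tsupport Θ ⊆ Metric.ball 0 ε) :
    tsupport (smear η F Θ) ⊆ Metric.cthickening ε (tsupport η) := by
  refine closure_minimal (fun z hz => ?_) Metric.isClosed_cthickening
  by_contra hz'
  apply hz
  rw [smear_eq hη hF]
  refine integral_eq_zero_of_ae (Eventually.of_forall fun q => ?_)
  by_cases hq : q ∈ tsupport Θ
  · have h1 : z + q.2 ∉ tsupport η := by
      intro h
      refine hz' (Metric.mem_cthickening_of_dist_le z (z + q.2) _ _ h ?_)
      have hq1 : ‖q‖ < ε := by simpa using hΘ hq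
      rw [dist_self_add_right]
      exact (norm_snd_le q).trans hq1.le
    simp [image_eq_zero_of_notMem_tsupport h1]
  · simp [image_eq_zero_of_notMem_tsupport hq]

/-- Averaging in `z` commutes with integration in `q`, so the rate survives at the cost of `∫ |Θ|`.
This is where the `L¹` bound on delta sequences enters the estimates of order `α`. -/
theorem AvgRate.integral {P : Type} [NormedAddCommGroup P] [NormedSpace ℝ P]
    [FiniteDimensional ℝ P] [SecondCountableTopology P] [MeasureSpace P] [BorelSpace P]
    [(volume : Measure P).IsAddHaarMeasure] {α B : ℝ} {ρ : Test E} {H : P → E → ℂ}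
    (hH : Continuous (Function.uncurry H)) (hB : ∀ q, AvgRate α ρ B (H q)) (Θ : Test P) :
    AvgRate α ρ (B * ∫ q, ‖Θ q‖) fun z => ∫ q, H q z * (Θ q : ℂ) := by
  intro n x
  set l := (1 / 2 : ℝ) ^ n
  have hi : Integrable Θ := Θ.continuous.integrable_of_hasCompactSupport Θ.hasCompactSupport
  have hHq : ∀ q, Continuous (H q) := fun q => hH.comp (continuous_const.prodMk continuous_id)
  have hHz : ∀ z, Continuous fun q => H q z := fun z =>
    hH.comp (continuous_id.prodMk continuous_const)
  have hj : Continuous fun r : E × P => H r.2 (x + l • r.1) * (Θ r.2 : ℂ) * (ρ r.1 : ℂ) := by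
    have h1 := (IsTest.ofReal Θ).continuous
    have h2 := (IsTest.ofReal ρ).continuous
    have h3 : Continuous fun r : E × P => H r.2 (x + l • r.1) :=
      hH.comp (continuous_snd.prodMk (by fun_prop))
    fun_prop
  have hjc : HasCompactSupport fun r : E × P => H r.2 (x + l • r.1) * (Θ r.2 : ℂ) * (ρ r.1 : ℂ) := by
    refine HasCompactSupport.intro
        (ρ.hasCompactSupport.isCompact.prod Θ.hasCompactSupport.isCompact) ?_
    rintro ⟨w, w'⟩ h
    simp only [Set.mem_prod, not_and_or] at h
    rcases h with h | h <;> simp [image_eq_zero_of_notMem_tsupport h]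
  have hint : Integrable (fun r : E × P => H r.2 (x + l • r.1) * (Θ r.2 : ℂ) * (ρ r.1 : ℂ))
      ((volume : Measure E).prod volume) := hj.integrable_of_hasCompactSupport hjc
  have e1 : avg ρ l (fun z => ∫ q, H q z * (Θ q : ℂ)) x = ∫ q, avg ρ l (H q) x * (Θ q : ℂ) := by
    simp only [avg, ← integral_mul_const]
    rw [integral_integral_swap hint]
    congr 1; ext q; congr 1; ext w; ring
  have i1 : Integrable fun q => avg ρ l (H q) x * (Θ q : ℂ) := by
    refine hint.integral_prod_right.congr (Eventually.of_forall fun q => ?_)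
    simp only [avg, ← integral_mul_const]
    congr 1; ext w; ring
  have i2 : Integrable fun q => H q x * (Θ q : ℂ) :=
    integrable_mul_of_isTest (hHz x) (IsTest.ofReal Θ)
  rw [e1, ← integral_sub i1 i2, mul_right_comm, ← integral_const_mul]
  refine norm_integral_le_of_norm_le (hi.norm.const_mul _) (Eventually.of_forall fun q => ?_)
  rw [← sub_mul, norm_mul, Complex.norm_real]
  exact mul_le_mul_of_nonneg_right (hB q n x) (norm_nonneg _)

/-- Convergence of the pairings with smeared products. -/
theorem tendsto_pair_of_avgRate {α B C : ℝ} {g : Distr E} {ρ : Test E}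
    (hs : tsupport ρ ⊆ Metric.ball 0 1) (h1 : ∫ w, ρ w = 1) (hα : 0 < α)
    (hg : SummableKern α g ρ) {K : Set E} (hK : IsCompact K) {φ : ℕ → E → ℂ}
    (hφ : ∀ j, IsTest (φ j)) (hφK : ∀ j, tsupport (φ j) ⊆ K) (hφB : ∀ j, AvgRate α ρ B (φ j))
    {H : E → ℂ} (hH : Continuous H) (hHK : tsupport H ⊆ K) (hHB : AvgRate α ρ C H)
    (hlim : ∀ ε : ℝ, 0 < ε → ∀ᶠ j in atTop, ∀ z, ‖φ j z - H z‖ ≤ ε) {L : ℂ}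
    (hL : Tendsto (fun n : ℕ => scalePair g ρ ((1 / 2 : ℝ) ^ n) H) atTop (𝓝 L)) :
    Tendsto (fun j => pair g (φ j)) atTop (𝓝 L) := by
  obtain ⟨τ, hτ, hrate⟩ := exists_rate hs hα hg hK
  have r1 : ∀ j n, ‖scalePair g ρ ((1 / 2 : ℝ) ^ n) (φ j) - pair g (φ j)‖ ≤ B * τ n := by
    intro j n
    obtain ⟨L', hL', hb⟩ := hrate (φ j) B (hφ j).continuous (hφK j) (hφB j)
    rw [tendsto_nhds_unique (tendsto_scalePair g hs h1 (hφ j)) hL']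
    exact hb n
  have r2 : ∀ n, ‖scalePair g ρ ((1 / 2 : ℝ) ^ n) H - L‖ ≤ C * τ n := by
    intro n
    obtain ⟨L', hL', hb⟩ := hrate H C hH hHK hHB
    rw [tendsto_nhds_unique hL hL']
    exact hb n
  have hHc : HasCompactSupport H :=
    HasCompactSupport.of_support_subset_isCompact hK ((subset_tsupport _).trans hHK)
  rw [Metric.tendsto_nhds]
  intro ε hε
  -- The scale is fixed first, uniformly in `j`; only then is the uniform closeness of `φ j` to `H`
  -- used, at that single scale.
  obtain ⟨n, hn1, hn2⟩ : ∃ n, B * τ n < ε / 3 ∧ C * τ n < ε / 3 := by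
    have a1 : ∀ᶠ n in atTop, B * τ n < ε / 3 :=
      (by simpa using hτ.const_mul B : Tendsto (fun n => B * τ n) atTop (𝓝 0)).eventually_lt_const (by positivity)
    have a2 : ∀ᶠ n in atTop, C * τ n < ε / 3 :=
      (by simpa using hτ.const_mul C : Tendsto (fun n => C * τ n) atTop (𝓝 0)).eventually_lt_const (by positivity)
    exact (a1.and a2).exists
  have hl := half_pow_pos n
  have hl1 := half_pow_le_one n
  set l := (1 / 2 : ℝ) ^ n
  set R := (∫ w, ‖ρ w‖) * ∫ x in Metric.cthickening 1 K, ‖kern g ρ l x‖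
  have hR : 0 ≤ R := mul_nonneg (integral_nonneg fun _ => norm_nonneg _)
    (integral_nonneg fun _ => norm_nonneg _)
  filter_upwards [hlim (ε / (3 * (R + 1))) (by positivity)] with j hj
  have hd : ‖scalePair g ρ l (φ j) - scalePair g ρ l H‖ ≤ ε / (3 * (R + 1)) * R := by
    have e : scalePair g ρ l (φ j)
        = scalePair g ρ l H + scalePair g ρ l fun z => φ j z - H z := by
      rw [← scalePair_add g ρ hl hH hHc (H' := fun z => φ j z - H z)
        ((hφ j).continuous.sub hH) ((hφ j).compact.sub hHc)]
      congr 1; ext z; ring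
    rw [e, add_sub_cancel_left]
    refine (norm_scalePair_le g hs hK hl hl1 ?_ hj).trans_eq (mul_assoc _ _ _)
    exact (tsupport_sub _ _).trans (Set.union_subset (hφK j) hHK)
  have hd' : ε / (3 * (R + 1)) * R ≤ ε / 3 := by
    rw [div_mul_eq_mul_div, div_le_div_iff₀ (by positivity) (by positivity)]
    nlinarith
  rw [dist_eq_norm]
  have e : pair g (φ j) - L = -(scalePair g ρ l (φ j) - pair g (φ j))
      + (scalePair g ρ l (φ j) - scalePair g ρ l H) + (scalePair g ρ l H - L) := by ring
  rw [e]
  refine (norm_add₃_le).trans_lt ?_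
  rw [norm_neg]
  linarith [r1 j n, r2 n]

theorem AvgRate.mono {α B C : ℝ} {ρ : Test E} {H : E → ℂ} (h : AvgRate α ρ B H) (hBC : B ≤ C) :
    AvgRate α ρ C H := fun n x => (h n x).trans (by gcongr)

/-- The limit of the pairings of a distribution with smeared products. -/
theorem exists_distr_tendsto_smear {g g' : Distr E} {κ : E → ℂ} (hκ : IsTest κ) (χ : Test E)
    {V : Set E} (hV : IsOpen V) (hχV : tsupport χ ⊆ V)
    (hg : ∀ φ, IsTest φ → tsupport φ ⊆ V → pair g φ = pair g' fun z => κ z * φ z)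
    {F : E → ℂ} (hF : Continuous F) (hFc : HasCompactSupport F) {α A : ℝ} {n : ℕ} (hα : 0 < α)
    (hFA : ∀ x, ApproxAt α n A F x)
    (hsum : ∀ ρ : Test E, tsupport ρ ⊆ Metric.ball 0 1 → SummableKern α g' ρ) :
    ∃ T : Distr E, ∀ Θ : ℕ → Test (E × E), IsDeltaSeq Θ → ∀ ψ : Test E,
      Tendsto (fun j => pair g (smear (fun x => (χ x : ℂ) * ψ x) F (Θ j))) atTop (𝓝 (T ψ)) := by
  have hχ := IsTest.ofReal χ
  set m := ⌈α⌉₊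
  have hαm : α ≤ m + 1 := (Nat.le_ceil α).trans (le_add_of_nonneg_right zero_le_one)
  obtain ⟨Aκ, hAκ⟩ := hκ.exists_approxAt hαm
  obtain ⟨Aχ, hAχ⟩ := hχ.exists_approxAt hαm
  -- The degree is the sum of those for `κ`, `χ`, the test function and `F`, as approximating
  -- polynomials are multiplied without truncation.
  obtain ⟨ρ, hs, hρ⟩ := exists_kernel E (m + (m + m + n))
  have h1 := integral_kernel_eq_one hρ
  have hgs := hsum ρ hs
  have hK : IsCompact (tsupport κ) := hκ.compact.isCompact
  obtain ⟨τ, hτ, hrate⟩ := exists_rate hs hα hgs hK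
  set R := ∫ w, ‖ρ w‖
  have hR : 0 ≤ R := integral_nonneg fun _ => norm_nonneg _
  -- the functions to be integrated against the delta sequence
  let H : Test E → E × E → E → ℂ := fun ψ q z =>
    κ z * ((χ (z + q.2) : ℂ) * ψ (z + q.2) * F (z + q.2 - q.1))
  -- The constant from three uses of `ApproxAt.mul`, with the bound `S` on the derivatives of `ψ`
  -- factored out; linearity in `S` is what yields a distribution.
  let D : ℝ := 3 * Aκ * (3 * (3 * Aχ * (m + 1)) * A)
  have hHA : ∀ (ψ : Test E) (S : ℝ), (∀ k ≤ m + 1, ∀ x, ‖iteratedFDeriv ℝ k ψ x‖ ≤ S) →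
      ∀ q x, ApproxAt α (m + (m + m + n)) (D * S) (H ψ q) x := by
    intro ψ S hS q x
    have hψA : ∀ x, ApproxAt α m ((m + 1) * S) (fun y => (ψ y : ℂ)) x := by
      refine fun x => approxAt_of_contDiff (IsTest.ofReal ψ).smooth hαm (fun k hk y => ?_) x
      refine le_trans (le_of_eq ?_) (hS k hk y)
      exact Complex.ofRealLI.norm_iteratedFDeriv_comp_left ψ.contDiff.contDiffAt
        (mod_cast le_top)
    have h := (hAκ x).mul hα (((((hAχ _).comp_add_right (x := x) (c := q.2)).mul hα
      ((hψA _).comp_add_right (x := x) (c := q.2))).mul hα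
      ((hFA _).comp_add_right (x := x) (c := q.2 - q.1))))
    have e : H ψ q = fun y => κ y * (((χ (y + q.2) : ℂ) * (ψ (y + q.2) : ℂ)) *
        F (y + (q.2 - q.1))) := by
      ext y; simp only [H, add_sub_assoc]
    rw [e]
    refine h.mono (le_of_eq ?_)
    simp only [D]; ring
  have hHc : ∀ ψ, Continuous (Function.uncurry (H ψ)) := by
    intro ψ
    have a1 := hκ.continuous
    have a2 := hχ.continuous
    have a3 := (IsTest.ofReal ψ).continuous
    simp only [H, Function.uncurry_def]
    fun_prop
  have hHq : ∀ ψ q, Continuous (H ψ q) := fun ψ q =>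
    (hHc ψ).comp (continuous_const.prodMk continuous_id)
  have hHK : ∀ ψ q, tsupport (H ψ q) ⊆ tsupport κ := fun ψ q => tsupport_mul_subset_left
  have hHcs : ∀ ψ q, HasCompactSupport (H ψ q) := fun ψ q =>
    HasCompactSupport.of_support_subset_isCompact hK ((subset_tsupport _).trans (hHK ψ q))
  have hHB : ∀ (ψ : Test E) (S : ℝ), (∀ k ≤ m + 1, ∀ x, ‖iteratedFDeriv ℝ k ψ x‖ ≤ S) →
      ∀ q, AvgRate α ρ (D * S * R) (H ψ q) := fun ψ S hS q n x =>
    norm_avg_sub_le hs hρ hα (hHq ψ q) (hHA ψ S hS q x) (half_pow_pos n) (half_pow_le_one n)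
  have hSex : ∀ ψ : Test E, ∃ S : ℝ, ∀ k ≤ m + 1, ∀ x, ‖iteratedFDeriv ℝ k ψ x‖ ≤ S := by
    intro ψ
    obtain ⟨S, hS⟩ := (IsTest.ofReal ψ).exists_bound_iteratedFDeriv (m + 1)
    refine ⟨S, fun k hk x => le_trans (le_of_eq ?_) (hS k hk x)⟩
    exact (Complex.ofRealLI.norm_iteratedFDeriv_comp_left ψ.contDiff.contDiffAt
      (mod_cast le_top)).symm
  -- The limit is chosen once, but its bound is stated for every admissible `S`, so that it can
  -- serve as a finite-order estimate.
  have hLex : ∀ ψ : Test E, ∃ L : ℂ,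
      Tendsto (fun n : ℕ => scalePair g' ρ ((1 / 2 : ℝ) ^ n) (H ψ 0)) atTop (𝓝 L) ∧
      ∀ S : ℝ, (∀ k ≤ m + 1, ∀ x, ‖iteratedFDeriv ℝ k ψ x‖ ≤ S) →
        ‖scalePair g' ρ ((1 / 2 : ℝ) ^ 0) (H ψ 0) - L‖ ≤ D * S * R * τ 0 := by
    intro ψ
    obtain ⟨S, hS⟩ := hSex ψ
    obtain ⟨L, hL, -⟩ := hrate _ _ (hHq ψ 0) (hHK ψ 0) (hHB ψ S hS 0)
    refine ⟨L, hL, fun S' hS' => ?_⟩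
    obtain ⟨L', hL', hb⟩ := hrate _ _ (hHq ψ 0) (hHK ψ 0) (hHB ψ S' hS' 0)
    rw [tendsto_nhds_unique hL hL']
    exact hb 0
  choose L hL hLb using hLex
  set I0 := ∫ x in Metric.cthickening 1 (tsupport κ), ‖kern g' ρ ((1 / 2 : ℝ) ^ 0) x‖
  have hI0 : 0 ≤ I0 := integral_nonneg fun _ => norm_nonneg _
  have hD0 : 0 ≤ D := by
    have a1 := (hAκ 0).nonneg
    have a2 := (hAχ 0).nonneg
    have a3 := (hFA 0).nonneg
    positivity
  let T : Distr E := mkDistr L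
    (fun φ ψ => by
      refine tendsto_nhds_unique (hL (φ + ψ)) (((hL φ).add (hL ψ)).congr fun n => ?_)
      rw [← scalePair_add g' ρ (half_pow_pos n) (hHq φ 0) (hHcs φ 0) (hHq ψ 0) (hHcs ψ 0)]
      congr 1; ext z
      simp only [H, FunLike.coe_add, Pi.add_apply, Complex.ofReal_add]
      ring)
    (fun c φ => by
      refine tendsto_nhds_unique (hL (c • φ)) (((hL φ).const_smul c).congr fun n => ?_)
      rw [Complex.real_smul, ← scalePair_const_mul]
      congr 1; ext z
      simp only [H, FunLike.coe_smul, Pi.smul_apply, smul_eq_mul, Complex.ofReal_mul]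
      ring)
    -- The pairing at scale one is bounded by the supremum of `H ψ 0`, and the distance to the limit
    -- by the rate from scale one on; both are multiples of `S`.
    (fun _ _ => by
      refine ⟨m + 1, |D * R * I0 + D * R * τ 0|, abs_nonneg _, fun φ _ S hS => ?_⟩
      have hS0 : 0 ≤ S := (norm_nonneg _).trans (hS 0 (by simp) 0)
      have b1 := norm_scalePair_le g' hs hK (half_pow_pos 0) (half_pow_le_one 0) (hHK φ 0)
        (fun x => (hHA φ S hS 0 x).norm_le hα)
      have b2 := hLb φ S hS
      have b3 : ‖L φ‖ ≤ D * S * R * I0 + D * S * R * τ 0 := by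
        rw [norm_sub_rev] at b2
        calc ‖L φ‖ = ‖scalePair g' ρ ((1 / 2 : ℝ) ^ 0) (H φ 0)
              + (L φ - scalePair g' ρ ((1 / 2 : ℝ) ^ 0) (H φ 0))‖ := by congr 1; ring
          _ ≤ _ := (norm_add_le _ _).trans (add_le_add b1 b2)
      calc ‖L φ‖ ≤ (D * R * I0 + D * R * τ 0) * S := b3.trans_eq (by ring)
        _ ≤ _ := mul_le_mul_of_nonneg_right (le_abs_self _) hS0)
  refine ⟨T, fun Θ hΘ ψ => ?_⟩
  have hη : IsTest fun x => (χ x : ℂ) * (ψ x : ℂ) := hχ.mul_right (IsTest.ofReal ψ).smooth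
  obtain ⟨S, hS⟩ := hSex ψ
  obtain ⟨CΘ, hCΘ⟩ := hΘ.bounded
  have hsm : ∀ j, IsTest (smear (fun x => (χ x : ℂ) * ψ x) F (Θ j)) := fun j =>
    isTest_smear hη hF (Θ j)
  have hφeq : ∀ j, (fun z => κ z * smear (fun x => (χ x : ℂ) * ψ x) F (Θ j) z)
      = fun z => ∫ q, H ψ q z * (Θ j q : ℂ) := by
    intro j; ext z
    rw [smear_eq hη hF, ← integral_const_mul]
    congr 1; ext q
    simp only [H]; ring
  have key := tendsto_pair_of_avgRate (g := g') hs h1 hα hgs hK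
    (φ := fun j z => κ z * smear (fun x => (χ x : ℂ) * ψ x) F (Θ j) z)
    (B := D * S * R * CΘ)
    (fun j => (hsm j).mul_left hκ.smooth) (fun j => tsupport_mul_subset_left) (fun j => ?_)
    (hHq ψ 0) (hHK ψ 0) (hHB ψ S hS 0) (fun ε hε => ?_) (hL ψ)
  · refine key.congr' ?_
    -- Smearing moves supports by at most the size of the support of `Θ j`, so eventually the
    -- smeared product lives in `V`, where `g` may be replaced by `κ g'`.
    obtain ⟨δ, hδ, hδV⟩ := hχ.compact.isCompact.exists_cthickening_subset_open hV
      ((tsupport_comp_subset (g := Complex.ofReal) rfl χ).trans hχV)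
    filter_upwards [hΘ.shrinking δ hδ] with j hj
    refine (hg _ (hsm j) ((tsupport_smear_subset hη hF hj).trans ?_)).symm
    exact (Metric.cthickening_subset_of_subset δ tsupport_mul_subset_left).trans hδV
  · simp only [hφeq]
    refine (AvgRate.integral (hHc ψ) (hHB ψ S hS) (Θ j)).mono ?_
    have hS0 : 0 ≤ S := (norm_nonneg _).trans (hS 0 (by simp) 0)
    exact mul_le_mul_of_nonneg_left (hCΘ j) (by positivity)
  -- Here `κ` confines `z`, `χ` confines `z + b` and `F` confines `z + b - a`. Joint compact support
  -- gives uniform continuity in `(q, z)`, hence convergence uniform in `z`.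
  · have hjc : HasCompactSupport (Function.uncurry (H ψ)) := by
      refine HasCompactSupport.intro (((hK.prod hχ.compact.isCompact).prod
        hFc.isCompact).image (f := fun r : (E × E) × E => ((r.1.2 - r.2, r.1.2 - r.1.1), r.1.1))
          (by fun_prop)) ?_
      rintro ⟨⟨a, b⟩, z⟩ hne
      by_contra hne'
      apply hne
      have a1 : κ z ≠ 0 := fun h => hne' (by simp [H, h])
      have a2 : (χ (z + b) : ℂ) ≠ 0 := fun h => hne' (by
        simp only [Function.uncurry_apply_pair, H, h, zero_mul, mul_zero])
      have a3 : F (z + b - a) ≠ 0 := fun h => hne' (by simp [H, h])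
      exact ⟨((z, z + b), z + b - a), ⟨⟨subset_tsupport _ a1,
        subset_tsupport (fun x => (χ x : ℂ)) a2⟩, subset_tsupport _ a3⟩, by simp⟩
    have huc := hjc.uniformContinuous_of_continuous (hHc ψ)
    have hC0 : 0 ≤ CΘ := (integral_nonneg fun _ => norm_nonneg _).trans (hCΘ 0)
    obtain ⟨δ, hδ, hu⟩ := Metric.uniformContinuous_iff.1 huc (ε / (CΘ + 1)) (by positivity)
    filter_upwards [hΘ.shrinking δ hδ] with j hj z
    have e := congrFun (hφeq j) z
    rw [e]
    refine (norm_integral_mul_sub_le (hΘ.integral_eq_one j) (c := H ψ 0 z) (ε := ε / (CΘ + 1))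
      ((hHc ψ).comp (continuous_id.prodMk continuous_const)) fun q hq => ?_).trans ?_
    · have hq' : dist q 0 < δ := hj hq
      have := (hu (a := (q, z)) (b := (0, z)) (by simpa [Prod.dist_eq] using hq')).le
      rwa [dist_eq_norm] at this
    · calc _ ≤ ε / (CΘ + 1) * CΘ := by gcongr; exact hCΘ j
        _ ≤ ε := by
          rw [div_mul_eq_mul_div, div_le_iff₀ (by positivity)]
          nlinarith

end Core

/-! ### Regularized products on the diagonal -/

section Diagonal

variable {E : Type} [NormedAddCommGroup E] [NormedSpace ℝ E] [FiniteDimensional ℝ E]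
  [ProperSpace E] [SecondCountableTopology E]
  [MeasureSpace E] [BorelSpace E] [(volume : Measure E).IsAddHaarMeasure]

theorem integral_mul_integral_pair (g : Distr E) {η F : E → ℂ} (hη : IsTest η)
    (hF : Continuous F) (Θ : Test (E × E)) :
    ∫ x, η x * ∫ y, F y * pair g (fun z => (Θ (x - y, x - z) : ℂ)) = pair g (smear η F Θ) := by
  have ht := isTest_smear_kernel hη Θ
  have hF' : Continuous fun q : E × E => F q.2 := hF.comp continuous_snd
  have key := integral_mul_pair_slice (P := E × E) g hF' ht
  refine Eq.trans ?_ key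
  refine Eq.trans ?_ (integral_prod _ (integrable_mul_of_isTest hF' (ht.pair_slice g))).symm
  congr 1; ext x
  rw [← integral_const_mul]
  congr 1; ext y
  have h1 : IsTest fun z => (Θ (x - y, x - z) : ℂ) :=
    (IsTest.ofReal (reflect Θ (x, x))).slice y
  dsimp only
  rw [pair_const_mul g h1]
  ring

theorem tsupport_pair_reflect_subset (g : Distr E) {Θ : Test (E × E)} {ε : ℝ}
    (hΘ : tsupport Θ ⊆ Metric.ball 0 ε) (x : E) :
    tsupport (fun y => pair g fun z => (Θ (x - y, x - z) : ℂ)) ⊆ Metric.cthickening ε {x} := by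
  refine closure_minimal (fun y hy => ?_) Metric.isClosed_cthickening
  by_contra hy'
  apply hy
  have : ∀ z, Θ (x - y, x - z) = 0 := by
    intro z
    by_contra h
    refine hy' (Metric.mem_cthickening_of_dist_le y x _ _ rfl ?_)
    have h1 : ‖(x - y, x - z)‖ < ε := by simpa using hΘ (subset_tsupport _ h)
    rw [dist_comm, dist_eq_norm]
    exact (norm_fst_le (x - y, x - z)).trans h1.le
  simp [this, pair_zero]

theorem tsupport_reflect_subset {Θ : Test (E × E)} {ε : ℝ}
    (hΘ : tsupport Θ ⊆ Metric.ball 0 ε) (x y : E) :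
    tsupport (fun z => (Θ (x - y, x - z) : ℂ)) ⊆ Metric.cthickening ε {x} := by
  refine closure_minimal (fun z hz => ?_) Metric.isClosed_cthickening
  refine Metric.mem_cthickening_of_dist_le z x _ _ rfl ?_
  have h0 : Θ (x - y, x - z) ≠ 0 := fun h => hz (by simp [h])
  have h1 : ‖(x - y, x - z)‖ < ε := by simpa using hΘ (subset_tsupport _ h0)
  rw [dist_comm, dist_eq_norm]
  exact (norm_snd_le (x - y, x - z)).trans h1.le

theorem regularize_tensor (f g : Distr E) (Θ : Test (E × E)) (x : E) :
    regularize (tensor f g) Θ (x, x)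
      = pair f fun y => pair g fun z => (Θ (x - y, x - z) : ℂ) := rfl

/-- `f` is given by the function `F` on `U`. -/
def EqFunOn (f : Distr E) (F : E → ℂ) (U : Set E) : Prop :=
  ∀ φ, IsTest φ → tsupport φ ⊆ U → pair f φ = ∫ y, F y * φ y

/-- For `x` in the support of `η` the slice `Θ(x - ·, x - z)` is supported within `ε` of `x`, hence
in `U`, where `f` may be replaced by `F`. The Fubini theorem then moves both integrals inside `g`.
-/
theorem integral_mul_regularize_left {f : Distr E} (g : Distr E) {η F : E → ℂ} (hη : IsTest η)
    (hF : Continuous F) {U : Set E} (hf : EqFunOn f F U) {ε : ℝ}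
    (hU : Metric.cthickening ε (tsupport η) ⊆ U) {Θ : Test (E × E)}
    (hΘ : tsupport Θ ⊆ Metric.ball 0 ε) :
    ∫ x, η x * regularize (tensor f g) Θ (x, x) = pair g (smear η F Θ) := by
  rw [← integral_mul_integral_pair g hη hF]
  congr 1; ext x
  by_cases hx : x ∈ tsupport η
  · have ht : IsTest fun y => pair g fun z => (Θ (x - y, x - z) : ℂ) :=
      (IsTest.ofReal (reflect Θ (x, x))).pair_slice g
    rw [regularize_tensor, hf _ ht]
    refine (tsupport_pair_reflect_subset g hΘ x).trans (Set.Subset.trans ?_ hU)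
    exact Metric.cthickening_subset_of_subset _ (Set.singleton_subset_iff.2 hx)
  · rw [image_eq_zero_of_notMem_tsupport hx, zero_mul, zero_mul]

/-- The test function with exchanged arguments. -/
def swapTest (Θ : Test (E × E)) : Test (E × E) where
  toFun q := Θ (q.2, q.1)
  contDiff' := Θ.contDiff.comp (contDiff_snd.prodMk contDiff_fst)
  hasCompactSupport' := Θ.hasCompactSupport.comp_homeomorph (Homeomorph.prodComm E E)
  tsupport_subset' := fun _ _ => trivial

theorem IsDeltaSeq.swap {Θ : ℕ → Test (E × E)} (h : IsDeltaSeq Θ) :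
    IsDeltaSeq fun n => swapTest (Θ n) := by
  have hi : ∀ G : E × E → ℝ, ∫ q : E × E, G (q.2, q.1) = ∫ q, G q := fun G =>
    integral_prod_swap (μ := volume) (ν := volume) G
  refine ⟨fun n => (hi _).trans (h.integral_eq_one n), ?_, fun ε hε => ?_⟩
  · obtain ⟨C, hC⟩ := h.bounded
    exact ⟨C, fun n => (hi fun q => ‖Θ n q‖).trans_le (hC n)⟩
  · filter_upwards [h.shrinking ε hε] with n hn
    have : tsupport (swapTest (Θ n)) = Homeomorph.prodComm E E ⁻¹' tsupport (Θ n) :=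
      tsupport_comp_eq_preimage (Θ n) (Homeomorph.prodComm E E)
    rw [this]
    intro q hq
    have := hn hq
    simp only [mem_ball_zero_iff, Homeomorph.coe_prodComm, Prod.norm_def, Prod.fst_swap,
      Prod.snd_swap] at this ⊢
    rwa [max_comm]

/-- `tensor` applies `g` before `f`. When `g` is the function, the order is reversed by the Fubini
theorem for `f`, at the price of exchanging the arguments of `Θ`. -/
theorem integral_mul_regularize_right (f : Distr E) {g : Distr E} {η G : E → ℂ} (hη : IsTest η)
    (hG : Continuous G) {U : Set E} (hg : EqFunOn g G U) {ε : ℝ}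
    (hU : Metric.cthickening ε (tsupport η) ⊆ U) {Θ : Test (E × E)}
    (hΘ : tsupport Θ ⊆ Metric.ball 0 ε) :
    ∫ x, η x * regularize (tensor f g) Θ (x, x) = pair f (smear η G (swapTest Θ)) := by
  rw [← integral_mul_integral_pair f hη hG]
  congr 1; ext x
  by_cases hx : x ∈ tsupport η
  · have ht := IsTest.ofReal (reflect Θ (x, x))
    have e : (fun y => pair g fun z => (Θ (x - y, x - z) : ℂ))
        = fun y => ∫ z, G z * (Θ (x - y, x - z) : ℂ) := by
      ext y
      refine hg _ (ht.slice y) ((tsupport_reflect_subset hΘ x y).trans (Set.Subset.trans ?_ hU))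
      exact Metric.cthickening_subset_of_subset _ (Set.singleton_subset_iff.2 hx)
    rw [regularize_tensor, e]
    congr 1
    exact (integral_mul_pair_slice f hG ht.comp_swap).symm
  · rw [image_eq_zero_of_notMem_tsupport hx, zero_mul, zero_mul]

/-- For smooth `F` the pairing is the `Θ`-average of a continuous function of the translations,
which is evaluated at `0` in the limit. -/
theorem tendsto_pair_smear (g : Distr E) {η F : E → ℂ} (hη : IsTest η) (hF : IsTest F)
    {Θ : ℕ → Test (E × E)} (hΘ : IsDeltaSeq Θ) :
    Tendsto (fun n => pair g (smear η F (Θ n))) atTop (𝓝 (pair g fun z => η z * F z)) := by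
  -- The translated products are not compactly supported in the translation variable; `ζ` repairs
  -- this and is `1` on the support of `Θ n` eventually.
  obtain ⟨ζ, -, hζ⟩ := exists_cutoff (isCompact_singleton (x := (0 : E × E))) isOpen_univ
    (Set.subset_univ _)
  rw [nhdsSet_singleton] at hζ
  have ht : IsTest fun r : (E × E) × E =>
      (ζ r.1 : ℂ) * (η (r.2 + r.1.2) * F (r.2 + r.1.2 - r.1.1)) := by
    refine ⟨((IsTest.ofReal ζ).smooth.comp contDiff_fst).mul
      ((hη.smooth.comp (by fun_prop)).mul (hF.smooth.comp (by fun_prop))), ?_⟩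
    refine HasCompactSupport.intro ((ζ.hasCompactSupport.isCompact.prod
      hη.compact.isCompact).image
        (f := fun q : (E × E) × E => (q.1, q.2 - q.1.2)) (by fun_prop)) ?_
    rintro ⟨q, z⟩ hqz
    by_contra hne
    apply hqz
    have h1 : ζ q ≠ 0 := fun h => hne (by simp [h])
    have h2 : η (z + q.2) ≠ 0 := fun h => hne (by simp [h])
    exact ⟨(q, z + q.2), ⟨subset_tsupport _ h1, subset_tsupport _ h2⟩, by simp⟩
  set G : E × E → ℂ := fun q => pair g fun z =>
    (ζ q : ℂ) * (η (z + q.2) * F (z + q.2 - q.1)) with hG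
  have hGc : Continuous G := (ht.pair_slice g).continuous
  have hG0 : G 0 = pair g fun z => η z * F z := by
    simp [hG, hζ.self_of_nhds]
  obtain ⟨C, hC⟩ := hΘ.bounded
  have hC0 : 0 ≤ C := (integral_nonneg fun _ => norm_nonneg _).trans (hC 0)
  obtain ⟨δ₀, hδ₀, hζδ⟩ := Metric.eventually_nhds_iff_ball.1 hζ
  rw [← hG0, Metric.tendsto_nhds]
  intro ε hε
  obtain ⟨δ, hδ, hGδ⟩ := Metric.continuousAt_iff.1 (hGc.continuousAt (x := 0))
    (ε / (C + 1)) (by positivity)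
  filter_upwards [hΘ.shrinking δ₀ hδ₀, hΘ.shrinking δ hδ] with n hn hn'
  have e : pair g (smear η F (Θ n)) = ∫ q, G q * (Θ n q : ℂ) := by
    have := integral_mul_pair_slice g (IsTest.ofReal (Θ n)).continuous ht
    simp only [mul_comm _ ((Θ n _ : ℝ) : ℂ)]
    refine Eq.trans ?_ this.symm
    congr 1; ext z
    rw [smear_eq hη hF.continuous]
    congr 1; ext q
    by_cases hq : q ∈ tsupport (Θ n)
    · simp only [hζδ q (hn hq), Complex.ofReal_one]; ring
    · simp [image_eq_zero_of_notMem_tsupport hq]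
  rw [e, dist_eq_norm]
  refine (norm_integral_mul_sub_le (hΘ.integral_eq_one n) hGc fun q hq => ?_).trans_lt
    (b := ε / (C + 1) * ∫ q, ‖Θ n q‖) ?_
  · rw [← dist_eq_norm]
    exact (hGδ (hn' hq)).le
  · calc _ ≤ ε / (C + 1) * C := by gcongr; exact hC n
      _ < ε := by
        rw [div_mul_eq_mul_div, div_lt_iff₀ (by positivity)]
        nlinarith

theorem pair_localize (φ : CTest E) (f : Distr E) {η : E → ℂ} (h : IsTest η) :
    pair (localize φ f) η = pair f fun x => φ x * η x := by
  have hφ := IsTest.of_ctest φ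
  have key : ∀ ψ : Test E, localize φ f ψ = pair f fun x => φ x * ψ x := by
    intro ψ
    rw [pair_def f (hφ.mul_right (IsTest.ofReal ψ).smooth)]
    have h1 : reTest _ (hφ.mul_right (IsTest.ofReal ψ).smooth) = mulCLM _ (contDiff_re φ) ψ := by
      ext x
      change (φ x * (ψ x : ℂ)).re = ψ x * (φ x).re
      simp [mul_comm]
    have h2 : imTest _ (hφ.mul_right (IsTest.ofReal ψ).smooth) = mulCLM _ (contDiff_im φ) ψ := by
      ext x
      change (φ x * (ψ x : ℂ)).im = ψ x * (φ x).im
      simp [mul_comm]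
    rw [h1, h2]; rfl
  rw [pair_def _ h, key, key, ← pair_const_mul f
    (hφ.mul_right (IsTest.ofReal (imTest η h)).smooth),
    ← pair_add f (hφ.mul_right (IsTest.ofReal (reTest η h)).smooth)
      ((hφ.mul_right (IsTest.ofReal (imTest η h)).smooth).const_mul _)]
  congr 1; ext x
  simp only [reTest_apply, imTest_apply]
  conv_rhs => rw [← Complex.re_add_im (η x)]
  ring

/-- The product of `f` and `g` exists after multiplication by the cutoff `χ`. -/
def HasLocalProduct (f g : Distr E) (χ : Test E) : Prop :=
  ∃ T : Distr E, ∀ Θ : ℕ → Test (E × E), IsDeltaSeq Θ → ∀ ψ : Test E,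
    Tendsto (fun n => ∫ x, (χ x : ℂ) * ψ x * regularize (tensor f g) (Θ n) (x, x)) atTop
      (𝓝 (T ψ))

theorem exists_cthickening_subset {χ : Test E} {U : Set E} (hU : IsOpen U)
    (hχU : tsupport χ ⊆ U) : ∃ ε : ℝ, 0 < ε ∧ ∀ ψ : Test E,
      Metric.cthickening ε (tsupport fun x => (χ x : ℂ) * ψ x) ⊆ U := by
  obtain ⟨ε, hε, h⟩ := χ.hasCompactSupport.isCompact.exists_cthickening_subset_open hU hχU
  refine ⟨ε, hε, fun ψ => (Metric.cthickening_subset_of_subset _ ?_).trans h⟩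
  exact tsupport_mul_subset_left.trans (tsupport_comp_subset (g := Complex.ofReal) rfl χ)

theorem IsTest.cutoff_mul (χ ψ : Test E) : IsTest fun x => (χ x : ℂ) * (ψ x : ℂ) :=
  (IsTest.ofReal χ).mul_right (IsTest.ofReal ψ).smooth

/-- Pairing with the product of a test function and a fixed factor is a distribution. -/
theorem exists_distr_pair_mul (g : Distr E) {φ : E → ℂ} (h : IsTest φ) :
    ∃ T : Distr E, ∀ ψ : Test E, T ψ = pair g fun z => φ z * ψ z :=
  ⟨localize ⟨φ, h.smooth, h.compact, fun _ _ => trivial⟩ g, fun ψ => by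
    rw [← pair_ofReal, pair_localize _ _ (IsTest.ofReal ψ)]; rfl⟩

theorem hasLocalProduct_of_smooth_left {f : Distr E} (g : Distr E) {F : E → ℂ} (hF : IsTest F)
    {U : Set E} (hU : IsOpen U) (hf : EqFunOn f F U) {χ : Test E} (hχU : tsupport χ ⊆ U) :
    HasLocalProduct f g χ := by
  obtain ⟨ε, hε, hεU⟩ := exists_cthickening_subset hU hχU
  obtain ⟨T, hT⟩ := exists_distr_pair_mul g ((IsTest.ofReal χ).mul_right hF.smooth)
  refine ⟨T, fun Θ hΘ ψ => ?_⟩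
  have e : T ψ = pair g fun z => (χ z : ℂ) * ψ z * F z := by
    rw [hT]; congr 1; ext z; ring
  rw [e]
  refine (tendsto_pair_smear g (IsTest.cutoff_mul χ ψ) hF hΘ).congr' ?_
  filter_upwards [hΘ.shrinking ε hε] with n hn
  exact (integral_mul_regularize_left g (IsTest.cutoff_mul χ ψ) hF.continuous hf (hεU ψ) hn).symm

theorem hasLocalProduct_of_smooth_right (f : Distr E) {g : Distr E} {G : E → ℂ} (hG : IsTest G)
    {U : Set E} (hU : IsOpen U) (hg : EqFunOn g G U) {χ : Test E} (hχU : tsupport χ ⊆ U) :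
    HasLocalProduct f g χ := by
  obtain ⟨ε, hε, hεU⟩ := exists_cthickening_subset hU hχU
  obtain ⟨T, hT⟩ := exists_distr_pair_mul f ((IsTest.ofReal χ).mul_right hG.smooth)
  refine ⟨T, fun Θ hΘ ψ => ?_⟩
  have e : T ψ = pair f fun z => (χ z : ℂ) * ψ z * G z := by
    rw [hT]; congr 1; ext z; ring
  rw [e]
  refine (tendsto_pair_smear f (IsTest.cutoff_mul χ ψ) hG hΘ.swap).congr' ?_
  filter_upwards [hΘ.shrinking ε hε] with n hn
  exact (integral_mul_regularize_right f (IsTest.cutoff_mul χ ψ) hG.continuous hg (hεU ψ) hn).symm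

theorem hasLocalProduct_of_approxAt {f g g' : Distr E} {F κ : E → ℂ} (hF : Continuous F)
    (hFc : HasCompactSupport F) {α A : ℝ} {n : ℕ} (hα : 0 < α)
    (hFA : ∀ x, ApproxAt α n A F x) (hκ : IsTest κ)
    (hsum : ∀ ρ : Test E, tsupport ρ ⊆ Metric.ball 0 1 → SummableKern α g' ρ)
    {U : Set E} (hU : IsOpen U) (hf : EqFunOn f F U)
    (hg : ∀ φ, IsTest φ → tsupport φ ⊆ U → pair g φ = pair g' fun z => κ z * φ z)
    {χ : Test E} (hχU : tsupport χ ⊆ U) : HasLocalProduct f g χ := by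
  obtain ⟨ε, hε, hεU⟩ := exists_cthickening_subset hU hχU
  obtain ⟨T, hT⟩ := exists_distr_tendsto_smear hκ χ hU hχU hg hF hFc hα hFA hsum
  refine ⟨T, fun Θ hΘ ψ => (hT Θ hΘ ψ).congr' ?_⟩
  filter_upwards [hΘ.shrinking ε hε] with n hn
  exact (integral_mul_regularize_left g (IsTest.cutoff_mul χ ψ) hF hf (hεU ψ) hn).symm

end Diagonal

/-! ### From the hypotheses at a point to local representatives -/

section LocalData

variable {d : ℕ}

theorem contDiff_of_tsupport_subset {E : Type} [NormedAddCommGroup E] [NormedSpace ℝ E]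
    {F : E → ℂ} {U : Set E} (hU : IsOpen U) (hF : ContDiffOn ℝ ∞ F U) (hs : tsupport F ⊆ U) :
    ContDiff ℝ ∞ F := by
  refine contDiff_iff_contDiffAt.2 fun x => ?_
  by_cases hx : x ∈ tsupport F
  · exact hF.contDiffAt (hU.mem_nhds (hs hx))
  · exact contDiffAt_const.congr_of_eventuallyEq (notMem_tsupport_iff_eventuallyEq.1 hx)

/-- A cutoff supported in the open set where `φ ≠ 0` makes `1 / φ` a global test function; it undoes
the localization by `φ` near `x`. -/
theorem exists_inv_cutoff (φ : CTest (Rd d)) {x : Rd d} (hx : φ x ≠ 0) :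
    ∃ κ : Rd d → ℂ, IsTest κ ∧ ∀ᶠ y in 𝓝 x, κ y * φ y = 1 := by
  have hU : IsOpen {y | φ y ≠ 0} := isOpen_ne_fun φ.continuous continuous_const
  obtain ⟨ζ, hζU, hζ⟩ := exists_cutoff (isCompact_singleton (x := x)) hU
    (Set.singleton_subset_iff.2 hx)
  rw [nhdsSet_singleton] at hζ
  have hζ' := IsTest.ofReal ζ
  have hts : tsupport (fun y => (ζ y : ℂ) * (φ y)⁻¹) ⊆ {y | φ y ≠ 0} :=
    tsupport_mul_subset_left.trans
      ((tsupport_comp_subset (g := Complex.ofReal) rfl ζ).trans hζU)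
  refine ⟨fun y => (ζ y : ℂ) * (φ y)⁻¹, ⟨contDiff_of_tsupport_subset hU ?_ hts,
    hζ'.compact.mul_right⟩, ?_⟩
  · exact hζ'.smooth.contDiffOn.mul (φ.contDiff.contDiffOn.inv fun y hy => hy)
  · filter_upwards [hζ, hU.mem_nhds hx] with y hy hy'
    rw [hy, Complex.ofReal_one, one_mul, inv_mul_cancel₀ hy']

theorem exists_eqFunOn_of_notMem_singSupp {f : Distr (Rd d)} {x : Rd d} (hx : x ∉ singSupp f) :
    ∃ F : Rd d → ℂ, IsTest F ∧ ∃ U ∈ 𝓝 x, IsOpen U ∧ EqFunOn f F U := by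
  simp only [singSupp, Set.mem_ofPred_eq, not_not] at hx
  obtain ⟨U, hU, hxU, F, hF, hf⟩ := hx
  obtain ⟨ζ, hζU, hζ⟩ := exists_cutoff (isCompact_singleton (x := x)) hU
    (Set.singleton_subset_iff.2 hxU)
  rw [nhdsSet_singleton] at hζ
  have hζ' := IsTest.ofReal ζ
  obtain ⟨V, hV, hVo, hxV⟩ := eventually_nhds_iff.1 hζ
  have hts : tsupport (fun y => (ζ y : ℂ) * F y) ⊆ U :=
    tsupport_mul_subset_left.trans
      ((tsupport_comp_subset (g := Complex.ofReal) rfl ζ).trans hζU)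
  have hT : IsTest fun y => (ζ y : ℂ) * F y :=
    ⟨contDiff_of_tsupport_subset hU (hζ'.smooth.contDiffOn.mul hF) hts, hζ'.compact.mul_right⟩
  have hVU : V ⊆ U := fun y hy => hζU (subset_tsupport _ (by simp [hV y hy]))
  refine ⟨_, hT, V, hVo.mem_nhds hxV, hVo, fun φ hφ hφV => ?_⟩
  refine pair_eq_integral_of_forall hT.continuous hφ fun ψ hψ => ?_
  rw [hf ψ ((hψ.trans hφV).trans hVU)]
  congr 1; ext y
  by_cases hy : y ∈ tsupport ψ
  · rw [hV y (hφV (hψ hy)), Complex.ofReal_one, one_mul]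
  · rw [image_eq_zero_of_notMem_tsupport hy]; simp

/-- Undoing a localization near a point. -/
theorem exists_pair_eq_pair_localize (f : Distr (Rd d)) (φ : CTest (Rd d)) {x : Rd d}
    (hx : φ x ≠ 0) : ∃ κ : Rd d → ℂ, IsTest κ ∧ ∃ U ∈ 𝓝 x, IsOpen U ∧
      ∀ η, IsTest η → tsupport η ⊆ U → pair f η = pair (localize φ f) fun z => κ z * η z := by
  obtain ⟨κ, hκ, h⟩ := exists_inv_cutoff φ hx
  obtain ⟨V, hV, hVo, hxV⟩ := eventually_nhds_iff.1 h
  refine ⟨κ, hκ, V, hVo.mem_nhds hxV, hVo, fun η hη hηV => ?_⟩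
  rw [pair_localize _ _ (hη.mul_left hκ.smooth)]
  congr 1; ext y
  by_cases hy : y ∈ tsupport η
  · rw [← mul_assoc, mul_comm (φ y), hV y (hηV hy), one_mul]
  · rw [image_eq_zero_of_notMem_tsupport hy]; simp

theorem exists_approxAt_of_taylor {α : ℝ} (hα : 0 < α) {F : Rd d → ℂ}
    (hF : ContDiff ℝ ((⌈α⌉₊ - 1 : ℕ) : WithTop ℕ∞) F)
    (hT : ∀ K : Set (Rd d), IsCompact K → ∃ C : ℝ, ∀ x ∈ K, ∀ y ∈ K,
      ‖F y - ∑ j ∈ Finset.range ⌈α⌉₊,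
        ((j.factorial : ℝ)⁻¹) • iteratedFDeriv ℝ j F x (fun _ => y - x)‖ ≤ C * ‖x - y‖ ^ α)
    {K : Set (Rd d)} (hK : IsCompact K) : ∃ A, ∀ x ∈ K, ApproxAt α (⌈α⌉₊ - 1) A F x := by
  -- The Taylor sum over `range ⌈α⌉₊` has degree `⌈α⌉₊ - 1`; the truncated subtraction is harmless
  -- since `α > 0`.
  have hn : ⌈α⌉₊ - 1 + 1 = ⌈α⌉₊ := Nat.sub_add_cancel (Nat.ceil_pos.2 hα)
  -- `ApproxAt` concerns all points within distance one of `x ∈ K`, so the Taylor estimate is taken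
  -- on a thickening of `K`.
  obtain ⟨C, hC⟩ := hT _ (hK.cthickening (r := 1))
  have hcont : Continuous fun x => ∑ j ∈ Finset.range ⌈α⌉₊, ‖iteratedFDeriv ℝ j F x‖ := by
    refine continuous_finsetSum _ fun j hj => (hF.continuous_iteratedFDeriv ?_).norm
    rw [Finset.mem_range] at hj
    exact_mod_cast (by omega : j ≤ ⌈α⌉₊ - 1)
  obtain ⟨S, hS⟩ := hK.exists_bound_of_continuousOn hcont.continuousOn
  refine ⟨S + |C|, fun x hx => ⟨_, isRayPoly_sum (⌈α⌉₊ - 1) (fun j => (j.factorial : ℝ)⁻¹)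
    fun j => iteratedFDeriv ℝ j F x, fun w hw => ?_, fun w hw => ?_⟩⟩
  · rw [hn]
    refine le_trans ((norm_sum_le _ _).trans (Finset.sum_le_sum fun j _ => ?_))
      (((le_abs_self _).trans (hS x hx)).trans (le_add_of_nonneg_right (abs_nonneg C)))
    rw [norm_smul, norm_inv, Real.norm_natCast]
    refine (mul_le_of_le_one_left (norm_nonneg _) (inv_le_one_of_one_le₀
      (mod_cast Nat.one_le_iff_ne_zero.2 (Nat.factorial_ne_zero j)))).trans ?_
    refine ((iteratedFDeriv ℝ j F x).le_opNorm _).trans (mul_le_of_le_one_right (norm_nonneg _) ?_)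
    simpa using pow_le_one₀ (norm_nonneg w) hw
  · rw [hn]
    have hS0 : 0 ≤ S := (norm_nonneg _).trans (hS x hx)
    have h1 := hC x (Metric.self_subset_cthickening K hx) (x + w)
      (Metric.mem_cthickening_of_dist_le _ x _ _ hx (by simpa using hw))
    simp only [add_sub_cancel_left, sub_add_cancel_left, norm_neg] at h1
    refine h1.trans (mul_le_mul_of_nonneg_right ?_ (by positivity))
    linarith [le_abs_self C]

/-- A distribution which is Hölder continuous after localization agrees near the point with a
compactly supported Hölder function. -/
theorem exists_eqFunOn_of_memHolderPosLoc {f : Distr (Rd d)} {φ : CTest (Rd d)} {x : Rd d}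
    (hx : φ x ≠ 0) {α : ℝ} (hα : 0 < α) (h : MemHolderPosLoc α (localize φ f)) :
    ∃ F : Rd d → ℂ, Continuous F ∧ HasCompactSupport F ∧
      (∃ (n : ℕ) (A : ℝ), ∀ y, ApproxAt α n A F y) ∧ ∃ U ∈ 𝓝 x, IsOpen U ∧ EqFunOn f F U := by
  obtain ⟨F, hF, hT, hf⟩ := h
  obtain ⟨κ, hκ, U, hU, hUo, hκf⟩ := exists_pair_eq_pair_localize f φ hx
  obtain ⟨A, hA⟩ := hκ.exists_approxAt_mul (m := ⌈α⌉₊) hα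
    ((Nat.le_ceil α).trans (le_add_of_nonneg_right zero_le_one))
    fun K hK => exists_approxAt_of_taylor hα hF hT hK
  refine ⟨fun y => κ y * F y, hκ.continuous.mul hF.continuous, hκ.compact.mul_right,
    ⟨_, A, hA⟩, U, hU, hUo, fun η hη hηU => ?_⟩
  rw [hκf η hη hηU, pair_eq_integral_of_forall hF.continuous (hη.mul_left hκ.smooth)
    fun ψ _ => hf ψ]
  congr 1; ext y; ring

end LocalData

/-! ### From Besov regularity to summable kernel averages -/

section Besov

variable {d : ℕ}

/-- Up to the factor `c`, the kernel is one of the test functions in the supremum, and on a compact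
set Hölder's inequality passes from `L^p` to `L¹`. -/
theorem integral_norm_kern_le {g : Distr (Rd d)} {ρ : Test (Rd d)} {B : Set (Test (Rd d))}
    {p : ℝ≥0∞} (hp : 1 ≤ p) {K : Set (Rd d)} (hK : IsCompact K) {c w : ℝ} (hc : 0 ≤ c)
    (hw : 0 ≤ w) (hB : c • ρ ∈ B) {n : ℕ} {M : ℝ≥0∞} (hM : M ≠ ⊤)
    (h : eLpNorm (fun x => ENNReal.ofReal w * scaleSup g B n x) p (volume.restrict K) ≤ M) :
    w * c * ∫ x in K, ‖kern g ρ ((1 / 2 : ℝ) ^ n) x‖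
      ≤ (M * volume K ^ (1 - 1 / p.toReal)).toReal := by
  have hl := half_pow_pos n
  set G : Rd d → ℂ := fun x => ((w * c : ℝ) : ℂ) * kern g ρ ((1 / 2 : ℝ) ^ n) x
  have hG : Continuous G := continuous_const.mul (continuous_kern g ρ hl)
  have hle : ∀ x, ‖G x‖ₑ ≤ ‖ENNReal.ofReal w * scaleSup g B n x‖ₑ := by
    intro x
    have h1 : ‖g (rescale (c • ρ) x ((1 / 2 : ℝ) ^ n) hl)‖ₑ ≤ scaleSup g B n x :=
      le_iSup₂ (f := fun ψ (_ : ψ ∈ B) => ‖g (rescale ψ x ((1 / 2 : ℝ) ^ n) hl)‖ₑ) (c • ρ) hB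
    have h2 : rescale (c • ρ) x ((1 / 2 : ℝ) ^ n) hl = c • rescale ρ x ((1 / 2 : ℝ) ^ n) hl := by
      ext y
      change _ * (c * _) = c * (_ * _)
      ring
    have h3 : G x = (w : ℂ) * g (rescale (c • ρ) x ((1 / 2 : ℝ) ^ n) hl) := by
      rw [h2, map_smul, ← kern_eq, Complex.real_smul]
      simp only [G]; push_cast; ring
    rw [h3, enorm_mul, enorm_eq_self]
    gcongr
    rw [← ofReal_norm, Complex.norm_real, Real.norm_of_nonneg hw]
  have hKt : volume K ≠ ⊤ := hK.measure_lt_top.ne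
  have hexp : 0 ≤ 1 - 1 / p.toReal := by
    rcases eq_or_ne p ⊤ with rfl | hpt
    · simp
    · have : 1 ≤ p.toReal := by
        rw [← ENNReal.toReal_one]
        exact (ENNReal.toReal_le_toReal ENNReal.one_ne_top hpt).2 hp
      rw [sub_nonneg]
      exact (div_le_one (by linarith)).2 this
  -- Hölder is applied to the continuous function `G`; the supremum enters only through
  -- monotonicity, so its measurability is not needed.
  have key : eLpNorm G 1 (volume.restrict K) ≤ M * volume K ^ (1 - 1 / p.toReal) := by
    refine (eLpNorm_le_eLpNorm_mul_rpow_measure_univ hp hG.aestronglyMeasurable).trans ?_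
    rw [Measure.restrict_apply_univ, ENNReal.toReal_one, div_one]
    gcongr
    exact (eLpNorm_mono_enorm hle).trans h
  rw [eLpNorm_one_eq_lintegral_enorm, ← ofReal_integral_norm_eq_lintegral_enorm
    (hG.continuousOn.integrableOn_compact hK)] at key
  have e : ∫ x in K, ‖G x‖ = w * c * ∫ x in K, ‖kern g ρ ((1 / 2 : ℝ) ^ n) x‖ := by
    rw [← integral_const_mul]
    congr 1; ext x
    rw [norm_mul, Complex.norm_real, Real.norm_of_nonneg (by positivity)]
  rw [e] at key
  exact (ENNReal.ofReal_le_iff_le_toReal (ENNReal.mul_ne_top hM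
    (ENNReal.rpow_ne_top_of_nonneg hexp hKt))).1 key

theorem exists_smul_mem_unitTests (r : ℕ) {ρ : Test (Rd d)} (hs : tsupport ρ ⊆ Metric.ball 0 1) :
    ∃ c : ℝ, 0 < c ∧ c • ρ ∈ unitTests d r := by
  obtain ⟨S, hS⟩ := (IsTest.ofReal ρ).exists_bound_iteratedFDeriv r
  have hS' : ∀ k ≤ r, ∀ x, ‖iteratedFDeriv ℝ k ρ x‖ ≤ S := fun k hk x =>
    le_trans (le_of_eq (Complex.ofRealLI.norm_iteratedFDeriv_comp_left ρ.contDiff.contDiffAt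
      (mod_cast le_top)).symm) (hS k hk x)
  have hS0 : 0 ≤ S := (norm_nonneg _).trans (hS 0 (Nat.zero_le _) 0)
  refine ⟨(S + 1)⁻¹, by positivity, ?_, fun k hk x => ?_⟩
  · exact (closure_mono (Function.support_const_smul_subset _ _)).trans hs
  · have e : iteratedFDeriv ℝ k (⇑((S + 1)⁻¹ • ρ)) x = (S + 1)⁻¹ • iteratedFDeriv ℝ k ρ x :=
      iteratedFDeriv_const_smul_apply (ρ.contDiff.contDiffAt.of_le (mod_cast le_top))
    rw [e, norm_smul, Real.norm_of_nonneg (by positivity), inv_mul_le_one₀ (by positivity)]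
    linarith [hS' k hk x]

/-- The difference of two consecutive dyadic rescalings of a kernel. -/
def dyadicDiff (ρ : Test (Rd d)) : Test (Rd d) where
  toFun w := (((1 / 2 : ℝ)) ^ Module.finrank ℝ (Rd d))⁻¹ * ρ ((1 / 2 : ℝ)⁻¹ • w) - ρ w
  contDiff' := (contDiff_const.mul (ρ.contDiff.comp (contDiff_id.const_smul _))).sub ρ.contDiff
  hasCompactSupport' := ((ρ.hasCompactSupport.comp_homeomorph
    (Homeomorph.smulOfNeZero (1 / 2 : ℝ)⁻¹ (by norm_num))).mul_left).sub ρ.hasCompactSupport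
  tsupport_subset' := fun _ _ => trivial

theorem tsupport_dyadicDiff_subset {ρ : Test (Rd d)} (hs : tsupport ρ ⊆ Metric.ball 0 1) :
    tsupport (dyadicDiff ρ) ⊆ Metric.ball 0 1 := by
  refine (tsupport_sub _ _).trans (Set.union_subset (tsupport_mul_subset_right.trans ?_) hs)
  have := tsupport_comp_eq_preimage ρ
    (Homeomorph.smulOfNeZero (1 / 2 : ℝ)⁻¹ (by norm_num) (α := Rd d))
  refine this.subset.trans fun w hw => ?_
  have h1 : ‖(1 / 2 : ℝ)⁻¹ • w‖ < 1 := by simpa using hs hw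
  rw [norm_smul] at h1
  norm_num at h1
  rw [mem_ball_zero_iff]
  linarith [norm_nonneg w]

/-- Both dilates have the same integral. The vanishing mean lets the bound over zero-moment tests
control the passage from one scale to the next when `γ = 0`. -/
theorem integral_dyadicDiff (ρ : Test (Rd d)) : ∫ w, dyadicDiff ρ w = 0 := by
  have h1 : Integrable ρ := ρ.continuous.integrable_of_hasCompactSupport ρ.hasCompactSupport
  have h2 : Integrable fun w : Rd d => (((1 / 2 : ℝ)) ^ Module.finrank ℝ (Rd d))⁻¹ *
      ρ ((1 / 2 : ℝ)⁻¹ • w) := (h1.comp_smul (by norm_num)).const_mul _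
  refine (integral_sub h2 h1).trans ?_
  rw [integral_const_mul, Measure.integral_comp_inv_smul_of_nonneg _ _ (by norm_num), smul_eq_mul,
    inv_mul_cancel_left₀ (by positivity), sub_self]

theorem kern_dyadicDiff (g : Distr (Rd d)) (ρ : Test (Rd d)) (n : ℕ) (x : Rd d) :
    kern g ρ ((1 / 2 : ℝ) ^ (n + 1)) x
      = kern g ρ ((1 / 2 : ℝ) ^ n) x + kern g (dyadicDiff ρ) ((1 / 2 : ℝ) ^ n) x := by
  rw [kern_eq g ρ (half_pow_pos _), kern_eq g ρ (half_pow_pos _),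
    kern_eq g (dyadicDiff ρ) (half_pow_pos _), ← map_add]
  congr 1; ext y
  set m := Module.finrank ℝ (Rd d)
  change (((1 / 2 : ℝ) ^ (n + 1)) ^ m)⁻¹ * ρ (((1 / 2 : ℝ) ^ (n + 1))⁻¹ • (x - y))
    = (((1 / 2 : ℝ) ^ n) ^ m)⁻¹ * ρ (((1 / 2 : ℝ) ^ n)⁻¹ • (x - y)) + (((1 / 2 : ℝ) ^ n) ^ m)⁻¹ *
      (((1 / 2 : ℝ) ^ m)⁻¹ * ρ ((1 / 2 : ℝ)⁻¹ • ((1 / 2 : ℝ) ^ n)⁻¹ • (x - y))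
        - ρ (((1 / 2 : ℝ) ^ n)⁻¹ • (x - y)))
  rw [smul_smul, pow_succ, mul_pow, mul_inv, mul_inv, mul_comm (1 / 2 : ℝ)⁻¹]
  ring

theorem eLpNorm_scaleSup_le_scaleNorm (γ : ℝ) (p : ℝ≥0∞) (g : Distr (Rd d))
    (B : Set (Test (Rd d))) (K : Set (Rd d)) (n : ℕ) :
    eLpNorm (fun x => ENNReal.ofReal ((2 : ℝ) ^ ((n : ℝ) * γ)) * scaleSup g B n x) p
      (volume.restrict K) ≤ scaleNorm γ p ⊤ g B K := by
  rw [scaleNorm, eLpNorm_exponent_top, eLpNormEssSup_count]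
  exact le_iSup (fun n : ℕ => ‖eLpNorm
    (fun x => ENNReal.ofReal ((2 : ℝ) ^ ((n : ℝ) * γ)) * scaleSup g B n x)
    p (volume.restrict K)‖ₑ) n

theorem two_rpow_mul (n : ℕ) (γ : ℝ) : (2 : ℝ) ^ ((n : ℝ) * γ) * ((1 / 2 : ℝ) ^ n) ^ γ = 1 := by
  rw [Real.rpow_natCast_mul (by norm_num), ← Real.mul_rpow (by positivity) (by positivity),
    ← mul_pow]
  norm_num

/-- For `γ < 0` the bound is direct and the factor `n + 1` is superfluous. For `γ = 0` the norm
bounds mean-zero kernels at all scales but general ones only at scale one, so the kernel at scale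
`2⁻ⁿ` is telescoped into `n` bounded dyadic differences. -/
theorem exists_integral_norm_kern_le {γ : ℝ} (hγ : γ ≤ 0) {p : ℝ≥0∞} (hp : 2 ≤ p)
    {g : Distr (Rd d)} (h : MemBesovLoc γ p ⊤ g) {ρ : Test (Rd d)}
    (hs : tsupport ρ ⊆ Metric.ball 0 1) {K : Set (Rd d)} (hK : IsCompact K) :
    ∃ C : ℝ, ∀ n : ℕ, ∫ x in K, ‖kern g ρ ((1 / 2 : ℝ) ^ n) x‖
      ≤ C * (n + 1) * ((1 / 2 : ℝ) ^ n) ^ γ := by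
  obtain ⟨r, hr, hB⟩ := h
  obtain ⟨hneg, hzero⟩ := hB K hK
  have hp1 : 1 ≤ p := le_trans (by norm_num) hp
  obtain ⟨c, hc, hcρ⟩ := exists_smul_mem_unitTests r hs
  rcases hγ.lt_or_eq with hγ | rfl
  · have hfin := hneg hγ
    set D := (scaleNorm γ p ⊤ g (unitTests d r) K * volume K ^ (1 - 1 / p.toReal)).toReal
    have hD : 0 ≤ D := ENNReal.toReal_nonneg
    refine ⟨D / c, fun n => ?_⟩
    have h1 := integral_norm_kern_le hp1 hK hc.le (Real.rpow_nonneg zero_le_two _) hcρ hfin.ne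
      (eLpNorm_scaleSup_le_scaleNorm γ p g _ K n)
    have h2 := two_rpow_mul n γ
    set I := ∫ x in K, ‖kern g ρ ((1 / 2 : ℝ) ^ n) x‖
    set t := ((1 / 2 : ℝ) ^ n) ^ γ
    have ht : 0 ≤ t := by positivity
    have h3 : I ≤ D / c * t := by
      rw [div_mul_eq_mul_div, le_div_iff₀ hc]
      calc I * c = (2 : ℝ) ^ ((n : ℝ) * γ) * c * I * t := by
            linear_combination (-(I * c)) * h2
        _ ≤ D * t := by gcongr
    refine h3.trans ?_
    have : 0 ≤ D / c * t := by positivity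
    nlinarith [mul_nonneg this (Nat.cast_nonneg (α := ℝ) n)]
  · have hfin := ENNReal.add_lt_top.1 (hzero le_rfl)
    obtain ⟨c', hc', hcσ⟩ := exists_smul_mem_unitTests r (tsupport_dyadicDiff_subset hs)
    -- As `⌊0⌋₊ = 0`, only the moment with `k = 0` has to vanish.
    have hcσ' : c' • dyadicDiff ρ ∈ unitTestsMoments d r ⌊(0 : ℝ)⌋₊ := by
      refine ⟨hcσ, fun k hk => ?_⟩
      have hk0 : ∀ i, k i = 0 := by
        simpa using hk
      simp only [hk0, pow_zero, Finset.prod_const_one, one_mul]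
      refine (integral_const_mul c' fun w => dyadicDiff ρ w).trans ?_
      rw [integral_dyadicDiff, mul_zero]
    have h0 := integral_norm_kern_le (g := g) (ρ := ρ) (B := unitTests d r) (n := 0) hp1 hK hc.le
      zero_le_one hcρ hfin.1.ne (by simp)
    have hn := fun n : ℕ => integral_norm_kern_le hp1 hK hc'.le (Real.rpow_nonneg zero_le_two _)
      hcσ' hfin.2.ne (eLpNorm_scaleSup_le_scaleNorm 0 p g _ K n)
    simp only [mul_zero, Real.rpow_zero, one_mul] at h0 hn
    set D₀ := (eLpNorm (scaleSup g (unitTests d r) 0) p (volume.restrict K) *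
      volume K ^ (1 - 1 / p.toReal)).toReal
    set D₁ := (scaleNorm 0 p ⊤ g (unitTestsMoments d r ⌊(0 : ℝ)⌋₊) K *
      volume K ^ (1 - 1 / p.toReal)).toReal
    have hD₀ : 0 ≤ D₀ / c := div_nonneg ENNReal.toReal_nonneg hc.le
    have hD₁ : 0 ≤ D₁ / c' := div_nonneg ENNReal.toReal_nonneg hc'.le
    refine ⟨D₀ / c + D₁ / c', fun n => ?_⟩
    rw [Real.rpow_zero, mul_one]
    have hint : ∀ σ : Test (Rd d), ∀ n : ℕ,
        IntegrableOn (fun x => ‖kern g σ ((1 / 2 : ℝ) ^ n) x‖) K := fun σ n =>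
      (continuous_kern g σ (half_pow_pos n)).norm.continuousOn.integrableOn_compact hK
    induction n with
    | zero =>
      have := (le_div_iff₀' hc).2 h0
      push_cast
      linarith
    | succ n ih =>
      have e : ∫ x in K, ‖kern g ρ ((1 / 2 : ℝ) ^ (n + 1)) x‖
          ≤ (∫ x in K, ‖kern g ρ ((1 / 2 : ℝ) ^ n) x‖)
            + ∫ x in K, ‖kern g (dyadicDiff ρ) ((1 / 2 : ℝ) ^ n) x‖ := by
        rw [← integral_add (hint _ _) (hint _ _)]
        refine integral_mono (hint _ _) ((hint _ _).add (hint _ _)) fun x => ?_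
        rw [kern_dyadicDiff]
        exact norm_add_le _ _
      have := (le_div_iff₀' hc').2 (hn n)
      push_cast
      linarith

/-- The weights combine to `(n + 1) qⁿ` with `q = 2^(-(α + γ)) < 1`, so the linear loss at `γ = 0`
does no harm. -/
theorem summableKern_of_memBesovLoc {α γ : ℝ} (hαγ : 0 < α + γ) (hγ : γ ≤ 0) {p : ℝ≥0∞}
    (hp : 2 ≤ p) {g : Distr (Rd d)} (h : MemBesovLoc γ p ⊤ g) {ρ : Test (Rd d)}
    (hs : tsupport ρ ⊆ Metric.ball 0 1) : SummableKern α g ρ := by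
  intro K hK
  obtain ⟨C, hC⟩ := exists_integral_norm_kern_le hγ hp h hs hK
  set q : ℝ := (1 / 2 : ℝ) ^ (α + γ)
  have hq0 : 0 ≤ q := by positivity
  have hq1 : ‖q‖ < 1 := by
    rw [Real.norm_of_nonneg hq0]
    exact Real.rpow_lt_one (by norm_num) (by norm_num) hαγ
  have hsum : Summable fun n : ℕ => C * ((n : ℝ) ^ 1 * q ^ n + (n : ℝ) ^ 0 * q ^ n) :=
    ((summable_pow_mul_geometric_of_norm_lt_one 1 hq1).add
      (summable_pow_mul_geometric_of_norm_lt_one 0 hq1)).mul_left C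
  refine Summable.of_nonneg_of_le (fun n => mul_nonneg (by positivity)
    (integral_nonneg fun _ => norm_nonneg _)) (fun n => ?_) hsum
  have e : q ^ n = ((1 / 2 : ℝ) ^ n) ^ α * ((1 / 2 : ℝ) ^ n) ^ γ := by
    rw [← Real.rpow_add (half_pow_pos n), ← Real.rpow_natCast, ← Real.rpow_natCast,
      ← Real.rpow_mul (by norm_num), ← Real.rpow_mul (by norm_num), mul_comm]
  calc _ ≤ ((1 / 2 : ℝ) ^ n) ^ α * (C * (n + 1) * ((1 / 2 : ℝ) ^ n) ^ γ) := by
        gcongr; exact hC n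
    _ = _ := by rw [e]; ring

/-- A bound uniform in `x` and in the scale is a Besov bound with both exponents infinite. -/
theorem memBesovLoc_of_memHolderNegLoc {β : ℝ} (hβ : β < 0) {g : Distr (Rd d)}
    (h : MemHolderNegLoc β g) : MemBesovLoc β ⊤ ⊤ g := by
  refine ⟨⌊-β⌋₊ + 1, by exact_mod_cast Nat.lt_floor_add_one (-β), fun K hK =>
    ⟨fun _ => ?_, fun h0 => absurd h0 hβ.not_ge⟩⟩
  obtain ⟨C, hC⟩ := h K hK
  refine lt_of_le_of_lt (b := ENNReal.ofReal C) ?_ ENNReal.ofReal_lt_top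
  rw [scaleNorm, eLpNorm_exponent_top, eLpNormEssSup_count]
  refine iSup_le fun n => ?_
  rw [enorm_eq_self, eLpNorm_exponent_top]
  refine eLpNormEssSup_le_of_ae_enorm_bound ?_
  filter_upwards [ae_restrict_mem hK.measurableSet] with x hx
  rw [enorm_eq_self]
  have h1 : scaleSup g (unitTests d (⌊-β⌋₊ + 1)) n x
      ≤ ENNReal.ofReal (C * ((1 / 2 : ℝ) ^ n) ^ β) := by
    refine iSup₂_le fun ψ hψ => ?_
    rw [← ofReal_norm]
    exact ENNReal.ofReal_le_ofReal (hC x hx _ (half_pow_pos n) (half_pow_le_one n) ψ hψ)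
  calc _ ≤ ENNReal.ofReal ((2 : ℝ) ^ ((n : ℝ) * β)) * ENNReal.ofReal (C * ((1 / 2 : ℝ) ^ n) ^ β) := by
        gcongr
    _ = ENNReal.ofReal C := by
        rw [← ENNReal.ofReal_mul (by positivity)]
        congr 1
        linear_combination C * two_rpow_mul n β

theorem summableKern_of_betaStar {α β : ℝ} (hβ : β < 0) {g : Distr (Rd d)}
    (h : MemHolderNegLoc β g) (hα : 0 < α + betaStar g) {ρ : Test (Rd d)}
    (hs : tsupport ρ ⊆ Metric.ball 0 1) : SummableKern α g ρ := by
  -- The real supremum of an empty set would be the default value `0`. The negative Hölder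
  -- hypothesis excludes this, so an actual Besov exponent above `-α` can be extracted.
  have hne : {γ : ℝ | γ ≤ 0 ∧ ∃ p : ℝ≥0∞, 2 ≤ p ∧ MemBesovLoc γ p ⊤ g}.Nonempty :=
    ⟨β, hβ.le, ⊤, le_top, memBesovLoc_of_memHolderNegLoc hβ h⟩
  obtain ⟨γ, ⟨hγ, p, hp, hmem⟩, hlt⟩ := exists_lt_of_lt_csSup hne
    (show -α < betaStar g by linarith)
  exact summableKern_of_memBesovLoc (by linarith) hγ hp hmem hs

end Besov

/-! ### Gluing local products, and uniqueness -/

section Gluing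

variable {d : ℕ}

theorem IsTest.mul_regularize {η : Rd d → ℂ} (hη : IsTest η) (u : Distr (Rd d × Rd d))
    (Θ : Test (Rd d × Rd d)) : IsTest fun x => η x * regularize u Θ (x, x) := by
  have ht : IsTest fun r : Rd d × (Rd d × Rd d) => η r.1 * (Θ ((r.1, r.1) - r.2) : ℂ) := by
    refine ⟨(hη.smooth.comp contDiff_fst).mul ((IsTest.ofReal Θ).smooth.comp (by fun_prop)), ?_⟩
    refine HasCompactSupport.intro ((hη.compact.isCompact.prod
      Θ.hasCompactSupport.isCompact).image
        (f := fun r : Rd d × (Rd d × Rd d) => (r.1, (r.1, r.1) - r.2)) (by fun_prop)) ?_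
    rintro ⟨x, q⟩ hxq
    by_contra hne
    apply hxq
    have h1 : η x ≠ 0 := fun h => hne (by simp [h])
    have h2 : Θ ((x, x) - q) ≠ 0 := fun h => hne (by simp only [h]; simp)
    exact ⟨(x, (x, x) - q), ⟨subset_tsupport _ h1, subset_tsupport _ h2⟩, by simp⟩
  have e : (fun x => η x * regularize u Θ (x, x))
      = fun x => pair u fun q => η x * (Θ ((x, x) - q) : ℂ) := by
    ext x
    have h1 : IsTest fun q => (Θ ((x, x) - q) : ℂ) := IsTest.ofReal (reflect Θ (x, x))
    rw [pair_const_mul u h1]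
    congr 1
    exact (pair_ofReal u (reflect Θ (x, x))).symm
  rw [e]
  exact ht.pair_slice u

theorem IsTest.integrable {φ : Rd d → ℂ} (h : IsTest φ) : Integrable φ :=
  h.continuous.integrable_of_hasCompactSupport h.compact

/-- The product of test functions as a test function. -/
def mulTest (χ ψ : Test (Rd d)) : Test (Rd d) := mulCLM χ χ.contDiff ψ

theorem mulTest_apply (χ ψ : Test (Rd d)) (x : Rd d) : mulTest χ ψ x = ψ x * χ x := rfl

/-- Inclusion–exclusion: the new cutoff is `1` wherever one of the two is, and the correction term
is the first local product tested against `χ₂ ψ`. -/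
theorem HasLocalProduct.union {f g : Distr (Rd d)} {χ₁ χ₂ : Test (Rd d)}
    (h₁ : HasLocalProduct f g χ₁) (h₂ : HasLocalProduct f g χ₂) :
    HasLocalProduct f g (χ₁ + χ₂ - mulTest χ₁ χ₂) := by
  obtain ⟨T₁, hT₁⟩ := h₁
  obtain ⟨T₂, hT₂⟩ := h₂
  let T₃ : Distr (Rd d) :=
    { toFun := fun ψ => T₁ (mulTest χ₂ ψ)
      map_add' := fun φ ψ => by simp only [mulTest, map_add]
      map_smul' := fun c ψ => by simp only [mulTest, map_smul, RingHom.id_apply]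
      cont := T₁.continuous.comp (mulCLM χ₂ χ₂.contDiff).continuous }
  refine ⟨T₁ + T₂ - T₃, fun Θ hΘ ψ => ?_⟩
  have h := ((hT₁ Θ hΘ ψ).add (hT₂ Θ hΘ ψ)).sub (hT₁ Θ hΘ (mulTest χ₂ ψ))
  refine h.congr fun n => ?_
  have i1 := ((IsTest.cutoff_mul χ₁ ψ).mul_regularize (tensor f g) (Θ n)).integrable
  have i2 := ((IsTest.cutoff_mul χ₂ ψ).mul_regularize (tensor f g) (Θ n)).integrable
  have i3 := ((IsTest.cutoff_mul χ₁ (mulTest χ₂ ψ)).mul_regularize (tensor f g) (Θ n)).integrable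
  refine (congrArg (· - _) (integral_add i1 i2).symm).trans
    ((integral_sub (i1.add i2) i3).symm.trans ?_)
  congr 1; ext x
  have e : (χ₁ + χ₂ - mulTest χ₁ χ₂) x = χ₁ x + χ₂ x - χ₂ x * χ₁ x := rfl
  rw [e, mulTest_apply]
  simp only [Pi.add_apply]
  push_cast
  ring

theorem exists_hasLocalProduct_of_isCompact {f g : Distr (Rd d)}
    (h : ∀ x, ∃ U ∈ 𝓝 x, ∀ χ : Test (Rd d), tsupport χ ⊆ U → HasLocalProduct f g χ)
    {K : Set (Rd d)} (hK : IsCompact K) :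
    ∃ χ : Test (Rd d), HasLocalProduct f g χ ∧ ∀ x ∈ K, χ x = 1 := by
  refine hK.induction_on (p := fun K => ∃ χ : Test (Rd d), HasLocalProduct f g χ ∧
    ∀ x ∈ K, χ x = 1) ⟨0, ⟨0, fun Θ hΘ ψ => by simp⟩, by simp⟩ ?_ ?_ ?_
  · rintro s t hst ⟨χ, hχ, h1⟩
    exact ⟨χ, hχ, fun x hx => h1 x (hst hx)⟩
  · rintro s t ⟨χ₁, h₁, e₁⟩ ⟨χ₂, h₂, e₂⟩
    refine ⟨_, h₁.union h₂, fun x hx => ?_⟩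
    change χ₁ x + χ₂ x - χ₂ x * χ₁ x = 1
    rcases hx with hx | hx
    · rw [e₁ x hx]; ring
    · rw [e₂ x hx]; ring
  · intro x hx
    obtain ⟨U, hU, hUχ⟩ := h x
    obtain ⟨χ, hχU, hχ⟩ := exists_cutoff (isCompact_singleton (x := x)) isOpen_interior
      (Set.singleton_subset_iff.2 (mem_interior_iff_mem_nhds.2 hU))
    rw [nhdsSet_singleton] at hχ
    exact ⟨{y | χ y = 1}, mem_nhdsWithin_of_mem_nhds hχ, χ, hUχ χ (hχU.trans interior_subset),
      fun y hy => hy⟩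

/-- Tensor-shaped delta sequences serve twice: as a reference sequence that identifies limits, and
for uniqueness, where `u` is known on tensors only. -/
theorem exists_isDeltaSeq_tensorTest (d : ℕ) :
    ∃ θ : ℕ → Test (Rd d), IsDeltaSeq fun n => tensorTest (θ n) (θ n) := by
  choose θ hθ h1 h0 using fun n : ℕ => exists_bump (E := Rd d) (Nat.one_div_pos_of_nat (n := n))
  have hint : ∀ G : Rd d → ℝ, ∫ q : Rd d × Rd d, G q.1 * G q.2 = (∫ x, G x) * ∫ x, G x :=
    fun G => integral_prod_mul (μ := volume) (ν := volume) G G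
  have hn : ∀ n, ∫ q, tensorTest (θ n) (θ n) q = 1 := fun n =>
    (hint (θ n)).trans (by rw [h1, one_mul])
  refine ⟨θ, hn, ⟨1, fun n => ?_⟩, fun ε hε => ?_⟩
  · refine le_of_eq (Eq.trans ?_ (hn n))
    congr 1; ext q
    exact Real.norm_of_nonneg (mul_nonneg (h0 n _) (h0 n _))
  · obtain ⟨N, hN⟩ := exists_nat_one_div_lt hε
    filter_upwards [eventually_ge_atTop N] with n hn
    have hle : (1 : ℝ) / (n + 1) < ε := (Nat.one_div_le_one_div hn).trans_lt hN
    have hsub : tsupport (tensorTest (θ n) (θ n)) ⊆ tsupport (θ n) ×ˢ tsupport (θ n) := by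
      refine closure_minimal (fun q hq => ?_) ((isClosed_tsupport _).prod (isClosed_tsupport _))
      have hq' : θ n q.1 * θ n q.2 ≠ 0 := hq
      exact ⟨subset_tsupport _ (left_ne_zero_of_mul hq'),
        subset_tsupport _ (right_ne_zero_of_mul hq')⟩
    intro q hq
    have h2 := hsub hq
    have a1 : ‖q.1‖ < ε := by simpa using (mem_ball_zero_iff.1 (hθ n h2.1)).trans hle
    have a2 : ‖q.2‖ < ε := by simpa using (mem_ball_zero_iff.1 (hθ n h2.2)).trans hle
    rw [mem_ball_zero_iff, Prod.norm_def]
    exact max_lt a1 a2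

/-- The local products are restrictions of one distribution. -/
theorem exists_isDiagonalPullback {f g : Distr (Rd d)}
    (h : ∀ x, ∃ U ∈ 𝓝 x, ∀ χ : Test (Rd d), tsupport χ ⊆ U → HasLocalProduct f g χ) :
    ∃ T : Distr (Rd d), IsDiagonalPullback (tensor f g) T := by
  obtain ⟨θ, hθ⟩ := exists_isDeltaSeq_tensorTest d
  have hK : ∀ K : Set (Rd d), IsCompact K → ∃ T : Distr (Rd d),
      ∀ Θ : ℕ → Test (Rd d × Rd d), IsDeltaSeq Θ → ∀ ψ : Test (Rd d), tsupport ψ ⊆ K →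
        Tendsto (fun n => ∫ x, (ψ x : ℂ) * regularize (tensor f g) (Θ n) (x, x)) atTop
          (𝓝 (T ψ)) := by
    intro K hK
    obtain ⟨χ, ⟨T, hT⟩, hχ⟩ := exists_hasLocalProduct_of_isCompact h hK
    refine ⟨T, fun Θ hΘ ψ hψ => (hT Θ hΘ ψ).congr fun n => ?_⟩
    congr 1; ext x
    by_cases hx : x ∈ tsupport ψ
    · rw [hχ x (hψ hx), Complex.ofReal_one, one_mul]
    · rw [image_eq_zero_of_notMem_tsupport hx]; simp
  -- The limit for `ψ` comes from a cutoff equal to one on the support of `ψ`. It is the same for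
  -- all delta sequences, so values chosen for different `ψ` can be compared along `θ ⊗ θ`.
  have hL : ∀ ψ : Test (Rd d), ∃ L : ℂ, ∀ Θ : ℕ → Test (Rd d × Rd d), IsDeltaSeq Θ →
      Tendsto (fun n => ∫ x, (ψ x : ℂ) * regularize (tensor f g) (Θ n) (x, x)) atTop (𝓝 L) := by
    intro ψ
    obtain ⟨T, hT⟩ := hK _ ψ.hasCompactSupport.isCompact
    exact ⟨T ψ, fun Θ hΘ => hT Θ hΘ ψ le_rfl⟩
  choose L hL using hL
  have hint : ∀ (ψ : Test (Rd d)) (n : ℕ), Integrable fun x => (ψ x : ℂ) *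
      regularize (tensor f g) (tensorTest (θ n) (θ n)) (x, x) := fun ψ n =>
    ((IsTest.ofReal ψ).mul_regularize _ _).integrable
  refine ⟨mkDistr L (fun φ ψ => ?_) (fun c φ => ?_) fun K hKc => ?_, fun Θ hΘ ψ => hL ψ Θ hΘ⟩
  · refine tendsto_nhds_unique (hL (φ + ψ) _ hθ) (((hL φ _ hθ).add (hL ψ _ hθ)).congr fun n => ?_)
    rw [← integral_add (hint φ n) (hint ψ n)]
    congr 1; ext x
    simp only [FunLike.coe_add, Pi.add_apply, Complex.ofReal_add]
    ring
  · refine tendsto_nhds_unique (hL (c • φ) _ hθ) (((hL φ _ hθ).const_smul c).congr fun n => ?_)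
    rw [← integral_smul]
    congr 1; ext x
    simp only [FunLike.coe_smul, Pi.smul_apply, smul_eq_mul, Complex.ofReal_mul, Complex.real_smul]
    ring
  -- For test functions supported in `K`, the chosen limits coincide with a single distribution,
  -- whose order on `K` bounds them.
  · obtain ⟨T, hT⟩ := hK K hKc
    obtain ⟨N, C, hC, hb⟩ := exists_bound_real T hKc
    refine ⟨N, C, hC, fun φ hφ S hS => ?_⟩
    rw [tendsto_nhds_unique (hL φ _ hθ) (hT _ hθ φ hφ)]
    exact hb φ hφ S hS

theorem regularize_tensorTest {f g : Distr (Rd d)} {u : Distr (Rd d × Rd d)}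
    (hu : IsTensorProduct f g u) (θ : Test (Rd d)) (x : Rd d) :
    regularize u (tensorTest θ θ) (x, x) = f (reflect θ x) * g (reflect θ x) :=
  hu (reflect θ x) (reflect θ x)

/-- Along `θ ⊗ θ` both regularized products equal `f(θ(x - ·)) g(θ(x - ·))`, so the limits agree
without first showing that the two tensor products do. -/
theorem IsCanonicalProduct.unique {f g h₁ h₂ : Distr (Rd d)} (H₁ : IsCanonicalProduct f g h₁)
    (H₂ : IsCanonicalProduct f g h₂) : h₁ = h₂ := by
  obtain ⟨u₁, hu₁, hp₁⟩ := H₁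
  obtain ⟨u₂, hu₂, hp₂⟩ := H₂
  obtain ⟨θ, hθ⟩ := exists_isDeltaSeq_tensorTest d
  ext ψ
  have l₁ := hp₁ _ hθ ψ
  have l₂ := hp₂ _ hθ ψ
  simp only [regularize_tensorTest hu₁] at l₁
  simp only [regularize_tensorTest hu₂] at l₂
  exact tendsto_nhds_unique l₁ l₂

end Gluing

end

end MicrolocalYoung

/-! ### The main theorem -/

open MicrolocalYoung in
theorem theorem1p1 (d : ℕ) (f g : Distr (Rd d))
    (hfg : ∀ x ∈ singSupp f ∩ singSupp g, ∃ φf φg : CTest (Rd d), φf x ≠ 0 ∧ φg x ≠ 0 ∧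
      ∃ α β : ℝ, 0 < α ∧ β < 0 ∧
        MemHolderPosCompact α (localize φf f) ∧ MemHolderNegCompact β (localize φg g) ∧
        0 < α + betaStar (localize φg g)) :
    ∃! h : Distr (Rd d), IsCanonicalProduct f g h := by
  have hloc : ∀ x, ∃ U ∈ 𝓝 x, ∀ χ : Test (Rd d), tsupport χ ⊆ U → HasLocalProduct f g χ := by
    intro x
    by_cases hxf : x ∈ singSupp f
    · by_cases hxg : x ∈ singSupp g
      · obtain ⟨φf, φg, hφf, hφg, α, β, hα, hβ, hf, hg, hαβ⟩ := hfg x ⟨hxf, hxg⟩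
        obtain ⟨F, hF, hFc, ⟨n, A, hA⟩, U, hU, hUo, hfU⟩ :=
          exists_eqFunOn_of_memHolderPosLoc hφf hα hf.1
        obtain ⟨κ, hκ, V, hV, hVo, hgV⟩ := exists_pair_eq_pair_localize g φg hφg
        refine ⟨U ∩ V, inter_mem hU hV, fun χ hχ => ?_⟩
        -- On `U ∩ V` the distribution `f` is the Hölder function `F`, and `g` is `κ` times its
        -- localization, whose kernel averages are summable against the weights of order `α`.
        exact hasLocalProduct_of_approxAt hF hFc hα hA hκ
          (fun ρ hρ => summableKern_of_betaStar hβ hg.1 hαβ hρ) (hUo.inter hVo)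
          (fun φ hφ h => hfU φ hφ (h.trans Set.inter_subset_left))
          (fun φ hφ h => hgV φ hφ (h.trans Set.inter_subset_right)) hχ
      · obtain ⟨G, hG, U, hU, hUo, hgU⟩ := exists_eqFunOn_of_notMem_singSupp hxg
        exact ⟨U, hU, fun χ hχ => hasLocalProduct_of_smooth_right f hG hUo hgU hχ⟩
    · obtain ⟨F, hF, U, hU, hUo, hfU⟩ := exists_eqFunOn_of_notMem_singSupp hxf
      exact ⟨U, hU, fun χ hχ => hasLocalProduct_of_smooth_left g hF hUo hfU hχ⟩
  obtain ⟨T, hT⟩ := exists_isDiagonalPullback hloc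
  have hprod : IsCanonicalProduct f g T := ⟨_, isTensorProduct_tensor f g, hT⟩
  exact ⟨T, hprod, fun h hh => hh.unique hprod⟩
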